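/- Let $\varepsilon\in\{1,-1\}$ and let $\mathbb K=\{x+\omega y: x,y\in\mathbb R\}$ with $\omega^2=-\varepsilon$, so $\mathbb K=\mathbb C$ ($\omega=i$) if $\varepsilon=1$, and $\mathbb K$ is the algebra of paracomplex (Lorentz) numbers ($\omega=\tau$, $\tau^2=1$) if $\varepsilon=-1$. Write $\overline{x+\omega y}=x-\omega y$, $z=x+\omega y$, $\partial_z=\frac12(\partial_x-\varepsilon\omega\,\partial_y)$ and $\partial_{\bar z}=\frac12(\partial_x+\varepsilon\omega\,\partial_y)$. A smooth $\mathbb K$-valued function $h$ is $\mathbb K$-holomorphic if $h_{\bar z}=0$, and then $h'=h_z$. A (para)meromorphic function is locally a quotient $P/Q$ of $\mathbb K$-holomorphic functions without common zero (if $\varepsilon=-1$: whose components in $\mathbb K\cong\mathbb R\oplus\mathbb R$ have no common zero), with $Q$ invertible on a dense set; its poles are the points where $Q$ is not invertible, and a pole is simple if $Q$ (if $\varepsilon=-1$: every component of $Q$ that vanishes there) has nonzero derivative there. Let $\mathbb L^3$ be $\mathbb R^3$ with $\langle u,v\rangle=u_1v_1+u_2v_2-u_3v_3$ and let $\times$ be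 the cross product with $\langle u\times v,w\rangle=\det(u,v,w)$. For a conformal immersion $\psi$ (with $\langle\psi_x,\psi_x\rangle=E=\varepsilon\langle\psi_y,\psi_y\rangle>0$ and $\langle\psi_x,\psi_y\rangle=0$) let $N=-\varepsilon\,\psi_x\times\psi_y/E$ be the oriented unit normal, $l=\langle\psi_{xx},N\rangle$, $m=\langle\psi_{xy},N\rangle$, $n=\langle\psi_{yy},N\rangle$, $\mathrm{II}=l\,dx^2+2m\,dx\,dy+n\,dy^2$, $H=-\frac{\varepsilon l+n}{2E}$ and $K=\frac{m^2-ln}{E^2}$; the principal curvatures are the eigenvalues of the Weingarten map $-dN$. The Weierstrass pair $(f\,dz,g)$ of $\psi$, with $\phi=\psi_z$, is $$(f,g)=\Big(2(\phi_1-i\phi_2),\ \frac{\phi_3}{-\phi_1+i\phi_2}\Big)\ \text{ if }\varepsilon=1,\qquad (f,g)=\Big(2(\phi_2+\tau\phi_3),\ \frac{\phi_1}{\phi_2+\tau\phi_3}\Big)\ \text{ if }\varepsilon=-1 .$$ Proposition. Let $\Omega\subset\mathbb R^2\equiv\mathbb K$ be open and simply connected (in particular nonempty and connected), and let $\lambda:\Omega\to\mathbb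 R$ be a smooth solution of the Liouville equation $$\Delta\lambda=-\varepsilon e^{-4\lambda},\qquad \Delta=e^{-2\lambda}(\partial_x^2+\varepsilon\,\partial_y^2),$$ where $\Delta$ is the Laplace–Beltrami operator of the metric $e^{2\lambda}(dx^2+\varepsilon\,dy^2)$. Then there is a smooth immersion $\psi:\Omega\to\mathbb L^3$ for which $z$ is a Liouville parameter with conformal factor $e^{2\lambda}$, that is, $$\mathrm I=e^{2\lambda}(dx^2+\varepsilon\,dy^2),\qquad \mathrm{II}=dx^2-\varepsilon\,dy^2 .$$ It is unique up to a rigid motion: if $\psi$ is such an immersion, then the others are exactly the maps $A\psi+b$ with $b\in\mathbb L^3$ and $A$ a pseudo-orthogonal linear map with $\det A=1$. Every such immersion $\psi$ is spacelike if $\varepsilon=1$ and timelike if $\varepsilon=-1$, satisfies $\langle N,N\rangle=-\varepsilon$, is minimal ($H=0$), has no umbilic points, and has the following properties. i) The coordinate lines are lines of curvature. The principal curvatures are $k_1=e^{-2\lambda}$ (in the direction of $\psi_x$) and $k_2=-e^{-2\lambda}$ (in the direction of $\psi_y$), the Gaussian curvature is $K=-\varepsilon k_1k_2=\varepsilon e^{-4\lambda}$,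 so $\varepsilon K>0$, and $dN_p$ is diagonalizable at every $p\in\Omega$. ii) In the Weierstrass pair $(f\,dz,g)$ of $\psi$, the function $f$ is $\mathbb K$-holomorphic on $\Omega$ and $g$ is (para)meromorphic on $\Omega$; the poles of $g$ are exactly the points where $f$ is not invertible, and all of them are simple. At all other points $g'\overline{g'}>0$, $g\overline g\neq\varepsilon$, $f=-\varepsilon/g'$, and $2\psi_z=\big(\tfrac12f(1+g^2),\tfrac i2f(1-g^2),-fg\big)$ if $\varepsilon=1$, respectively $2\psi_z=\big(fg,\tfrac12f(1-g^2),\tfrac\tau2f(1+g^2)\big)$ if $\varepsilon=-1$. iii) At all points of $\Omega$ that are not poles of $g$, $$e^{2\lambda}=\frac{(1-\varepsilon g\overline g)^2}{4g'\overline{g'}} .$$ -/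

import Mathlib

open scoped ContDiff

noncomputable section

namespace LiouvilleMinimal

/-- The algebra `𝕂` of numbers `x + ω y` with `x, y` real and `ω² = -ε`: the complex numbers for
`ε = 1` (with `ω = i`), the paracomplex (Lorentz) numbers for `ε = -1` (with `ω = τ`, `τ² = 1`).
In Mathlib `star (x + ω y) = x - ω y`, `norm z = z * star z = x² + ε y²` (a real number), and
`z⁻¹ = (norm z)⁻¹ • star z`, which inverts `z` exactly when `norm z ≠ 0`, that is, when `z` is
a unit. -/
abbrev KNum (ε : ℝ) : Type := QuadraticAlgebra ℝ (-ε) 0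

/-- The imaginary unit of `𝕂`. -/
def unitI (ε : ℝ) : KNum ε := QuadraticAlgebra.omega

/-! ### Calculus on the parameter plane

A point `(x, y)` of `ℝ × ℝ` stands for the number `z = x + ω y`. -/

/-- The partial derivative with respect to `x`. -/
def dX {V : Type*} [NormedAddCommGroup V] [NormedSpace ℝ V] (f : ℝ × ℝ → V) (p : ℝ × ℝ) : V :=
  fderiv ℝ f p (1, 0)

/-- The partial derivative with respect to `y`. -/
def dY {V : Type*} [NormedAddCommGroup V] [NormedSpace ℝ V] (f : ℝ × ℝ → V) (p : ℝ × ℝ) : V :=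
  fderiv ℝ f p (0, 1)

/-- The partial derivative with respect to `x` of a `𝕂`-valued function. -/
def kdX {ε : ℝ} (f : ℝ × ℝ → KNum ε) (p : ℝ × ℝ) : KNum ε :=
  ⟨dX (fun q => (f q).re) p, dX (fun q => (f q).im) p⟩

/-- The partial derivative with respect to `y` of a `𝕂`-valued function. -/
def kdY {ε : ℝ} (f : ℝ × ℝ → KNum ε) (p : ℝ × ℝ) : KNum ε :=
  ⟨dY (fun q => (f q).re) p, dY (fun q => (f q).im) p⟩

/-- `∂/∂z`, that is `(∂x - i ∂y) / 2` for `ε = 1` and `(∂x + τ ∂y) / 2` for `ε = -1`.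
On `𝕂`-holomorphic functions this is the derivative `f'`. -/
def dz {ε : ℝ} (f : ℝ × ℝ → KNum ε) (p : ℝ × ℝ) : KNum ε :=
  (1 / 2 : ℝ) • (kdX f p - ε • (unitI ε * kdY f p))

/-- `∂/∂z̄`, that is `(∂x + i ∂y) / 2` for `ε = 1` and `(∂x - τ ∂y) / 2` for `ε = -1`. -/
def dzbar {ε : ℝ} (f : ℝ × ℝ → KNum ε) (p : ℝ × ℝ) : KNum ε :=
  (1 / 2 : ℝ) • (kdX f p + ε • (unitI ε * kdY f p))

/-- `f` is (smooth and) `𝕂`-holomorphic on `U`. -/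
def KHolomorphicOn {ε : ℝ} (f : ℝ × ℝ → KNum ε) (U : Set (ℝ × ℝ)) : Prop :=
  ContDiffOn ℝ ∞ (fun q => (f q).re) U ∧ ContDiffOn ℝ ∞ (fun q => (f q).im) U ∧
    ∀ p ∈ U, dzbar f p = 0

/-- On `U`, the function `g` is the quotient in lowest terms of the `𝕂`-holomorphic functions
`P` and `Q`, with pole set `S`: `Q` is invertible exactly off `S`, the points where it is
invertible are dense, and no nonzero number annihilates `P` and `Q` at the same point
(for `ε = 1`: `P` and `Q` have no common zero; for `ε = -1`: neither have their components in
`𝕂 ≅ ℝ ⊕ ℝ`). The values of `g` on `S` play no role. -/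
structure IsQuotientOn {ε : ℝ} (g P Q : ℝ × ℝ → KNum ε) (S U : Set (ℝ × ℝ)) : Prop where
  num : KHolomorphicOn P U
  den : KHolomorphicOn Q U
  pole : ∀ q ∈ U, q ∈ S ↔ ¬ IsUnit (Q q)
  dense : U ⊆ closure (U \ S)
  coprime : ∀ q ∈ U, ∀ k : KNum ε, k * P q = 0 → k * Q q = 0 → k = 0
  eq_div : ∀ q ∈ U \ S, g q = P q / Q q

/-- `g` is a (para)meromorphic function on `Ω` with pole set `S`. -/
def IsMeromorphicWithPoles {ε : ℝ} (g : ℝ × ℝ → KNum ε) (S Ω : Set (ℝ × ℝ)) : Prop :=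
  S ⊆ Ω ∧ ∀ p ∈ Ω, ∃ U P Q, IsOpen U ∧ p ∈ U ∧ U ⊆ Ω ∧ IsQuotientOn g P Q S U

/-- All poles of `g` are simple: near each pole `p`, `g = P / Q` in lowest terms, where `Q` has
a simple zero at `p` (for `ε = -1`: every component of `Q` in `𝕂 ≅ ℝ ⊕ ℝ` that vanishes at `p`
has nonzero derivative at `p`). -/
def HasOnlySimplePoles {ε : ℝ} (g : ℝ × ℝ → KNum ε) (S : Set (ℝ × ℝ)) : Prop :=
  ∀ p ∈ S, ∃ U P Q, IsOpen U ∧ p ∈ U ∧ IsQuotientOn g P Q S U ∧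
    ∀ k : KNum ε, k ≠ 0 → k * Q p = 0 → k * dz Q p ≠ 0

/-- The Laplace–Beltrami operator of the metric `e^{2λ} (dx² + ε dy²)`. -/
def laplaceBeltrami (ε : ℝ) (lam u : ℝ × ℝ → ℝ) (p : ℝ × ℝ) : ℝ :=
  Real.exp (-2 * lam p) * (dX (dX u) p + ε * dY (dY u) p)

/-! ### The Lorentz–Minkowski space -/

/-- The underlying vector space of `𝕃³`. -/
abbrev L3 : Type := Fin 3 → ℝ

/-- The Lorentzian metric `dx₁² + dx₂² - dx₃²`. -/
def lor (u v : L3) : ℝ := u 0 * v 0 + u 1 * v 1 - u 2 * v 2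

/-- The Lorentzian cross product, determined by `lor (lcross u v) w = det (u, v, w)`. -/
def lcross (u v : L3) : L3 :=
  ![u 1 * v 2 - u 2 * v 1, u 2 * v 0 - u 0 * v 2, u 1 * v 0 - u 0 * v 1]

/-- A rigid motion of `𝕃³`: `x ↦ A x + b` with `A` pseudo-orthogonal of determinant `1`. -/
def IsRigidMotion (Φ : L3 → L3) : Prop :=
  ∃ (A : L3 →ₗ[ℝ] L3) (b : L3), (∀ u v, lor (A u) (A v) = lor u v) ∧
    LinearMap.det A = 1 ∧ ∀ x, Φ x = A x + b

/-! ### Surfaces in `𝕃³` -/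

section Surfaces

variable (ε : ℝ) (ψ : ℝ × ℝ → L3) (p : ℝ × ℝ)

/-- The coefficient `E` of the first fundamental form. -/
def coeffE : ℝ := lor (dX ψ p) (dX ψ p)

/-- The coefficient `F` of the first fundamental form. -/
def coeffF : ℝ := lor (dX ψ p) (dY ψ p)

/-- The coefficient `G` of the first fundamental form. -/
def coeffG : ℝ := lor (dY ψ p) (dY ψ p)

/-- The oriented unit normal of a conformal immersion, `⟨N, N⟩ = -ε`. With the cross product
`lcross`, the orientation `-ε` is the one for which the Hopf differential of the Weierstrass
representation below is `2 ⟨ψ_zz, N⟩ dz² = -ε f g' dz²` in both cases. -/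
def normalN : L3 := (-ε / coeffE ψ p) • lcross (dX ψ p) (dY ψ p)

/-- The coefficient `l` of the second fundamental form. -/
def coeffl : ℝ := lor (dX (dX ψ) p) (normalN ε ψ p)

/-- The coefficient `m` of the second fundamental form. -/
def coeffm : ℝ := lor (dX (dY ψ) p) (normalN ε ψ p)

/-- The coefficient `n` of the second fundamental form. -/
def coeffn : ℝ := lor (dY (dY ψ) p) (normalN ε ψ p)

/-- The mean curvature; in conformal coordinates (`F = 0`, `G = ε E`) it is
`-(ε l + n) / (2 E)`. -/
def meanCurvature : ℝ :=
  -ε * (coeffl ε ψ p * coeffG ψ p - 2 * coeffm ε ψ p * coeffF ψ p + coeffn ε ψ p * coeffE ψ p) /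
    (2 * (coeffE ψ p * coeffG ψ p - coeffF ψ p ^ 2))

/-- The Gaussian curvature; in conformal coordinates it is `(m² - l n) / E²`. -/
def gaussCurvature : ℝ :=
  -ε * (coeffl ε ψ p * coeffn ε ψ p - coeffm ε ψ p ^ 2) /
    (coeffE ψ p * coeffG ψ p - coeffF ψ p ^ 2)

/-- The tangent vector `dψ(v)` is an eigenvector of the Weingarten map `-dN` with
eigenvalue `k`. -/
def IsPrincipal (k : ℝ) (v : ℝ × ℝ) : Prop :=
  v ≠ 0 ∧ -fderiv ℝ (normalN ε ψ) p v = k • fderiv ℝ ψ p v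

/-- `k` is a principal curvature at `p`. -/
def IsPrincipalCurvature (k : ℝ) : Prop := ∃ v, IsPrincipal ε ψ p k v

/-- The Weingarten map at `p` has a basis of eigenvectors. -/
def IsWeingartenDiagonalizable : Prop :=
  ∃ v w : ℝ × ℝ, LinearIndependent ℝ ![v, w] ∧
    (∃ k, IsPrincipal ε ψ p k v) ∧ ∃ k, IsPrincipal ε ψ p k w

/-- `p` is an umbilic point: the Weingarten map is a multiple of the identity. -/
def IsUmbilic : Prop := ∃ k : ℝ, ∀ v, -fderiv ℝ (normalN ε ψ) p v = k • fderiv ℝ ψ p v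

/-- `ψ` is an immersion at `p`. -/
def IsImmersionAt : Prop := Function.Injective (fderiv ℝ ψ p)

/-- The induced metric at `p` is Riemannian (positive definite). -/
def IsSpacelikeAt : Prop := ∀ v, v ≠ 0 → 0 < lor (fderiv ℝ ψ p v) (fderiv ℝ ψ p v)

/-- The induced metric at `p` is Lorentzian: it takes both signs, so (the tangent plane being
two-dimensional) it has signature `(1, 1)`. -/
def IsTimelikeAt : Prop :=
  (∃ v, 0 < lor (fderiv ℝ ψ p v) (fderiv ℝ ψ p v)) ∧
    ∃ v, lor (fderiv ℝ ψ p v) (fderiv ℝ ψ p v) < 0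

/-- The component `φ_j` of `φ = ∂ψ/∂z`. -/
def phi (j : Fin 3) : KNum ε := dz (fun q => algebraMap ℝ (KNum ε) (ψ q j)) p

open Classical in
/-- The coefficient `f` of the Weierstrass pair `(f dz, g)` of `ψ`. -/
def weierstrassF : KNum ε :=
  if ε = 1 then 2 * (phi ε ψ p 0 - unitI ε * phi ε ψ p 1)
  else 2 * (phi ε ψ p 1 + unitI ε * phi ε ψ p 2)

open Classical in
/-- The function `g` of the Weierstrass pair `(f dz, g)` of `ψ`; its value is meaningful at the
points where the denominator, a multiple of `f`, is invertible. -/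
def weierstrassG : KNum ε :=
  if ε = 1 then phi ε ψ p 2 / (-phi ε ψ p 0 + unitI ε * phi ε ψ p 1)
  else phi ε ψ p 0 / (phi ε ψ p 1 + unitI ε * phi ε ψ p 2)

open Classical in
/-- The right-hand side of the Weierstrass representation formula `2 ψ_z = …`. -/
def weierstrassVector (f g : KNum ε) : Fin 3 → KNum ε :=
  if ε = 1 then
    ![(1 / 2 : ℝ) • (f * (1 + g ^ 2)), (1 / 2 : ℝ) • (unitI ε * f * (1 - g ^ 2)), -(f * g)]
  else
    ![f * g, (1 / 2 : ℝ) • (f * (1 - g ^ 2)), (1 / 2 : ℝ) • (unitI ε * f * (1 + g ^ 2))]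

end Surfaces

/-- The points of `Ω` at which the coefficient `f` of the Weierstrass pair is not invertible. -/
def weierstrassPoles (ε : ℝ) (ψ : ℝ × ℝ → L3) (Ω : Set (ℝ × ℝ)) : Set (ℝ × ℝ) :=
  {p | p ∈ Ω ∧ ¬ IsUnit (weierstrassF ε ψ p)}

/-- `ψ` is a smooth immersion of `Ω` for which `z = x + ω y` is a Liouville parameter with
conformal factor `e^{2λ}`: `I = e^{2λ} (dx² + ε dy²)` and `II = dx² - ε dy²`. -/
structure IsLiouvilleImmersion (ε : ℝ) (Ω : Set (ℝ × ℝ)) (lam : ℝ × ℝ → ℝ)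
    (ψ : ℝ × ℝ → L3) : Prop where
  smooth : ContDiffOn ℝ ∞ ψ Ω
  immersion : ∀ p ∈ Ω, IsImmersionAt ψ p
  first_E : ∀ p ∈ Ω, coeffE ψ p = Real.exp (2 * lam p)
  first_F : ∀ p ∈ Ω, coeffF ψ p = 0
  first_G : ∀ p ∈ Ω, coeffG ψ p = ε * Real.exp (2 * lam p)
  second_l : ∀ p ∈ Ω, coeffl ε ψ p = 1
  second_m : ∀ p ∈ Ω, coeffm ε ψ p = 0
  second_n : ∀ p ∈ Ω, coeffn ε ψ p = -ε

end LiouvilleMinimal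

end

open LiouvilleMinimal

open LiouvilleMinimal

namespace LiouvilleMinimal

open Set Filter Metric
open scoped Topology NNReal

/-! ### Linear ordinary differential equations -/

/-! The Liouville equation is the zero-curvature condition of a linear system. For a surface with
the prescribed fundamental forms, the Gauss–Weingarten equations say that w = (ψ, ψ_x, ψ_y, N)
satisfies w_x = A w, w_y = B w, with A and B built from λ_x, λ_y and e^{-2λ}. For these forms the
Codazzi equations hold identically, and the Gauss equation is exactly the Liouville equation
(`isFlatOn_gauss`).

A flat system on a simply connected domain has a fundamental solution. Locally it is found by
solving an ODE along a horizontal segment and then along the verticals; flatness and Grönwall's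
inequality show that the x-equation survives off the initial segment (`hasDerivAt_fst_of_flat`). Two
local solutions differ by a locally constant factor on the right, so they glue to a covering space,
in which the identity of the domain lifts (`exists_glued_section`).

For two moving frames over the same λ the tensor e^{-2λ}(X⊗X' + εY⊗Y') - εN⊗N' is constant
(`frameTensor_const`). With both frames equal, this propagates orthonormality from one point, which
gives existence; with two different frames, it is up to the metric the linear part of the rigid
motion between the surfaces, which gives uniqueness. The curvature statements are read off from N_x
= -e^{-2λ}ψ_x and N_y = e^{-2λ}ψ_y.

For the Weierstrass pair, minimality makes φ = ψ_z holomorphic, with φ' = 2λ_z φ - (ε/2)N. In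
suitable coordinates a, b, c of 𝕂³ the null condition on φ is c² = ab, and f = -2εa, g = c/a. The
relation φ × N = -εωφ turns the quotient rule into 2a g' = 1, that is f = -ε/g' (`two_mul_dz_div`).
Writing |z|² for `norm`, the first fundamental form gives (|a|² - ε|c|²)² = |a|² e^{2λ} (`norm_sq`),
hence the sign of |g'|², |g|² ≠ ε, and the Liouville formula.

Since 𝕂 may have zero divisors, c/a need not be in lowest terms. It is rewritten as (c + βb)/(a +
βc) with β ∈ {0, 1, -1} chosen so that D = a + 2βc + β²b is invertible (`exists_isUnit_rotation`);
then (a + βc)² = aD, and both coprimality and simplicity of the poles follow. -/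

theorem gronwallBound_le_mul_exp {δ K e x r : ℝ} (hK : 1 ≤ K) (hδ : 0 ≤ δ) (he : 0 ≤ e)
    (hx : x ≤ r) : gronwallBound δ K e x ≤ (δ + e) * Real.exp (K * r) := by
  have hK0 : K ≠ 0 := by positivity
  rw [gronwallBound_of_K_ne_0 hK0]
  have h1 : Real.exp (K * x) ≤ Real.exp (K * r) := by
    apply Real.exp_le_exp.2; gcongr
  have h2 : e / K ≤ e := div_le_self he hK
  have h3 := Real.exp_pos (K * x)
  have h4 : 0 ≤ e / K := by positivity
  calc δ * Real.exp (K * x) + e / K * (Real.exp (K * x) - 1)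
      ≤ δ * Real.exp (K * x) + e / K * Real.exp (K * x) := by gcongr; linarith
    _ ≤ δ * Real.exp (K * r) + e * Real.exp (K * r) := by gcongr
    _ = _ := by ring

theorem norm_le_of_norm_deriv_le_right {E : Type*} [NormedAddCommGroup E] [NormedSpace ℝ E]
    {f f' : ℝ → E} {t₀ r δ K e : ℝ} (hK : 1 ≤ K) (he : 0 ≤ e)
    (hf : ∀ t ∈ Icc t₀ (t₀ + r), HasDerivWithinAt f (f' t) (Icc t₀ (t₀ + r)) t)
    (h0 : ‖f t₀‖ ≤ δ) (hb : ∀ t ∈ Icc t₀ (t₀ + r), ‖f' t‖ ≤ K * ‖f t‖ + e) :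
    ∀ t ∈ Icc t₀ (t₀ + r), ‖f t‖ ≤ (δ + e) * Real.exp (K * r) := by
  intro t ht
  refine (norm_le_gronwallBound_of_norm_deriv_right_le (K := K) (ε := e)
    (fun s hs => (hf s hs).continuousWithinAt) (fun s hs => ?_) h0
    (fun s hs => hb s (Ico_subset_Icc_self hs)) t ht).trans
    (gronwallBound_le_mul_exp hK ((norm_nonneg _).trans h0) he (by linarith [ht.2]))
  exact (hf s (Ico_subset_Icc_self hs)).mono_of_mem_nhdsWithin (Icc_mem_nhdsGE_of_mem hs)

/-- A two-sided version of Grönwall's inequality. -/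
theorem norm_le_of_norm_deriv_le {E : Type*} [NormedAddCommGroup E] [NormedSpace ℝ E]
    {f f' : ℝ → E} {t₀ r δ K e : ℝ} (hr : 0 ≤ r) (hK : 1 ≤ K) (he : 0 ≤ e)
    (hf : ∀ t ∈ Icc (t₀ - r) (t₀ + r), HasDerivWithinAt f (f' t) (Icc (t₀ - r) (t₀ + r)) t)
    (h0 : ‖f t₀‖ ≤ δ) (hb : ∀ t ∈ Icc (t₀ - r) (t₀ + r), ‖f' t‖ ≤ K * ‖f t‖ + e) :
    ∀ t ∈ Icc (t₀ - r) (t₀ + r), ‖f t‖ ≤ (δ + e) * Real.exp (K * r) := by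
  intro t ht
  rcases le_total t₀ t with h | h
  · have hsub : Icc t₀ (t₀ + r) ⊆ Icc (t₀ - r) (t₀ + r) := Icc_subset_Icc_left (by linarith)
    exact norm_le_of_norm_deriv_le_right hK he (fun s hs => (hf s (hsub hs)).mono hsub) h0
      (fun s hs => hb s (hsub hs)) t ⟨h, ht.2⟩
  · have hmem : ∀ s ∈ Icc t₀ (t₀ + r), 2 * t₀ - s ∈ Icc (t₀ - r) (t₀ + r) := fun s hs =>
      ⟨by linarith [hs.2], by linarith [hs.1]⟩
    -- The left half is reduced to the right half by the reflection s ↦ 2t₀ - s.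
    have key := norm_le_of_norm_deriv_le_right (f := fun s => f (2 * t₀ - s))
      (f' := fun s => -f' (2 * t₀ - s)) (t₀ := t₀) (r := r) (δ := δ) hK he (fun s hs => ?_)
      (by rwa [show 2 * t₀ - t₀ = t₀ by ring])
      (fun s hs => by rw [norm_neg]; exact hb _ (hmem s hs)) (2 * t₀ - t)
      ⟨by linarith, by linarith [ht.1]⟩
    · simpa using key
    · have h1 : HasDerivWithinAt (fun s : ℝ => 2 * t₀ - s) (-1) (Icc t₀ (t₀ + r)) s :=
        (hasDerivWithinAt_id s _).const_sub _
      simpa using! HasDerivWithinAt.scomp s (hf _ (hmem s hs)) h1 hmem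

/-- This is the mean value inequality for t ↦ g t - t g'(x), whose derivative is at most C|s - x|
between x and s. It yields a first-order Taylor remainder that is uniform in further parameters. -/
theorem norm_sub_sub_smul_le {E : Type*} [NormedAddCommGroup E] [NormedSpace ℝ E]
    {g g' : ℝ → E} {a b C x s : ℝ} (hg : ∀ t ∈ Icc a b, HasDerivWithinAt g (g' t) (Icc a b) t)
    (hC : ∀ t ∈ Icc a b, ‖g' t - g' x‖ ≤ C * |t - x|) (hC0 : 0 ≤ C)
    (hx : x ∈ Icc a b) (hs : s ∈ Icc a b) :
    ‖g s - g x - (s - x) • g' x‖ ≤ C * |s - x| ^ 2 := by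
  have hsub : uIcc x s ⊆ Icc a b := uIcc_subset_Icc hx hs
  have key := Convex.norm_image_sub_le_of_norm_hasDerivWithin_le
    (f := fun t => g t - t • g' x) (f' := fun t => g' t - g' x) (s := uIcc x s)
    (x := x) (y := s) (C := C * |s - x|) (fun t ht => ?_) (fun t ht => ?_)
    (convex_uIcc _ _) left_mem_uIcc right_mem_uIcc
  · rw [Real.norm_eq_abs] at key
    calc ‖g s - g x - (s - x) • g' x‖ = ‖g s - s • g' x - (g x - x • g' x)‖ := by
          congr 1; rw [sub_smul]; abel
      _ ≤ _ := key
      _ = _ := by ring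
  · have := ((hasDerivWithinAt_id t (uIcc x s)).smul_const (g' x))
    simpa using! ((hg t (hsub ht)).mono hsub).sub this
  · refine (hC t (hsub ht)).trans ?_
    gcongr C * ?_
    exact abs_sub_left_of_mem_uIcc ht

/-- A linear differential equation with bounded coefficients has solutions on an interval whose
length depends only on the bounds. -/
theorem exists_linear_ode {𝒜 : Type*} [NormedRing 𝒜] [NormedAlgebra ℝ 𝒜] [CompleteSpace 𝒜]
    {c : ℝ → 𝒜} {t₀ r K R : ℝ} (hr : 0 ≤ r) (hK : 1 ≤ K)
    (hc : ContinuousOn c (Icc (t₀ - r) (t₀ + r)))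
    (hcK : ∀ t ∈ Icc (t₀ - r) (t₀ + r), ‖c t‖ ≤ K) (v : 𝒜) (hv : ‖v‖ ≤ R)
    (hKr : K * (R + 1) * r ≤ 1) :
    ∃ u : ℝ → 𝒜, u t₀ = v ∧
      (∀ t ∈ Icc (t₀ - r) (t₀ + r), HasDerivWithinAt u (c t * u t) (Icc (t₀ - r) (t₀ + r)) t) ∧
      ∀ t ∈ Icc (t₀ - r) (t₀ + r), ‖u t‖ ≤ R * Real.exp (K * r) := by
  have hR : 0 ≤ R := (norm_nonneg v).trans hv
  have hK0 : 0 ≤ K := by linarith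
  -- On the ball of radius 1 around v the solution has norm at most R + 1, so the field is bounded
  -- by K(R + 1), and `hKr` says that the solution cannot leave the ball in time r. The length r
  -- depends on v only through R.
  have hpl : IsPicardLindelof (fun t u => c t * u) (tmin := t₀ - r) (tmax := t₀ + r)
      ⟨t₀, by constructor <;> linarith⟩ v 1 0 ⟨K * (R + 1), by positivity⟩ ⟨K, hK0⟩ := by
    refine ⟨fun t ht => ?_, fun x _ => hc.mul continuousOn_const, fun t ht x hx => ?_, ?_⟩
    · refine LipschitzOnWith.of_dist_le_mul fun x _ y _ => ?_
      rw [dist_eq_norm, dist_eq_norm, ← mul_sub]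
      exact (norm_mul_le _ _).trans (mul_le_mul_of_nonneg_right (hcK t ht) (norm_nonneg _))
    · refine (norm_mul_le _ _).trans ?_
      have h1 : ‖x‖ ≤ R + 1 := by
        have := norm_le_norm_add_norm_sub' x v
        rw [mem_closedBall, dist_eq_norm] at hx
        simp at hx
        linarith
      exact mul_le_mul (hcK t ht) h1 (norm_nonneg _) hK0
    · simpa using! hKr
  obtain ⟨u, hu0, hu⟩ := hpl.exists_eq_forall_mem_Icc_hasDerivWithinAt₀
  refine ⟨u, hu0, hu, fun t ht => ?_⟩
  have := norm_le_of_norm_deriv_le (f := u) (δ := R) (e := 0) hr hK le_rfl hu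
    (by simpa [hu0] using hv) (fun s hs => ?_) t ht
  · simpa using this
  · rw [add_zero]
    exact (norm_mul_le _ _).trans (mul_le_mul_of_nonneg_right (hcK s hs) (norm_nonneg _))

/-! ### Partial derivatives -/

section PartialDerivatives

variable {V : Type*} [NormedAddCommGroup V] [NormedSpace ℝ V] {f : ℝ × ℝ → V}

theorem hasDerivAt_fst_slice {x y : ℝ} (h : DifferentiableAt ℝ f (x, y)) :
    HasDerivAt (fun s => f (s, y)) (dX f (x, y)) x :=
  h.hasFDerivAt.comp_hasDerivAt x ((hasDerivAt_id x).prodMk (hasDerivAt_const x y))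

theorem hasDerivAt_snd_slice {x y : ℝ} (h : DifferentiableAt ℝ f (x, y)) :
    HasDerivAt (fun s => f (x, s)) (dY f (x, y)) y :=
  h.hasFDerivAt.comp_hasDerivAt y ((hasDerivAt_const y x).prodMk (hasDerivAt_id y))

theorem contDiffOn_dX {Ω : Set (ℝ × ℝ)} (hΩ : IsOpen Ω) (hf : ContDiffOn ℝ ∞ f Ω) :
    ContDiffOn ℝ ∞ (dX f) Ω :=
  (hf.fderiv_of_isOpen hΩ (m := ∞) le_rfl).clm_apply contDiffOn_const

theorem contDiffOn_dY {Ω : Set (ℝ × ℝ)} (hΩ : IsOpen Ω) (hf : ContDiffOn ℝ ∞ f Ω) :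
    ContDiffOn ℝ ∞ (dY f) Ω :=
  (hf.fderiv_of_isOpen hΩ (m := ∞) le_rfl).clm_apply contDiffOn_const

/-- The linear map `(h, k) ↦ h a + k b`. -/
noncomputable def ofPartials (a b : V) : ℝ × ℝ →L[ℝ] V :=
  (ContinuousLinearMap.fst ℝ ℝ ℝ).smulRight a + (ContinuousLinearMap.snd ℝ ℝ ℝ).smulRight b

@[simp] theorem ofPartials_apply (a b : V) (v : ℝ × ℝ) :
    ofPartials a b v = v.1 • a + v.2 • b := by simp [ofPartials]

theorem fderiv_eq_ofPartials (f : ℝ × ℝ → V) (p : ℝ × ℝ) :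
    fderiv ℝ f p = ofPartials (dX f p) (dY f p) := by
  ext <;> simp [dX, dY]

theorem dX_eq_of_hasFDerivAt {a b : V} {p : ℝ × ℝ} (h : HasFDerivAt f (ofPartials a b) p) :
    dX f p = a := by simp [dX, h.fderiv]

theorem dY_eq_of_hasFDerivAt {a b : V} {p : ℝ × ℝ} (h : HasFDerivAt f (ofPartials a b) p) :
    dY f p = b := by simp [dY, h.fderiv]

end PartialDerivatives

/-! ### Local solutions of flat linear systems -/

section Flat

variable {𝒜 : Type*} [NormedRing 𝒜] [NormedAlgebra ℝ 𝒜]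

/-- The integrability condition of the linear system `w_x = A w`, `w_y = B w`. -/
noncomputable def IsFlatOn (A B : ℝ × ℝ → 𝒜) (Ω : Set (ℝ × ℝ)) : Prop :=
  ∀ p ∈ Ω, dY A p + A p * B p = dX B p + B p * A p

/-- The defect D(s, t) = w(s, t) - w(x, t) - (s - x) A w(x, t) satisfies a linear equation in t up
to an error O(|s - x|²); the first-order error cancels precisely by flatness. Since D(s, y₀) = o(s -
x) by the equation on the initial segment, Grönwall's inequality carries this estimate to every
height y. Differentiable dependence of ODE solutions on parameters is thus not needed. -/
theorem hasDerivAt_fst_of_flat {A B : ℝ × ℝ → 𝒜} {w : ℝ → ℝ → 𝒜} {x₀ y₀ r K W : ℝ}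
    (hr : 0 < r) (hr1 : r ≤ 1) (hK : 1 ≤ K) (hW : 0 ≤ W)
    (hA : ∀ p ∈ Icc (x₀ - r) (x₀ + r) ×ˢ Icc (y₀ - r) (y₀ + r), DifferentiableAt ℝ A p)
    (hB : ∀ p ∈ Icc (x₀ - r) (x₀ + r) ×ˢ Icc (y₀ - r) (y₀ + r), DifferentiableAt ℝ B p)
    (hAK : ∀ p ∈ Icc (x₀ - r) (x₀ + r) ×ˢ Icc (y₀ - r) (y₀ + r), ‖A p‖ ≤ K)
    (hBK : ∀ p ∈ Icc (x₀ - r) (x₀ + r) ×ˢ Icc (y₀ - r) (y₀ + r), ‖B p‖ ≤ K)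
    (hBxK : ∀ p ∈ Icc (x₀ - r) (x₀ + r) ×ˢ Icc (y₀ - r) (y₀ + r), ‖dX B p‖ ≤ K)
    (hBL : ∀ p ∈ Icc (x₀ - r) (x₀ + r) ×ˢ Icc (y₀ - r) (y₀ + r),
      ∀ q ∈ Icc (x₀ - r) (x₀ + r) ×ˢ Icc (y₀ - r) (y₀ + r), ‖dX B p - dX B q‖ ≤ K * dist p q)
    (hflat : IsFlatOn A B (Icc (x₀ - r) (x₀ + r) ×ˢ Icc (y₀ - r) (y₀ + r)))
    (hwy : ∀ x ∈ Icc (x₀ - r) (x₀ + r), ∀ t ∈ Icc (y₀ - r) (y₀ + r),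
      HasDerivWithinAt (w x) (B (x, t) * w x t) (Icc (y₀ - r) (y₀ + r)) t)
    (hwx : ∀ x ∈ Icc (x₀ - r) (x₀ + r),
      HasDerivWithinAt (fun s => w s y₀) (A (x, y₀) * w x y₀) (Icc (x₀ - r) (x₀ + r)) x)
    (hwW : ∀ x ∈ Icc (x₀ - r) (x₀ + r), ∀ t ∈ Icc (y₀ - r) (y₀ + r), ‖w x t‖ ≤ W)
    {x y : ℝ} (hx : x ∈ Ioo (x₀ - r) (x₀ + r)) (hy : y ∈ Icc (y₀ - r) (y₀ + r)) :
    HasDerivAt (fun s => w s y) (A (x, y) * w x y) x := by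
  have hxc := Ioo_subset_Icc_self hx
  set D : ℝ → ℝ → 𝒜 := fun s t => w s t - w x t - (s - x) • (A (x, t) * w x t) with hD
  set C : ℝ := K * W + K * (K * W) with hC
  have hC0 : 0 ≤ C := by positivity
  -- The rate 3K is K from B plus 2K from (s - x) B_x, because r ≤ 1 gives |s - x| ≤ 2. In C, the
  -- term K W comes from the Taylor remainder of B and the term K (K W) from B_x A w.
  have main : ∀ s ∈ Icc (x₀ - r) (x₀ + r),
      ‖D s y‖ ≤ (‖D s y₀‖ + C * |s - x| ^ 2) * Real.exp (3 * K * r) := by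
    intro s hs
    have hsx : |s - x| ≤ 2 := by
      rw [abs_le]; constructor <;> linarith [hs.1, hs.2, hxc.1, hxc.2]
    refine norm_le_of_norm_deriv_le (f := D s) (t₀ := y₀)
      (f' := fun t => B (s, t) * w s t - B (x, t) * w x t -
        (s - x) • (dY A (x, t) * w x t + A (x, t) * (B (x, t) * w x t)))
      hr.le (by linarith) (by positivity) (fun t ht => ?_) le_rfl (fun t ht => ?_) y hy
    · have hAt : HasDerivWithinAt (fun t => A (x, t)) (dY A (x, t))
          (Icc (y₀ - r) (y₀ + r)) t :=
        (hasDerivAt_snd_slice (hA (x, t) ⟨hxc, ht⟩)).hasDerivWithinAt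
      exact ((hwy s hs t ht).sub (hwy x hxc t ht)).sub
        ((hAt.mul (hwy x hxc t ht)).const_smul (s - x))
    · have hpx : (x, t) ∈ Icc (x₀ - r) (x₀ + r) ×ˢ Icc (y₀ - r) (y₀ + r) := ⟨hxc, ht⟩
      have hfl := hflat (x, t) hpx
      have hBT : ‖B (s, t) - B (x, t) - (s - x) • dX B (x, t)‖ ≤ K * |s - x| ^ 2 :=
        norm_sub_sub_smul_le (g := fun s => B (s, t)) (g' := fun s => dX B (s, t))
          (a := x₀ - r) (b := x₀ + r)
          (fun q hq => (hasDerivAt_fst_slice (hB (q, t) ⟨hq, ht⟩)).hasDerivWithinAt)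
          (fun q hq => by
            refine (hBL (q, t) ⟨hq, ht⟩ (x, t) hpx).trans_eq ?_
            simp [Prod.dist_eq, Real.dist_eq])
          (by linarith) hxc hs
      have e1 : B (s, t) * w s t - B (x, t) * w x t -
          (s - x) • (dY A (x, t) * w x t + A (x, t) * (B (x, t) * w x t)) =
          B (x, t) * D s t + (B (s, t) - B (x, t) - (s - x) • dX B (x, t)) * w s t +
          (s - x) • (dX B (x, t) * (D s t + (s - x) • (A (x, t) * w x t))) := by
        -- Flatness enters here: it trades A_y + AB for B_x + BA, which matches the Taylor expansion
        -- of B in s.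
        have e2 : dY A (x, t) * w x t + A (x, t) * (B (x, t) * w x t) =
            dX B (x, t) * w x t + B (x, t) * (A (x, t) * w x t) := by
          rw [← mul_assoc, ← mul_assoc, ← add_mul, ← add_mul, hfl]
        rw [e2]
        simp only [hD, mul_sub, sub_mul, smul_sub, smul_add, mul_smul_comm, smul_mul_assoc,
          sub_add_cancel]
        abel
      have n1 : ‖B (x, t) * D s t‖ ≤ K * ‖D s t‖ :=
        (norm_mul_le _ _).trans (by gcongr; exact hBK _ hpx)
      have n2 : ‖(B (s, t) - B (x, t) - (s - x) • dX B (x, t)) * w s t‖ ≤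
          K * |s - x| ^ 2 * W :=
        (norm_mul_le _ _).trans (by gcongr; exact hwW s hs t ht)
      have n3 : ‖(s - x) • (dX B (x, t) * (D s t + (s - x) • (A (x, t) * w x t)))‖ ≤
          |s - x| * (K * (‖D s t‖ + |s - x| * (K * W))) := by
        rw [norm_smul, Real.norm_eq_abs]
        gcongr
        refine (norm_mul_le _ _).trans ?_
        gcongr
        · exact hBxK _ hpx
        · refine (norm_add_le _ _).trans ?_
          gcongr
          rw [norm_smul, Real.norm_eq_abs]
          gcongr
          refine (norm_mul_le _ _).trans ?_
          gcongr
          · exact hAK _ hpx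
          · exact hwW x hxc t ht
      rw [e1]
      refine (norm_add₃_le).trans ?_
      have n4 : |s - x| * (K * ‖D s t‖) ≤ 2 * (K * ‖D s t‖) := by gcongr
      have e3 : 3 * K * ‖D s t‖ + C * |s - x| ^ 2 = K * ‖D s t‖ + K * |s - x| ^ 2 * W +
          (2 * (K * ‖D s t‖) + |s - x| * (K * (|s - x| * (K * W)))) := by rw [hC]; ring
      rw [e3]
      have e4 : |s - x| * (K * (‖D s t‖ + |s - x| * (K * W))) =
        |s - x| * (K * ‖D s t‖) + |s - x| * (K * (|s - x| * (K * W))) := by ring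
      linarith
  rw [hasDerivAt_iff_isLittleO]
  have h0 : (fun s => D s y₀) =o[𝓝 x] fun s => s - x := by
    have := (hwx x hxc).hasDerivAt (Icc_mem_nhds hx.1 hx.2)
    exact hasDerivAt_iff_isLittleO.1 this
  have h1 : (fun s => C * |s - x| ^ 2) =o[𝓝 x] fun s => s - x := by
    refine Asymptotics.IsLittleO.const_mul_left ?_ C
    have h2 : (fun s : ℝ => (s - x) ^ 2) =o[𝓝 x] fun s => s - x := by
      have h3 : Tendsto (fun s : ℝ => s - x) (𝓝 x) (𝓝 0) :=
        tendsto_sub_nhds_zero_iff.2 tendsto_id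
      simpa using! (Asymptotics.isLittleO_pow_id (𝕜 := ℝ) (n := 2) (by norm_num)).comp_tendsto h3
    simpa [sq_abs] using h2
  refine Asymptotics.IsBigO.trans_isLittleO (g := fun s => ‖D s y₀‖ + C * |s - x| ^ 2) ?_
    (h0.norm_left.add h1)
  refine Asymptotics.IsBigO.of_bound (Real.exp (3 * K * r)) ?_
  filter_upwards [Icc_mem_nhds hx.1 hx.2] with s hs
  have hpos : 0 ≤ ‖D s y₀‖ + C * |s - x| ^ 2 := by positivity
  rw [Real.norm_of_nonneg hpos, mul_comm]
  exact main s hs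

/-- Partial derivatives that are given by a linear system can be joined to a derivative. -/
theorem hasFDerivAt_of_partials {A B : ℝ × ℝ → 𝒜} {w : ℝ → ℝ → 𝒜} {U : Set (ℝ × ℝ)}
    (hU : IsOpen U) (hA : ContinuousOn A U) (hB : ContinuousOn B U)
    (hw : ContinuousOn (fun p : ℝ × ℝ => w p.1 p.2) U)
    (hwx : ∀ p ∈ U, HasDerivAt (fun s => w s p.2) (A p * w p.1 p.2) p.1)
    (hwy : ∀ p ∈ U, HasDerivAt (fun s => w p.1 s) (B p * w p.1 p.2) p.2) {p : ℝ × ℝ}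
    (hp : p ∈ U) :
    HasFDerivAt (fun p : ℝ × ℝ => w p.1 p.2)
      (ofPartials (A p * w p.1 p.2) (B p * w p.1 p.2)) p := by
  have hUp := hU.mem_nhds hp
  have key := hasStrictFDerivAt_uncurry_coprod (𝕜 := ℝ) (u := p) (f := w)
    (f₁ := fun x y => (ContinuousLinearMap.toSpanSingleton ℝ (A (x, y) * w x y)))
    (f₂ := fun x y => (ContinuousLinearMap.toSpanSingleton ℝ (B (x, y) * w x y)))
    (by filter_upwards [hUp] with v hv using (hwx v hv).hasFDerivAt)
    (by filter_upwards [hUp] with v hv using (hwy v hv).hasFDerivAt)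
    ?_ ?_
  · refine key.hasFDerivAt.congr_fderiv ?_
    ext <;> simp [Function.HasUncurry.uncurry]
  · exact (ContinuousLinearMap.toSpanSingletonCLE (𝕜 := ℝ) (E := 𝒜)).continuous.continuousAt.comp
      ((hA.mul hw).continuousAt hUp)
  · exact (ContinuousLinearMap.toSpanSingletonCLE (𝕜 := ℝ) (E := 𝒜)).continuous.continuousAt.comp
      ((hB.mul hw).continuousAt hUp)

end Flat

section Flat

variable {𝒜 : Type*} [NormedRing 𝒜] [NormedAlgebra ℝ 𝒜]

/-- The solution is built along the segment y = y₀ from the value 1, and then along each vertical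
from the value reached there. On the initial segment it is bounded by ‖1‖ exp K, which serves as the
bound R of the vertical problems; hence the form of `hKr`. -/
theorem exists_local_solution_of_bounds [CompleteSpace 𝒜] {A B : ℝ × ℝ → 𝒜} {x₀ y₀ r K : ℝ}
    (hr : 0 < r) (hr1 : r ≤ 1) (hK : 1 ≤ K)
    (hA : ∀ p ∈ Icc (x₀ - r) (x₀ + r) ×ˢ Icc (y₀ - r) (y₀ + r), DifferentiableAt ℝ A p)
    (hB : ∀ p ∈ Icc (x₀ - r) (x₀ + r) ×ˢ Icc (y₀ - r) (y₀ + r), DifferentiableAt ℝ B p)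
    (hAK : ∀ p ∈ Icc (x₀ - r) (x₀ + r) ×ˢ Icc (y₀ - r) (y₀ + r), ‖A p‖ ≤ K)
    (hBK : ∀ p ∈ Icc (x₀ - r) (x₀ + r) ×ˢ Icc (y₀ - r) (y₀ + r), ‖B p‖ ≤ K)
    (hBxK : ∀ p ∈ Icc (x₀ - r) (x₀ + r) ×ˢ Icc (y₀ - r) (y₀ + r), ‖dX B p‖ ≤ K)
    (hBL : ∀ p ∈ Icc (x₀ - r) (x₀ + r) ×ˢ Icc (y₀ - r) (y₀ + r),
      ∀ q ∈ Icc (x₀ - r) (x₀ + r) ×ˢ Icc (y₀ - r) (y₀ + r), ‖dX B p - dX B q‖ ≤ K * dist p q)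
    (hflat : IsFlatOn A B (Icc (x₀ - r) (x₀ + r) ×ˢ Icc (y₀ - r) (y₀ + r)))
    (hKr : K * (‖(1 : 𝒜)‖ * Real.exp K + 1) * r ≤ 1) :
    ∃ Φ : ℝ × ℝ → 𝒜, Φ (x₀, y₀) = 1 ∧ ∀ p ∈ Ioo (x₀ - r) (x₀ + r) ×ˢ Ioo (y₀ - r) (y₀ + r),
      HasFDerivAt Φ (ofPartials (A p * Φ p) (B p * Φ p)) p := by
  set ρ : ℝ := ‖(1 : 𝒜)‖ with hρ
  have hρ0 : 0 ≤ ρ := norm_nonneg _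
  have hy₀ : y₀ ∈ Icc (y₀ - r) (y₀ + r) := ⟨by linarith, by linarith⟩
  have hx₀ : x₀ ∈ Icc (x₀ - r) (x₀ + r) := ⟨by linarith, by linarith⟩
  have hexp : Real.exp (K * r) ≤ Real.exp K := by
    apply Real.exp_le_exp.2; nlinarith
  have h1exp : 1 ≤ Real.exp K := Real.one_le_exp (by linarith)
  obtain ⟨a, ha0, ha, haR⟩ := exists_linear_ode (c := fun s => A (s, y₀)) (t₀ := x₀) hr.le hK
    (fun s hs => (hasDerivAt_fst_slice (hA (s, y₀) ⟨hs, hy₀⟩)).continuousAt.continuousWithinAt)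
    (fun s hs => hAK (s, y₀) ⟨hs, hy₀⟩) (1 : 𝒜) (R := ρ) le_rfl (le_trans (by
      gcongr; exact le_mul_of_one_le_right hρ0 h1exp) hKr)
  have haR' : ∀ s ∈ Icc (x₀ - r) (x₀ + r), ‖a s‖ ≤ ρ * Real.exp K := fun s hs =>
    (haR s hs).trans (by gcongr)
  have hex : ∀ s ∈ Icc (x₀ - r) (x₀ + r), _ := fun s hs =>
    exists_linear_ode (c := fun t => B (s, t)) (t₀ := y₀) hr.le hK
    (fun t ht => (hasDerivAt_snd_slice (hB (s, t) ⟨hs, ht⟩)).continuousAt.continuousWithinAt)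
    (fun t ht => hBK (s, t) ⟨hs, ht⟩) (a s) (haR' s hs) hKr
  choose! w hw0 hwy hwW using hex
  set W := ρ * Real.exp K * Real.exp (K * r) with hW
  have hW0 : 0 ≤ W := by positivity
  have hwx : ∀ s ∈ Icc (x₀ - r) (x₀ + r),
      HasDerivWithinAt (fun s => w s y₀) (A (s, y₀) * w s y₀) (Icc (x₀ - r) (x₀ + r)) s := by
    intro s hs
    rw [hw0 s hs]
    exact (ha s hs).congr_of_mem (fun t ht => hw0 t ht) hs
  have hwx' : ∀ p ∈ Ioo (x₀ - r) (x₀ + r) ×ˢ Ioo (y₀ - r) (y₀ + r),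
      HasDerivAt (fun s => w s p.2) (A p * w p.1 p.2) p.1 := fun p hp =>
    hasDerivAt_fst_of_flat hr hr1 hK hW0 hA hB hAK hBK hBxK hBL hflat hwy hwx hwW hp.1
      (Ioo_subset_Icc_self hp.2)
  have hwy' : ∀ p ∈ Ioo (x₀ - r) (x₀ + r) ×ˢ Ioo (y₀ - r) (y₀ + r),
      HasDerivAt (fun s => w p.1 s) (B p * w p.1 p.2) p.2 := fun p hp =>
    (hwy p.1 (Ioo_subset_Icc_self hp.1) p.2 (Ioo_subset_Icc_self hp.2)).hasDerivAt
      (Icc_mem_nhds hp.2.1 hp.2.2)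
  have hsub : Ioo (x₀ - r) (x₀ + r) ×ˢ Ioo (y₀ - r) (y₀ + r) ⊆
      Icc (x₀ - r) (x₀ + r) ×ˢ Icc (y₀ - r) (y₀ + r) :=
    prod_mono Ioo_subset_Icc_self Ioo_subset_Icc_self
  have hcont : ContinuousOn (fun p : ℝ × ℝ => w p.1 p.2)
      (Ioo (x₀ - r) (x₀ + r) ×ˢ Ioo (y₀ - r) (y₀ + r)) := by
    -- Joint continuity: the function is continuous in t for each s, and Lipschitz in s with the
    -- constant K W for all t, by the x-equation just proved.
    refine continuousOn_prod_of_continuousOn_lipschitzOnWith (fun p : ℝ × ℝ => w p.1 p.2)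
      (⟨K * W, by positivity⟩ : ℝ≥0) (fun s hs t ht =>
        (hwy' (s, t) ⟨hs, ht⟩).continuousAt.continuousWithinAt) fun t ht => ?_
    refine Convex.lipschitzOnWith_of_nnnorm_hasDerivWithin_le (convex_Ioo _ _)
      (fun s hs => (hwx' (s, t) ⟨hs, ht⟩).hasDerivWithinAt) fun s hs => ?_
    refine (norm_mul_le (A (s, t)) (w s t)).trans ?_
    refine mul_le_mul (hAK _ (hsub ⟨hs, ht⟩)) ?_ (norm_nonneg _) (by linarith)
    exact hwW s (Ioo_subset_Icc_self hs) t (Ioo_subset_Icc_self ht)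
  refine ⟨fun p => w p.1 p.2, (hw0 x₀ hx₀).trans ha0, fun p hp => ?_⟩
  exact hasFDerivAt_of_partials (isOpen_Ioo.prod isOpen_Ioo)
    (fun q hq => (hA q (hsub hq)).continuousAt.continuousWithinAt)
    (fun q hq => (hB q (hsub hq)).continuousAt.continuousWithinAt) hcont hwx' hwy' hp

/-- Flat linear systems have local fundamental solutions. -/
theorem exists_local_solution [CompleteSpace 𝒜] {A B : ℝ × ℝ → 𝒜} {Ω : Set (ℝ × ℝ)}
    (hΩ : IsOpen Ω) (hA : ContDiffOn ℝ ∞ A Ω) (hB : ContDiffOn ℝ ∞ B Ω) (hflat : IsFlatOn A B Ω)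
    {p₀ : ℝ × ℝ} (hp₀ : p₀ ∈ Ω) :
    ∃ (U : Set (ℝ × ℝ)) (Φ : ℝ × ℝ → 𝒜), IsOpen U ∧ p₀ ∈ U ∧ U ⊆ Ω ∧ (∀ p ∈ U, IsUnit (Φ p)) ∧
      ∀ p ∈ U, HasFDerivAt Φ (ofPartials (A p * Φ p) (B p * Φ p)) p := by
  obtain ⟨x₀, y₀⟩ := p₀
  have hn := hΩ.mem_nhds hp₀
  have hdA : ∀ p ∈ Ω, DifferentiableAt ℝ A p := fun p hp =>
    (hA.contDiffAt (hΩ.mem_nhds hp)).differentiableAt (by simp)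
  have hdB : ∀ p ∈ Ω, DifferentiableAt ℝ B p := fun p hp =>
    (hB.contDiffAt (hΩ.mem_nhds hp)).differentiableAt (by simp)
  have hBx := (contDiffOn_dX hΩ hB).contDiffAt hn
  obtain ⟨L, t, ht, hL⟩ := (hBx.of_le (m := 1) (mod_cast le_top)).exists_lipschitzOnWith
  set K : ℝ := 1 + L + ‖A (x₀, y₀)‖ + ‖B (x₀, y₀)‖ + ‖dX B (x₀, y₀)‖ with hK
  have hL0 := L.coe_nonneg
  have hnA := norm_nonneg (A (x₀, y₀))
  have hnB := norm_nonneg (B (x₀, y₀))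
  have hnBx := norm_nonneg (dX B (x₀, y₀))
  have hK1 : 1 ≤ K := by rw [hK]; linarith
  have hev : ∀ᶠ p in 𝓝 (x₀, y₀), p ∈ Ω ∧ p ∈ t ∧ ‖A p‖ < K ∧ ‖B p‖ < K ∧ ‖dX B p‖ < K := by
    refine Filter.Eventually.and hn (Filter.Eventually.and ht
      (Filter.Eventually.and ?_ (Filter.Eventually.and ?_ ?_)))
    · exact (hdA _ hp₀).continuousAt.norm.eventually_lt_const (by rw [hK]; linarith)
    · exact (hdB _ hp₀).continuousAt.norm.eventually_lt_const (by rw [hK]; linarith)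
    · exact hBx.continuousAt.norm.eventually_lt_const (by rw [hK]; linarith)
  obtain ⟨r₀, hr₀, hr₀'⟩ := Metric.nhds_basis_closedBall.eventually_iff.1 hev
  set M : ℝ := K * (‖(1 : 𝒜)‖ * Real.exp K + 1) with hM
  have hM0 : 0 < M := by positivity
  -- The three bounds keep the box inside the good neighbourhood, ensure r ≤ 1, and make M r ≤ 1 as
  -- the ODE lemma demands.
  set r : ℝ := min r₀ (min 1 (1 / M)) with hr
  have hr0 : 0 < r := by positivity
  have hbox : ∀ p ∈ Icc (x₀ - r) (x₀ + r) ×ˢ Icc (y₀ - r) (y₀ + r),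
      p ∈ Ω ∧ p ∈ t ∧ ‖A p‖ < K ∧ ‖B p‖ < K ∧ ‖dX B p‖ < K := by
    intro p hp
    apply hr₀'
    rw [← Real.closedBall_eq_Icc, ← Real.closedBall_eq_Icc, closedBall_prod_same] at hp
    exact closedBall_subset_closedBall (min_le_left _ _) hp
  obtain ⟨Φ, hΦ1, hΦ⟩ := exists_local_solution_of_bounds (A := A) (B := B) (x₀ := x₀) (y₀ := y₀)
    hr0 ((min_le_right _ _).trans (min_le_left _ _)) hK1
    (fun p hp => hdA p (hbox p hp).1) (fun p hp => hdB p (hbox p hp).1)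
    (fun p hp => (hbox p hp).2.2.1.le) (fun p hp => (hbox p hp).2.2.2.1.le)
    (fun p hp => (hbox p hp).2.2.2.2.le)
    (fun p hp q hq => by
      rw [← dist_eq_norm]
      refine (hL.dist_le_mul p (hbox p hp).2.1 q (hbox q hq).2.1).trans ?_
      gcongr
      rw [hK]; linarith)
    (fun p hp => hflat p (hbox p hp).1)
    (by
      calc M * r ≤ M * (1 / M) := by
            gcongr; exact (min_le_right _ _).trans (min_le_right _ _)
        _ = 1 := by field_simp)
  have hopen : IsOpen (Ioo (x₀ - r) (x₀ + r) ×ˢ Ioo (y₀ - r) (y₀ + r)) :=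
    isOpen_Ioo.prod isOpen_Ioo
  -- The units form an open set containing Φ(p₀) = 1, so invertibility is achieved by shrinking the
  -- box.
  refine ⟨Ioo (x₀ - r) (x₀ + r) ×ˢ Ioo (y₀ - r) (y₀ + r) ∩ Φ ⁻¹' {u | IsUnit u}, Φ,
    ContinuousOn.isOpen_inter_preimage (fun p hp => (hΦ p hp).continuousAt.continuousWithinAt)
      hopen Units.isOpen, ⟨⟨⟨by linarith, by linarith⟩, ⟨by linarith, by linarith⟩⟩, ?_⟩,
    fun p hp => (hbox p ?_).1, fun p hp => hp.2, fun p hp => hΦ p hp.1⟩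
  · simp [hΦ1]
  · exact prod_mono Ioo_subset_Icc_self Ioo_subset_Icc_self hp.1

/-! ### Global solutions -/

/-- The derivative of Ψ⁻¹Φ is -Ψ⁻¹(AΨ)Ψ⁻¹Φ + Ψ⁻¹AΦ = 0 in the x-direction, and likewise with B in
the y-direction. These quotients are the locally constant transition functions used for gluing. -/
theorem eventually_inverse_mul_eq [CompleteSpace 𝒜] {A B Φ Ψ : ℝ × ℝ → 𝒜} {U : Set (ℝ × ℝ)}
    (hU : IsOpen U)
    (hΦ : ∀ p ∈ U, HasFDerivAt Φ (ofPartials (A p * Φ p) (B p * Φ p)) p)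
    (hΨ : ∀ p ∈ U, HasFDerivAt Ψ (ofPartials (A p * Ψ p) (B p * Ψ p)) p)
    (hΨu : ∀ p ∈ U, IsUnit (Ψ p)) {q : ℝ × ℝ} (hq : q ∈ U) :
    ∀ᶠ q' in 𝓝 q, Ring.inverse (Ψ q') * Φ q' = Ring.inverse (Ψ q) * Φ q := by
  obtain ⟨r, hr, hrU⟩ := Metric.isOpen_iff.1 hU q hq
  have hder : ∀ p ∈ U, HasFDerivAt (fun q' => Ring.inverse (Ψ q') * Φ q')
      (0 : ℝ × ℝ →L[ℝ] 𝒜) p := by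
    intro p hp
    obtain ⟨u, hu⟩ := hΨu p hp
    have h1 := (hasFDerivAt_ringInverse (𝕜 := ℝ) u)
    rw [hu] at h1
    refine ((h1.comp p (hΨ p hp)).mul' (hΦ p hp)).congr_fderiv ?_
    refine ContinuousLinearMap.ext fun v => ?_
    simp [← hu, mul_add, add_mul, mul_assoc]
  filter_upwards [ball_mem_nhds q hr] with q' hq'
  exact (convex_ball q r).is_const_of_fderivWithin_eq_zero (𝕜 := ℝ)
    (fun p hp => (hder p (hrU hp)).differentiableAt.differentiableWithinAt)
    (fun p hp => by
      rw [fderivWithin_of_isOpen isOpen_ball hp, (hder p (hrU hp)).fderiv]) hq'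
    (mem_ball_self hr)

end Flat

/-- The flat bundle glued from local sections of a discrete group that differ by locally constant
factors. -/
noncomputable def flatBundle {X G : Type*} [TopologicalSpace X] [TopologicalSpace G]
    [DiscreteTopology G] [Group G] (U : X → Set X) (hU : ∀ i, IsOpen (U i)) (hmem : ∀ x, x ∈ U x) (S : X → X → G)
    (hS : ∀ i j, ∀ q ∈ U i ∩ U j, ∀ᶠ q' in 𝓝 q, (S j q')⁻¹ * S i q' = (S j q)⁻¹ * S i q) :
    FiberBundleCore X X G where
  baseSet := U
  isOpen_baseSet := hU
  indexAt := id
  mem_baseSet_at := hmem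
  coordChange i j q v := (S j q)⁻¹ * S i q * v
  coordChange_self i x _ v := by simp
  continuousOn_coordChange i j := by
    rintro ⟨q, v⟩ hq
    refine ContinuousAt.continuousWithinAt ?_
    refine ContinuousAt.congr (continuousAt_const (y := (S j q)⁻¹ * S i q * v)) ?_
    rw [nhds_prod_eq]
    have h2 : ∀ᶠ v' in 𝓝 v, v' = v := by rw [nhds_discrete]; simp
    filter_upwards [(hS i j q hq.1).prod_mk h2] with p hp
    rw [hp.1, hp.2]
  coordChange_comp i j k x _ v := by group

/-- Local sections of a group that differ by locally constant factors can be glued, up to such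
factors, over a simply connected space. -/
theorem exists_glued_section {X G : Type*} [TopologicalSpace X] [SimplyConnectedSpace X]
    [LocallyPathConnectedSpace X] [Group G] (U : X → Set X)
    (hU : ∀ i, IsOpen (U i)) (hmem : ∀ x, x ∈ U x) (S : X → X → G)
    (hS : ∀ i j, ∀ q ∈ U i ∩ U j, ∀ᶠ q' in 𝓝 q, (S j q')⁻¹ * S i q' = (S j q)⁻¹ * S i q)
    (x₀ : X) :
    ∃ s : X → G, s x₀ = 1 ∧ ∀ q, ∃ c, ∀ᶠ q' in 𝓝 q, s q' = S q q' * c := by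
  -- With the discrete topology on G, locally constant transition functions are continuous, and the
  -- bundle is a covering.
  let _ : TopologicalSpace G := ⊥
  have : DiscreteTopology G := ⟨rfl⟩
  let Z := flatBundle U hU hmem S hS
  have cov : IsCoveringMap (Bundle.TotalSpace.proj : Bundle.TotalSpace G Z.Fiber → X) :=
    FiberBundle.isCoveringMap
  -- A lift of the identity is a global section; it exists because X is simply connected and locally
  -- path connected. Its starting value is the one for which the glued section equals 1 at x₀.
  obtain ⟨F, ⟨hF0, hF⟩, -⟩ := cov.existsUnique_continuousMap_lifts (ContinuousMap.id X) x₀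
    ⟨x₀, ((S x₀ x₀)⁻¹ : G)⟩ rfl
  let fib : Bundle.TotalSpace G Z.Fiber → G := fun e => e.2
  -- The fibre over x is written in the chart with index x, so multiplying by S x x removes the
  -- dependence on the chart.
  let val : Bundle.TotalSpace G Z.Fiber → G := fun e => S e.1 e.1 * fib e
  have hproj : ∀ x, (F x).1 = x := fun x => congrFun hF x
  refine ⟨fun x => val (F x), ?_, fun q => ?_⟩
  · show val (F x₀) = 1
    rw [hF0]
    exact mul_inv_cancel (S x₀ x₀)
  · have hmemq : F q ∈ (Z.localTrivAt q).source := by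
      rw [Bundle.Trivialization.mem_source]
      show (F q).1 ∈ U q
      rw [hproj]; exact hmem q
    have hc : ContinuousAt (fun q' => (Z.localTrivAt q (F q')).2) q :=
      continuousAt_snd.comp
        (((Z.localTrivAt q).continuousOn.continuousAt
          ((Z.localTrivAt q).open_source.mem_nhds hmemq)).comp F.continuous.continuousAt)
    refine ⟨(Z.localTrivAt q (F q)).2, ?_⟩
    have h2 : ∀ᶠ q' in 𝓝 q, (Z.localTrivAt q (F q')).2 = (Z.localTrivAt q (F q)).2 := by
      have := hc
      rw [ContinuousAt, nhds_discrete G, tendsto_pure] at this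
      exact this
    filter_upwards [h2] with q' hq'
    rw [← hq']
    have e1 : (Z.localTrivAt q (F q')).2 =
        (S q (F q').1)⁻¹ * S (F q').1 (F q').1 * fib (F q') := rfl
    rw [e1, hproj q', mul_assoc, mul_inv_cancel_left, ← hproj q']
    simp only [val, hproj q']

/-- Flat linear systems have fundamental solutions on simply connected open sets. -/
theorem exists_solution_of_isSimplyConnected {𝒜 : Type*} [NormedRing 𝒜] [NormedAlgebra ℝ 𝒜]
    [CompleteSpace 𝒜] {A B : ℝ × ℝ → 𝒜} {Ω : Set (ℝ × ℝ)}
    (hΩ : IsOpen Ω) (hsc : IsSimplyConnected Ω) (hA : ContDiffOn ℝ ∞ A Ω)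
    (hB : ContDiffOn ℝ ∞ B Ω) (hflat : IsFlatOn A B Ω) {p₀ : ℝ × ℝ} (hp₀ : p₀ ∈ Ω) :
    ∃ Φ : ℝ × ℝ → 𝒜, Φ p₀ = 1 ∧ ∀ p ∈ Ω, HasFDerivAt Φ (ofPartials (A p * Φ p) (B p * Φ p)) p := by
  classical
  have hloc : ∀ i : Ω, _ := fun i => exists_local_solution hΩ hA hB hflat i.2
  choose U Ψ hUo hmem hUΩ hunit hΨ using hloc
  have := hsc.simplyConnectedSpace
  have : LocallyPathConnectedSpace Ω := hΩ.locallyPathConnectedSpace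
  -- The value 1 outside U i is a filler: only values on the chart domains are used.
  let S : Ω → Ω → 𝒜ˣ := fun i q => if h : (q : ℝ × ℝ) ∈ U i then (hunit i q h).unit else 1
  have hSval : ∀ i q : Ω, (q : ℝ × ℝ) ∈ U i → (S i q : 𝒜) = Ψ i q := fun i q h => by
    simp [S, h]
  have hSinv : ∀ i q : Ω, (q : ℝ × ℝ) ∈ U i → ((S i q)⁻¹ : 𝒜ˣ) = Ring.inverse (Ψ i q) :=
    fun i q h => by rw [← hSval i q h, Ring.inverse_unit]
  obtain ⟨s, hs0, hs⟩ := exists_glued_section (fun i : Ω => Subtype.val ⁻¹' U i)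
    (fun i => (hUo i).preimage continuous_subtype_val) hmem S (fun i j q hq => by
      have h1 := eventually_inverse_mul_eq ((hUo i).inter (hUo j)) (fun p hp => hΨ i p hp.1)
        (fun p hp => hΨ j p hp.2) (fun p hp => hunit j p hp.2) (q := q) hq
      have h2 := (continuous_subtype_val.continuousAt (x := q)).eventually h1
      have h3 : ∀ᶠ q' : Ω in 𝓝 q, (q' : ℝ × ℝ) ∈ U i ∩ U j :=
        (((hUo i).inter (hUo j)).preimage continuous_subtype_val).mem_nhds hq
      filter_upwards [h2, h3] with q' hq' hm
      apply Units.ext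
      rw [Units.val_mul, Units.val_mul, hSval i q' hm.1, hSval i q hq.1, hSinv j q' hm.2,
        hSinv j q hq.2, hq']) ⟨p₀, hp₀⟩
  refine ⟨fun p => if h : p ∈ Ω then s ⟨p, h⟩ else 0, by simp [hp₀, hs0], fun p hp => ?_⟩
  obtain ⟨c, hc⟩ := hs ⟨p, hp⟩
  have hc' : ∀ᶠ q in 𝓝 p, (if h : q ∈ Ω then (s ⟨q, h⟩ : 𝒜) else 0) = Ψ ⟨p, hp⟩ q * c := by
    rw [nhds_subtype_eq_comap, eventually_comap] at hc
    filter_upwards [hc, (hUo ⟨p, hp⟩).mem_nhds (hmem _)] with q hq hqU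
    have hqΩ := hUΩ _ hqU
    rw [dif_pos hqΩ, hq ⟨q, hqΩ⟩ rfl, Units.val_mul, hSval _ _ hqU]
  have hval := hc'.self_of_nhds
  beta_reduce
  rw [hval]
  refine HasFDerivAt.congr_of_eventuallyEq ?_ hc'
  refine ((hΨ ⟨p, hp⟩ p (hmem _)).mul_const' (c : 𝒜)).congr_fderiv ?_
  ext <;> simp [mul_assoc]

/-- Solutions of linear systems with smooth coefficients are smooth. -/
theorem contDiffOn_of_hasFDerivAt_system {𝒜 : Type*} [NormedRing 𝒜] [NormedAlgebra ℝ 𝒜]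
    {A B Φ : ℝ × ℝ → 𝒜} {Ω : Set (ℝ × ℝ)} (hΩ : IsOpen Ω) (hA : ContDiffOn ℝ ∞ A Ω)
    (hB : ContDiffOn ℝ ∞ B Ω)
    (hΦ : ∀ p ∈ Ω, HasFDerivAt Φ (ofPartials (A p * Φ p) (B p * Φ p)) p) :
    ContDiffOn ℝ ∞ Φ Ω := by
  rw [contDiffOn_infty]
  intro n
  induction n with
  | zero => exact contDiffOn_zero.2 fun p hp => (hΦ p hp).continuousAt.continuousWithinAt
  | succ n ih =>
    push_cast
    rw [contDiffOn_succ_iff_fderiv_of_isOpen hΩ]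
    refine ⟨fun p hp => (hΦ p hp).differentiableAt.differentiableWithinAt, by simp, ?_⟩
    have hA' : ContDiffOn ℝ n A Ω := hA.of_le (mod_cast le_top)
    have hB' : ContDiffOn ℝ n B Ω := hB.of_le (mod_cast le_top)
    -- Bootstrapping: the derivative is an expression in A, B and Φ itself, so it is as smooth as Φ
    -- is already known to be.
    refine ContDiffOn.congr (f := fun p => ofPartials (A p * Φ p) (B p * Φ p)) ?_
      fun p hp => (hΦ p hp).fderiv
    exact (contDiffOn_const.smulRight (hA'.mul ih)).add (contDiffOn_const.smulRight (hB'.mul ih))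

/-! ### Differentiation rules in terms of pairs of partial derivatives -/

section PartialsCalculus

variable {u v : ℝ × ℝ → ℝ} {p : ℝ × ℝ}

theorem hasFDerivAt_ofPartials {V : Type*} [NormedAddCommGroup V] [NormedSpace ℝ V]
    {f : ℝ × ℝ → V} (h : DifferentiableAt ℝ f p) :
    HasFDerivAt f (ofPartials (dX f p) (dY f p)) p :=
  h.hasFDerivAt.congr_fderiv (fderiv_eq_ofPartials f p)

theorem hasFDerivAt_apply {X : ℝ × ℝ → L3} {a b : L3} (h : HasFDerivAt X (ofPartials a b) p)
    (i : Fin 3) : HasFDerivAt (fun q => X q i) (ofPartials (a i) (b i)) p := by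
  refine (hasFDerivAt_pi'.1 h i).congr_fderiv ?_
  ext <;> simp

theorem hasFDerivAt_mul {a b c d : ℝ} (hu : HasFDerivAt u (ofPartials a b) p)
    (hv : HasFDerivAt v (ofPartials c d) p) :
    HasFDerivAt (fun q => u q * v q)
      (ofPartials (a * v p + u p * c) (b * v p + u p * d)) p := by
  refine (hu.mul hv).congr_fderiv ?_
  ext <;> simp <;> ring

theorem hasFDerivAt_add {a b c d : ℝ} (hu : HasFDerivAt u (ofPartials a b) p)
    (hv : HasFDerivAt v (ofPartials c d) p) :
    HasFDerivAt (fun q => u q + v q) (ofPartials (a + c) (b + d)) p := by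
  refine (hu.add hv).congr_fderiv ?_
  ext <;> simp

theorem hasFDerivAt_sub {a b c d : ℝ} (hu : HasFDerivAt u (ofPartials a b) p)
    (hv : HasFDerivAt v (ofPartials c d) p) :
    HasFDerivAt (fun q => u q - v q) (ofPartials (a - c) (b - d)) p := by
  refine (hu.sub hv).congr_fderiv ?_
  ext <;> simp

theorem hasFDerivAt_const_mul {a b : ℝ} (c : ℝ) (hu : HasFDerivAt u (ofPartials a b) p) :
    HasFDerivAt (fun q => c * u q) (ofPartials (c * a) (c * b)) p := by
  refine (hu.const_mul c).congr_fderiv ?_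
  ext <;> simp

theorem hasFDerivAt_exp_mul {a b : ℝ} (c : ℝ) (hu : HasFDerivAt u (ofPartials a b) p) :
    HasFDerivAt (fun q => Real.exp (c * u q))
      (ofPartials (c * a * Real.exp (c * u p)) (c * b * Real.exp (c * u p))) p := by
  refine (hu.const_mul c).exp.congr_fderiv ?_
  ext <;> simp <;> ring

theorem eq_of_hasFDerivAt_zero {V : Type*} [NormedAddCommGroup V] [NormedSpace ℝ V]
    {f : ℝ × ℝ → V} {Ω : Set (ℝ × ℝ)} (hΩ : IsOpen Ω) (hc : IsPreconnected Ω)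
    (hf : ∀ p ∈ Ω, HasFDerivAt f (ofPartials (0 : V) 0) p) {p q : ℝ × ℝ} (hp : p ∈ Ω)
    (hq : q ∈ Ω) : f p = f q :=
  hΩ.is_const_of_fderiv_eq_zero (𝕜 := ℝ) hc
    (fun r hr => (hf r hr).differentiableAt.differentiableWithinAt)
    (fun r hr => by rw [(hf r hr).fderiv]; ext <;> simp) hp hq

end PartialsCalculus

/-! ### Linear algebra of the Lorentz–Minkowski space -/

theorem lor_comm (u v : L3) : lor u v = lor v u := by simp only [lor]; ring

theorem lor_add_left (u v w : L3) : lor (u + v) w = lor u w + lor v w := by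
  simp only [lor, Pi.add_apply]; ring

theorem lor_smul_left (c : ℝ) (u v : L3) : lor (c • u) v = c * lor u v := by
  simp only [lor, Pi.smul_apply, smul_eq_mul]; ring

theorem lor_sub_left (u v w : L3) : lor (u - v) w = lor u w - lor v w := by
  simp only [lor, Pi.sub_apply]; ring

theorem lor_smul_right (c : ℝ) (u v : L3) : lor u (c • v) = c * lor u v := by
  simp only [lor, Pi.smul_apply, smul_eq_mul]; ring

theorem lor_lcross_left (u v : L3) : lor (lcross u v) u = 0 := by simp [lor, lcross]; ring

theorem lor_lcross_right (u v : L3) : lor (lcross u v) v = 0 := by simp [lor, lcross]; ring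

theorem lor_lcross_lcross (u v : L3) :
    lor (lcross u v) (lcross u v) = lor u v ^ 2 - lor u u * lor v v := by
  simp [lor, lcross]; ring

/-- The frame `X`, `Y`, `N` is adapted to a surface with first fundamental form
`e⁻¹ (dx² + ε dy²)`. -/
structure IsAdapted (ε e : ℝ) (X Y N : L3) : Prop where
  XX : lor X X = e⁻¹
  XY : lor X Y = 0
  YY : lor Y Y = ε * e⁻¹
  NX : lor N X = 0
  NY : lor N Y = 0
  NN : lor N N = -ε

/-- The tensor `e (X ⊗ X' + ε Y ⊗ Y') - ε N ⊗ N'`. -/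
noncomputable def frameTensor (ε e : ℝ) (X Y N X' Y' N' : L3) : Matrix (Fin 3) (Fin 3) ℝ :=
  Matrix.of fun i j => e * (X i * X' j) + ε * e * (Y i * Y' j) - ε * (N i * N' j)

/-- The matrix of the Lorentzian metric. -/
noncomputable def lorMatrix : Matrix (Fin 3) (Fin 3) ℝ := Matrix.diagonal ![1, 1, -1]

/-- The matrix with the given columns. -/
noncomputable def colMatrix (X Y N : L3) : Matrix (Fin 3) (Fin 3) ℝ :=
  Matrix.of fun i => ![X i, Y i, N i]

theorem lorMatrix_mul_self : lorMatrix * lorMatrix = 1 := by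
  ext i j; fin_cases i <;> fin_cases j <;> simp [lorMatrix]

theorem frameTensor_eq (ε e : ℝ) (X Y N X' Y' N' : L3) :
    frameTensor ε e X Y N X' Y' N' =
      colMatrix X Y N * Matrix.diagonal ![e, ε * e, -ε] * (colMatrix X' Y' N').transpose := by
  ext i j
  simp [frameTensor, colMatrix, Matrix.mul_apply, Fin.sum_univ_three, Matrix.diagonal]
  ring

theorem isAdapted_iff_gram {ε e : ℝ} {X Y N : L3} :
    IsAdapted ε e X Y N ↔ (colMatrix X Y N).transpose * lorMatrix * colMatrix X Y N =
      Matrix.diagonal ![e⁻¹, ε * e⁻¹, -ε] := by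
  have key : (colMatrix X Y N).transpose * lorMatrix * colMatrix X Y N =
      !![lor X X, lor X Y, lor N X; lor X Y, lor Y Y, lor N Y; lor N X, lor N Y, lor N N] := by
    ext i j
    fin_cases i <;> fin_cases j <;>
      simp [colMatrix, lorMatrix, Matrix.mul_apply, Fin.sum_univ_three, Matrix.diagonal, lor] <;>
      ring
  rw [key]
  constructor
  · rintro ⟨h1, h2, h3, h4, h5, h6⟩
    rw [h1, h2, h3, h4, h5, h6]
    ext i j; fin_cases i <;> fin_cases j <;> simp
  · intro h
    have h' := fun i j => congrFun (congrFun h i) j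
    exact ⟨by simpa using h' 0 0, by simpa using h' 0 1, by simpa using h' 1 1,
      by simpa using h' 0 2, by simpa using h' 1 2, by simpa using h' 2 2⟩

/-- With M the frame matrix and G the metric, adaptedness is Mᵀ G M = D⁻¹, so D Mᵀ G is a left
inverse of M. A left inverse of a square matrix is a right inverse, and this turns the condition
into M D Mᵀ = G, an equation for the tensor that stays constant along moving frames. -/
theorem isAdapted_iff {ε e : ℝ} (hε : ε = 1 ∨ ε = -1) (he : e ≠ 0) {X Y N : L3} :
    IsAdapted ε e X Y N ↔ frameTensor ε e X Y N X Y N = lorMatrix := by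
  have hD : (Matrix.diagonal ![e, ε * e, -ε] : Matrix (Fin 3) (Fin 3) ℝ) *
      Matrix.diagonal ![e⁻¹, ε * e⁻¹, -ε] = 1 := by
    ext i j; rcases hε with rfl | rfl <;> fin_cases i <;> fin_cases j <;> simp [he]
  have hD' := mul_eq_one_comm.1 hD
  have hH := lorMatrix_mul_self
  rw [isAdapted_iff_gram, frameTensor_eq]
  generalize colMatrix X Y N = M at *
  generalize (Matrix.diagonal ![e, ε * e, -ε] : Matrix (Fin 3) (Fin 3) ℝ) = D at *
  generalize (Matrix.diagonal ![e⁻¹, ε * e⁻¹, -ε] : Matrix (Fin 3) (Fin 3) ℝ) = D' at *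
  constructor
  · intro h
    have h1 : (D * M.transpose * lorMatrix) * M = 1 := by
      rw [← hD, ← h]; simp only [mul_assoc]
    have h2 := mul_eq_one_comm.1 h1
    calc M * D * M.transpose = M * (D * M.transpose * lorMatrix) * lorMatrix := by
          simp only [mul_assoc, hH, mul_one]
      _ = lorMatrix := by rw [h2, one_mul]
  · intro h
    have h1 : M * (D * M.transpose * lorMatrix) = 1 := by
      rw [← hH, ← h]; simp only [mul_assoc]
    have h2 := mul_eq_one_comm.1 h1
    calc M.transpose * lorMatrix * M = D' * (D * M.transpose * lorMatrix * M) := by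
          rw [← mul_assoc, ← mul_assoc, ← mul_assoc, hD', one_mul]
      _ = D' := by rw [h2, mul_one]

theorem IsAdapted.expansion {ε e : ℝ} (hε : ε = 1 ∨ ε = -1) (he : e ≠ 0) {X Y N : L3}
    (h : IsAdapted ε e X Y N) (u : L3) :
    u = (e * lor u X) • X + (ε * e * lor u Y) • Y - (ε * lor u N) • N := by
  have h1 := (isAdapted_iff hε he).1 h
  have h2 : ∀ i, u i = ∑ j, lorMatrix i j * (![1, 1, -1] j * u j) := fun i => by
    fin_cases i <;> simp [lorMatrix, Matrix.diagonal]
  ext i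
  rw [h2, ← h1]
  simp [frameTensor, Fin.sum_univ_three, lor]
  ring

/-! ### Moving frames -/

/-- The Gauss–Weingarten equations of a surface with fundamental forms `e^{2λ} (dx² + ε dy²)` and
`dx² - ε dy²`. -/
structure IsMovingFrame (ε : ℝ) (lam : ℝ × ℝ → ℝ) (X Y N : ℝ × ℝ → L3) (Ω : Set (ℝ × ℝ)) :
    Prop where
  hasFDerivAt_X : ∀ p ∈ Ω, HasFDerivAt X (ofPartials
    (dX lam p • X p - (ε * dY lam p) • Y p - ε • N p) (dY lam p • X p + dX lam p • Y p)) p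
  hasFDerivAt_Y : ∀ p ∈ Ω, HasFDerivAt Y (ofPartials
    (dY lam p • X p + dX lam p • Y p) (-(ε * dX lam p) • X p + dY lam p • Y p + N p)) p
  hasFDerivAt_N : ∀ p ∈ Ω, HasFDerivAt N (ofPartials
    (-Real.exp (-2 * lam p) • X p) (Real.exp (-2 * lam p) • Y p)) p

namespace IsMovingFrame

variable {ε : ℝ} {lam : ℝ × ℝ → ℝ} {X Y N X' Y' N' : ℝ × ℝ → L3} {Ω : Set (ℝ × ℝ)}

/-- In the derivative of each entry the connection terms of the two frames cancel in pairs, the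
factor e^{-2λ} absorbing the terms in λ_x and λ_y; only ε² = 1 is needed. The two frames may be
equal or belong to different surfaces. -/
theorem frameTensor_const (hε : ε = 1 ∨ ε = -1) (hΩ : IsOpen Ω) (hc : IsPreconnected Ω)
    (hlam : ∀ p ∈ Ω, DifferentiableAt ℝ lam p) (hF : IsMovingFrame ε lam X Y N Ω)
    (hF' : IsMovingFrame ε lam X' Y' N' Ω) {p q : ℝ × ℝ} (hp : p ∈ Ω) (hq : q ∈ Ω) :
    frameTensor ε (Real.exp (-2 * lam p)) (X p) (Y p) (N p) (X' p) (Y' p) (N' p) =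
      frameTensor ε (Real.exp (-2 * lam q)) (X q) (Y q) (N q) (X' q) (Y' q) (N' q) := by
  ext i j
  refine eq_of_hasFDerivAt_zero (f := fun p => frameTensor ε (Real.exp (-2 * lam p)) (X p) (Y p)
    (N p) (X' p) (Y' p) (N' p) i j) hΩ hc (fun p hp => ?_) hp hq
  have he := hasFDerivAt_exp_mul (-2) (hasFDerivAt_ofPartials (hlam p hp))
  have hX := hasFDerivAt_apply (hF.hasFDerivAt_X p hp) i
  have hY := hasFDerivAt_apply (hF.hasFDerivAt_Y p hp) i
  have hN := hasFDerivAt_apply (hF.hasFDerivAt_N p hp) i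
  have hX' := hasFDerivAt_apply (hF'.hasFDerivAt_X p hp) j
  have hY' := hasFDerivAt_apply (hF'.hasFDerivAt_Y p hp) j
  have hN' := hasFDerivAt_apply (hF'.hasFDerivAt_N p hp) j
  refine (hasFDerivAt_sub (hasFDerivAt_add (hasFDerivAt_mul he (hasFDerivAt_mul hX hX'))
    (hasFDerivAt_mul (hasFDerivAt_const_mul ε he) (hasFDerivAt_mul hY hY')))
    (hasFDerivAt_const_mul ε (hasFDerivAt_mul hN hN'))).congr_fderiv ?_
  congr 1
  · simp only [Pi.add_apply, Pi.sub_apply, Pi.smul_apply, smul_eq_mul]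
    rcases hε with rfl | rfl <;> ring
  · simp only [Pi.add_apply, Pi.smul_apply, smul_eq_mul]
    rcases hε with rfl | rfl <;> ring

/-- The connection matrices on (X, Y, N) have traces 2λ_x and 2λ_y, so the volume of the frame grows
like e^{2λ}. -/
theorem volume_const (hΩ : IsOpen Ω) (hc : IsPreconnected Ω)
    (hlam : ∀ p ∈ Ω, DifferentiableAt ℝ lam p) (hF : IsMovingFrame ε lam X Y N Ω)
    {p q : ℝ × ℝ} (hp : p ∈ Ω) (hq : q ∈ Ω) :
    Real.exp (-2 * lam p) * lor (lcross (X p) (Y p)) (N p) =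
      Real.exp (-2 * lam q) * lor (lcross (X q) (Y q)) (N q) := by
  have hrw : ∀ p, lor (lcross (X p) (Y p)) (N p) =
      (X p 1 * Y p 2 - X p 2 * Y p 1) * N p 0 + (X p 2 * Y p 0 - X p 0 * Y p 2) * N p 1
        - (X p 1 * Y p 0 - X p 0 * Y p 1) * N p 2 := fun p => by simp [lor, lcross]
  simp only [hrw]
  refine eq_of_hasFDerivAt_zero (f := fun p => Real.exp (-2 * lam p) *
    ((X p 1 * Y p 2 - X p 2 * Y p 1) * N p 0 + (X p 2 * Y p 0 - X p 0 * Y p 2) * N p 1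
        - (X p 1 * Y p 0 - X p 0 * Y p 1) * N p 2)) hΩ hc (fun p hp => ?_) hp hq
  have he := hasFDerivAt_exp_mul (-2) (hasFDerivAt_ofPartials (hlam p hp))
  have hX := hasFDerivAt_apply (hF.hasFDerivAt_X p hp)
  have hY := hasFDerivAt_apply (hF.hasFDerivAt_Y p hp)
  have hN := hasFDerivAt_apply (hF.hasFDerivAt_N p hp)
  have h2 := fun i j => hasFDerivAt_sub (hasFDerivAt_mul (hX i) (hY j))
    (hasFDerivAt_mul (hX j) (hY i))
  refine (hasFDerivAt_mul he (hasFDerivAt_sub (hasFDerivAt_add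
    (hasFDerivAt_mul (h2 1 2) (hN 0)) (hasFDerivAt_mul (h2 2 0) (hN 1)))
    (hasFDerivAt_mul (h2 1 0) (hN 2)))).congr_fderiv ?_
  congr 1
  · simp only [Pi.add_apply, Pi.sub_apply, Pi.smul_apply, smul_eq_mul]
    ring
  · simp only [Pi.add_apply, Pi.smul_apply, smul_eq_mul]
    ring

end IsMovingFrame

/-! ### The flat connection of the Gauss–Weingarten equations -/

/-- The phase space: a point and a frame. -/
abbrev FrameSpace : Type := L3 × L3 × L3 × L3

/-- The linear map `(ψ, X, Y, N) ↦ a X`, and so on, of the `x`-derivative in the Gauss–Weingarten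
equations. -/
noncomputable def gaussX (ε a b e : ℝ) : FrameSpace →L[ℝ] FrameSpace :=
  let pX : FrameSpace →L[ℝ] L3 := ContinuousLinearMap.fst ℝ L3 (L3 × L3) ∘L
    ContinuousLinearMap.snd ℝ L3 (L3 × L3 × L3)
  let pY : FrameSpace →L[ℝ] L3 := ContinuousLinearMap.fst ℝ L3 L3 ∘L
    ContinuousLinearMap.snd ℝ L3 (L3 × L3) ∘L ContinuousLinearMap.snd ℝ L3 (L3 × L3 × L3)
  let pN : FrameSpace →L[ℝ] L3 := ContinuousLinearMap.snd ℝ L3 L3 ∘L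
    ContinuousLinearMap.snd ℝ L3 (L3 × L3) ∘L ContinuousLinearMap.snd ℝ L3 (L3 × L3 × L3)
  pX.prod ((-(ε • pN)).prod (0 : FrameSpace →L[ℝ] L3 × L3)) +
    a • (0 : FrameSpace →L[ℝ] L3).prod (pX.prod (pY.prod 0)) +
    b • (0 : FrameSpace →L[ℝ] L3).prod ((-(ε • pY)).prod (pX.prod 0)) +
    e • (0 : FrameSpace →L[ℝ] L3).prod
      ((0 : FrameSpace →L[ℝ] L3).prod ((0 : FrameSpace →L[ℝ] L3).prod (-pX)))

/-- The linear map of the `y`-derivative in the Gauss–Weingarten equations. -/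
noncomputable def gaussY (ε a b e : ℝ) : FrameSpace →L[ℝ] FrameSpace :=
  let pX : FrameSpace →L[ℝ] L3 := ContinuousLinearMap.fst ℝ L3 (L3 × L3) ∘L
    ContinuousLinearMap.snd ℝ L3 (L3 × L3 × L3)
  let pY : FrameSpace →L[ℝ] L3 := ContinuousLinearMap.fst ℝ L3 L3 ∘L
    ContinuousLinearMap.snd ℝ L3 (L3 × L3) ∘L ContinuousLinearMap.snd ℝ L3 (L3 × L3 × L3)
  let pN : FrameSpace →L[ℝ] L3 := ContinuousLinearMap.snd ℝ L3 L3 ∘L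
    ContinuousLinearMap.snd ℝ L3 (L3 × L3) ∘L ContinuousLinearMap.snd ℝ L3 (L3 × L3 × L3)
  pY.prod ((0 : FrameSpace →L[ℝ] L3).prod (pN.prod 0)) +
    a • (0 : FrameSpace →L[ℝ] L3).prod (pY.prod ((-(ε • pX)).prod 0)) +
    b • (0 : FrameSpace →L[ℝ] L3).prod (pX.prod (pY.prod 0)) +
    e • (0 : FrameSpace →L[ℝ] L3).prod
      ((0 : FrameSpace →L[ℝ] L3).prod ((0 : FrameSpace →L[ℝ] L3).prod pY))

theorem gaussX_apply (ε a b e : ℝ) (v : FrameSpace) : gaussX ε a b e v =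
    (v.2.1, a • v.2.1 - (ε * b) • v.2.2.1 - ε • v.2.2.2, b • v.2.1 + a • v.2.2.1,
      -e • v.2.1) := by
  simp only [gaussX]
  refine Prod.ext ?_ (Prod.ext ?_ (Prod.ext ?_ ?_)) <;> simp <;> module

theorem gaussY_apply (ε a b e : ℝ) (v : FrameSpace) : gaussY ε a b e v =
    (v.2.2.1, b • v.2.1 + a • v.2.2.1, -(ε * a) • v.2.1 + b • v.2.2.1 + v.2.2.2,
      e • v.2.2.1) := by
  simp only [gaussY]
  refine Prod.ext ?_ (Prod.ext ?_ (Prod.ext ?_ ?_)) <;> simp <;> module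

theorem contDiffOn_gaussX (ε : ℝ) {a b e : ℝ × ℝ → ℝ} {Ω : Set (ℝ × ℝ)}
    (ha : ContDiffOn ℝ ∞ a Ω) (hb : ContDiffOn ℝ ∞ b Ω) (he : ContDiffOn ℝ ∞ e Ω) :
    ContDiffOn ℝ ∞ (fun p => gaussX ε (a p) (b p) (e p)) Ω :=
  ((contDiffOn_const.add (ha.smul contDiffOn_const)).add (hb.smul contDiffOn_const)).add
    (he.smul contDiffOn_const)

theorem contDiffOn_gaussY (ε : ℝ) {a b e : ℝ × ℝ → ℝ} {Ω : Set (ℝ × ℝ)}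
    (ha : ContDiffOn ℝ ∞ a Ω) (hb : ContDiffOn ℝ ∞ b Ω) (he : ContDiffOn ℝ ∞ e Ω) :
    ContDiffOn ℝ ∞ (fun p => gaussY ε (a p) (b p) (e p)) Ω :=
  ((contDiffOn_const.add (ha.smul contDiffOn_const)).add (hb.smul contDiffOn_const)).add
    (he.smul contDiffOn_const)

/-- The Gauss–Weingarten operators are affine in the coefficients (a, b, e). Their derivatives are
therefore the same operators with differentiated coefficients, minus the constant part. -/
theorem fderiv_affine_combination {W : Type*} [NormedAddCommGroup W] [NormedSpace ℝ W]
    (C₀ C₁ C₂ C₃ : W) {a b e : ℝ × ℝ → ℝ} {p : ℝ × ℝ} (ha : DifferentiableAt ℝ a p)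
    (hb : DifferentiableAt ℝ b p) (he : DifferentiableAt ℝ e p) (v : ℝ × ℝ) :
    fderiv ℝ (fun p => C₀ + a p • C₁ + b p • C₂ + e p • C₃) p v =
      fderiv ℝ a p v • C₁ + fderiv ℝ b p v • C₂ + fderiv ℝ e p v • C₃ := by
  have := (((hasFDerivAt_const C₀ p).add (ha.hasFDerivAt.smul_const C₁)).add
    (hb.hasFDerivAt.smul_const C₂)).add (he.hasFDerivAt.smul_const C₃)
  have h2 := this.fderiv
  simp only [Pi.add_def] at h2
  rw [h2]
  simp

theorem fderiv_gaussX (ε : ℝ) {a b e : ℝ × ℝ → ℝ} {p : ℝ × ℝ} (ha : DifferentiableAt ℝ a p)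
    (hb : DifferentiableAt ℝ b p) (he : DifferentiableAt ℝ e p) (v : ℝ × ℝ) :
    fderiv ℝ (fun p => gaussX ε (a p) (b p) (e p)) p v =
      gaussX ε (fderiv ℝ a p v) (fderiv ℝ b p v) (fderiv ℝ e p v) - gaussX ε 0 0 0 := by
  refine (fderiv_affine_combination _ _ _ _ ha hb he v).trans ?_
  simp only [gaussX]
  module

theorem fderiv_gaussY (ε : ℝ) {a b e : ℝ × ℝ → ℝ} {p : ℝ × ℝ} (ha : DifferentiableAt ℝ a p)
    (hb : DifferentiableAt ℝ b p) (he : DifferentiableAt ℝ e p) (v : ℝ × ℝ) :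
    fderiv ℝ (fun p => gaussY ε (a p) (b p) (e p)) p v =
      gaussY ε (fderiv ℝ a p v) (fderiv ℝ b p v) (fderiv ℝ e p v) - gaussY ε 0 0 0 := by
  refine (fderiv_affine_combination _ _ _ _ ha hb he v).trans ?_
  simp only [gaussY]
  module

theorem dX_dY_comm {V : Type*} [NormedAddCommGroup V] [NormedSpace ℝ V] {f : ℝ × ℝ → V}
    {Ω : Set (ℝ × ℝ)} (hΩ : IsOpen Ω) (hf : ContDiffOn ℝ ∞ f Ω) {p : ℝ × ℝ} (hp : p ∈ Ω) :
    dX (dY f) p = dY (dX f) p := by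
  have hfp := hf.contDiffAt (hΩ.mem_nhds hp)
  have hsymm : IsSymmSndFDerivAt ℝ f p := hfp.isSymmSndFDerivAt (by simpa using ENat.LEInfty.out)
  have hd : DifferentiableAt ℝ (fderiv ℝ f) p :=
    (hfp.fderiv_right (m := ∞) le_rfl).differentiableAt (by simp)
  have key : ∀ v w, fderiv ℝ (fun q => fderiv ℝ f q v) p w = fderiv ℝ (fderiv ℝ f) p w v :=
    fun v w => by
      rw [fderiv_clm_apply hd (differentiableAt_const v)]
      simp
  show fderiv ℝ (fun q => fderiv ℝ f q (0, 1)) p (1, 0) =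
    fderiv ℝ (fun q => fderiv ℝ f q (1, 0)) p (0, 1)
  rw [key, key]
  exact hsymm _ _

/-- Comparing the components of A_y + AB and B_x + BA on a frame, everything agrees identically
except the combination λ_xx + ελ_yy + εe^{-2λ}, which vanishes by the Liouville equation. -/
theorem isFlatOn_gauss {ε : ℝ} (hε : ε = 1 ∨ ε = -1) {lam : ℝ × ℝ → ℝ} {Ω : Set (ℝ × ℝ)}
    (hΩ : IsOpen Ω) (hlam : ContDiffOn ℝ ∞ lam Ω)
    (hL : ∀ p ∈ Ω, laplaceBeltrami ε lam lam p = -ε * Real.exp (-4 * lam p)) :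
    IsFlatOn (fun p => gaussX ε (dX lam p) (dY lam p) (Real.exp (-2 * lam p)))
      (fun p => gaussY ε (dX lam p) (dY lam p) (Real.exp (-2 * lam p))) Ω := by
  intro p hp
  have hn := hΩ.mem_nhds hp
  have hl := (hlam.contDiffAt hn).differentiableAt (by simp)
  have ha := ((contDiffOn_dX hΩ hlam).contDiffAt hn).differentiableAt (by simp)
  have hb := ((contDiffOn_dY hΩ hlam).contDiffAt hn).differentiableAt (by simp)
  have he := hasFDerivAt_exp_mul (-2) (hasFDerivAt_ofPartials hl)
  have hcomm := dX_dY_comm hΩ hlam hp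
  -- The Liouville equation divided by e^{-2λ} is solved for λ_xx, which can then be eliminated.
  have hL' : dX (dX lam) p = -ε * dY (dY lam) p - ε * Real.exp (-2 * lam p) := by
    have h1 := hL p hp
    have h2 : Real.exp (-4 * lam p) = Real.exp (-2 * lam p) * Real.exp (-2 * lam p) := by
      rw [← Real.exp_add]; ring_nf
    rw [laplaceBeltrami, h2] at h1
    have h3 := (Real.exp_pos (-2 * lam p)).ne'
    have h4 : dX (dX lam) p + ε * dY (dY lam) p = -ε * Real.exp (-2 * lam p) :=
      mul_left_cancel₀ h3 (by linarith)
    linarith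
  have eA : dY (fun p => gaussX ε (dX lam p) (dY lam p) (Real.exp (-2 * lam p))) p =
      gaussX ε (dX (dY lam) p) (dY (dY lam) p)
        (-2 * dY lam p * Real.exp (-2 * lam p)) - gaussX ε 0 0 0 := by
    rw [hcomm, dY, fderiv_gaussX ε ha hb he.differentiableAt, he.fderiv]
    simp [dY]
  have eB : dX (fun p => gaussY ε (dX lam p) (dY lam p) (Real.exp (-2 * lam p))) p =
      gaussY ε (dX (dX lam) p) (dX (dY lam) p)
        (-2 * dX lam p * Real.exp (-2 * lam p)) - gaussY ε 0 0 0 := by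
    rw [dX, fderiv_gaussY ε ha hb he.differentiableAt, he.fderiv]
    simp [dX]
  rw [eA, eB, hL']
  refine ContinuousLinearMap.ext fun v => ?_
  simp only [add_apply, sub_apply, mul_apply_eq_comp, gaussX_apply, gaussY_apply]
  refine Prod.ext ?_ (Prod.ext ?_ (Prod.ext ?_ ?_))
  all_goals
    simp only [Prod.fst_add, Prod.snd_add, Prod.fst_sub, Prod.snd_sub]
    rcases hε with rfl | rfl <;> module

/-! ### Liouville immersions and their moving frames -/

theorem dX_congr {V : Type*} [NormedAddCommGroup V] [NormedSpace ℝ V] {f g : ℝ × ℝ → V}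
    {Ω : Set (ℝ × ℝ)} (hΩ : IsOpen Ω) (h : ∀ q ∈ Ω, f q = g q) {p : ℝ × ℝ} (hp : p ∈ Ω) :
    dX f p = dX g p := by
  rw [dX, dX, Filter.EventuallyEq.fderiv_eq (eventuallyEq_of_mem (hΩ.mem_nhds hp) h)]

theorem dY_congr {V : Type*} [NormedAddCommGroup V] [NormedSpace ℝ V] {f g : ℝ × ℝ → V}
    {Ω : Set (ℝ × ℝ)} (hΩ : IsOpen Ω) (h : ∀ q ∈ Ω, f q = g q) {p : ℝ × ℝ} (hp : p ∈ Ω) :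
    dY f p = dY g p := by
  rw [dY, dY, Filter.EventuallyEq.fderiv_eq (eventuallyEq_of_mem (hΩ.mem_nhds hp) h)]

theorem partials_eq_of_eqOn {V : Type*} [NormedAddCommGroup V] [NormedSpace ℝ V]
    {f g : ℝ × ℝ → V} {Ω : Set (ℝ × ℝ)} (hΩ : IsOpen Ω) (h : ∀ q ∈ Ω, f q = g q) {p : ℝ × ℝ}
    (hp : p ∈ Ω) {a b c d : V} (hf : HasFDerivAt f (ofPartials a b) p)
    (hg : HasFDerivAt g (ofPartials c d) p) : a = c ∧ b = d :=
  ⟨by rw [← dX_eq_of_hasFDerivAt hf, ← dX_eq_of_hasFDerivAt hg, dX_congr hΩ h hp],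
    by rw [← dY_eq_of_hasFDerivAt hf, ← dY_eq_of_hasFDerivAt hg, dY_congr hΩ h hp]⟩

theorem hasFDerivAt_lor {u v : ℝ × ℝ → L3} {p : ℝ × ℝ} {a b c d : L3}
    (hu : HasFDerivAt u (ofPartials a b) p) (hv : HasFDerivAt v (ofPartials c d) p) :
    HasFDerivAt (fun q => lor (u q) (v q))
      (ofPartials (lor a (v p) + lor (u p) c) (lor b (v p) + lor (u p) d)) p := by
  have h := fun i => hasFDerivAt_mul (hasFDerivAt_apply hu i) (hasFDerivAt_apply hv i)
  refine (hasFDerivAt_sub (hasFDerivAt_add (h 0) (h 1)) (h 2)).congr_fderiv ?_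
  congr 1 <;> simp only [lor] <;> ring

theorem exp_neg_two_mul_inv (t : ℝ) : (Real.exp (-2 * t))⁻¹ = Real.exp (2 * t) := by
  rw [← Real.exp_neg]; ring_nf

theorem lcross_eq_of_isAdapted {ε e : ℝ} (hε : ε = 1 ∨ ε = -1) (he : e ≠ 0) {X Y N : L3}
    (h : IsAdapted ε e X Y N) (hvol : lor (lcross X Y) N = e⁻¹) :
    lcross X Y = -(ε * e⁻¹) • N := by
  have := h.expansion hε he (lcross X Y)
  rw [lor_lcross_left, lor_lcross_right, hvol] at this
  rw [this]; module

/-- A surface whose derivatives are part of an adapted moving frame is a Liouville immersion. -/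
theorem IsMovingFrame.isLiouvilleImmersion {ε : ℝ} (hε : ε = 1 ∨ ε = -1) {lam : ℝ × ℝ → ℝ}
    {ψ X Y N : ℝ × ℝ → L3} {Ω : Set (ℝ × ℝ)} (hΩ : IsOpen Ω) (hψ : ContDiffOn ℝ ∞ ψ Ω)
    (hF : IsMovingFrame ε lam X Y N Ω)
    (hψ' : ∀ p ∈ Ω, HasFDerivAt ψ (ofPartials (X p) (Y p)) p)
    (had : ∀ p ∈ Ω, IsAdapted ε (Real.exp (-2 * lam p)) (X p) (Y p) (N p))
    (hvol : ∀ p ∈ Ω, lor (lcross (X p) (Y p)) (N p) = (Real.exp (-2 * lam p))⁻¹) :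
    IsLiouvilleImmersion ε Ω lam ψ := by
  have hX : ∀ p ∈ Ω, dX ψ p = X p := fun p hp => dX_eq_of_hasFDerivAt (hψ' p hp)
  have hY : ∀ p ∈ Ω, dY ψ p = Y p := fun p hp => dY_eq_of_hasFDerivAt (hψ' p hp)
  have hε2 : ε * ε = 1 := by rcases hε with rfl | rfl <;> norm_num
  have hE : ∀ p ∈ Ω, coeffE ψ p = (Real.exp (-2 * lam p))⁻¹ := fun p hp => by
    rw [coeffE, hX p hp, (had p hp).XX]
  have hN : ∀ p ∈ Ω, normalN ε ψ p = N p := fun p hp => by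
    have he := (Real.exp_pos (-2 * lam p)).ne'
    rw [normalN, hE p hp, hX p hp, hY p hp, lcross_eq_of_isAdapted hε he (had p hp) (hvol p hp),
      smul_smul]
    have : -ε / (Real.exp (-2 * lam p))⁻¹ * -(ε * (Real.exp (-2 * lam p))⁻¹) = 1 := by
      field_simp; linarith
    rw [this, one_smul]
  refine ⟨hψ, fun p hp => ?_, fun p hp => ?_, fun p hp => ?_, fun p hp => ?_, fun p hp => ?_,
    fun p hp => ?_, fun p hp => ?_⟩
  · rw [IsImmersionAt, (hψ' p hp).fderiv, injective_iff_map_eq_zero]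
    intro v hv
    have he := (Real.exp_pos (-2 * lam p)).ne'
    rw [ofPartials_apply] at hv
    have h1 : lor (v.1 • X p + v.2 • Y p) (X p) = 0 := by rw [hv]; simp [lor]
    have h2 : lor (v.1 • X p + v.2 • Y p) (Y p) = 0 := by rw [hv]; simp [lor]
    rw [lor_add_left, lor_smul_left, lor_smul_left, (had p hp).XX, lor_comm (Y p),
      (had p hp).XY] at h1
    rw [lor_add_left, lor_smul_left, lor_smul_left, (had p hp).XY, (had p hp).YY] at h2
    have hε0 : ε ≠ 0 := by rintro rfl; simp at hε2
    refine Prod.ext ?_ ?_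
    · simpa [he] using h1
    · simpa [he, hε0] using h2
  · rw [hE p hp, exp_neg_two_mul_inv]
  · rw [coeffF, hX p hp, hY p hp, (had p hp).XY]
  · rw [coeffG, hY p hp, (had p hp).YY, exp_neg_two_mul_inv]
  · rw [coeffl, hN p hp, dX_congr hΩ hX hp, dX_eq_of_hasFDerivAt (hF.hasFDerivAt_X p hp),
      lor_sub_left, lor_sub_left, lor_smul_left, lor_smul_left, lor_smul_left, (had p hp).NN,
      lor_comm, (had p hp).NX, lor_comm, (had p hp).NY]
    linarith
  · rw [coeffm, hN p hp, dX_congr hΩ hY hp, dX_eq_of_hasFDerivAt (hF.hasFDerivAt_Y p hp),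
      lor_add_left, lor_smul_left, lor_smul_left, lor_comm, (had p hp).NX, lor_comm,
      (had p hp).NY]
    simp
  · rw [coeffn, hN p hp, dY_congr hΩ hY hp, dY_eq_of_hasFDerivAt (hF.hasFDerivAt_Y p hp),
      lor_add_left, lor_add_left, lor_smul_left, lor_smul_left, lor_comm, (had p hp).NX, lor_comm,
      (had p hp).NY, (had p hp).NN]
    simp

/-- Solutions of the Liouville equation are conformal factors of Liouville immersions. -/
theorem exists_isLiouvilleImmersion {ε : ℝ} (hε : ε = 1 ∨ ε = -1)
    {Ω : Set (ℝ × ℝ)} (hΩ : IsOpen Ω) (hsc : IsSimplyConnected Ω)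
    {lam : ℝ × ℝ → ℝ} (hlam : ContDiffOn ℝ ∞ lam Ω)
    (hL : ∀ p ∈ Ω, laplaceBeltrami ε lam lam p = -ε * Real.exp (-4 * lam p)) :
    ∃ ψ, IsLiouvilleImmersion ε Ω lam ψ := by
  obtain ⟨p₀, hp₀⟩ := hsc.nonempty
  have hc : IsPreconnected Ω := hsc.isPathConnected.isConnected.isPreconnected
  have ha := contDiffOn_dX hΩ hlam
  have hb := contDiffOn_dY hΩ hlam
  have he : ContDiffOn ℝ ∞ (fun p => Real.exp (-2 * lam p)) Ω :=
    (contDiffOn_const.mul hlam).exp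
  have hA := contDiffOn_gaussX ε ha hb he
  have hB := contDiffOn_gaussY ε ha hb he
  obtain ⟨Φ, hΦ0, hΦ⟩ := exists_solution_of_isSimplyConnected hΩ hsc hA hB
    (isFlatOn_gauss hε hΩ hlam hL) hp₀
  have hΦs := contDiffOn_of_hasFDerivAt_system hΩ hA hB hΦ
  have hd : ∀ p ∈ Ω, DifferentiableAt ℝ lam p := fun p hp =>
    (hlam.contDiffAt (hΩ.mem_nhds hp)).differentiableAt (by simp)
  set s := Real.exp (lam p₀) with hs
  have hs0 : 0 < s := Real.exp_pos _
  have hse : Real.exp (-2 * lam p₀) = (s * s)⁻¹ := by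
    rw [hs, ← Real.exp_add, ← Real.exp_neg]; ring_nf
  -- The initial frame is a standard basis scaled by s = e^{λ(p₀)} in the tangent directions. For ε
  -- = -1 the vector Y₀ is the timelike axis, and the sign of N₀ is forced by the orientation.
  obtain ⟨X₀, Y₀, N₀, had₀, hvol₀⟩ : ∃ X₀ Y₀ N₀ : L3,
      IsAdapted ε (Real.exp (-2 * lam p₀)) X₀ Y₀ N₀ ∧
        Real.exp (-2 * lam p₀) * lor (lcross X₀ Y₀) N₀ = 1 := by
    rw [hse]
    rcases hε with rfl | rfl
    · refine ⟨![s, 0, 0], ![0, s, 0], ![0, 0, 1], ⟨?_, ?_, ?_, ?_, ?_, ?_⟩, ?_⟩ <;>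
        simp [lor, lcross] <;> field_simp
    · refine ⟨![s, 0, 0], ![0, 0, s], ![0, -1, 0], ⟨?_, ?_, ?_, ?_, ?_, ?_⟩, ?_⟩ <;>
        simp [lor, lcross] <;> field_simp
  set w : ℝ × ℝ → FrameSpace := fun p => Φ p (0, X₀, Y₀, N₀) with hw
  have hws : ContDiffOn ℝ ∞ w Ω := hΦs.clm_apply contDiffOn_const
  have hw' : ∀ p ∈ Ω, HasFDerivAt w (ofPartials
      (gaussX ε (dX lam p) (dY lam p) (Real.exp (-2 * lam p)) (w p))
      (gaussY ε (dX lam p) (dY lam p) (Real.exp (-2 * lam p)) (w p))) p := by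
    intro p hp
    refine ((hΦ p hp).clm_apply (hasFDerivAt_const _ p)).congr_fderiv ?_
    ext1 <;> ext1 <;> simp [hw]
  have hw0 : w p₀ = (0, X₀, Y₀, N₀) := by simp [hw, hΦ0]
  simp only [gaussX_apply, gaussY_apply] at hw'
  have hF : IsMovingFrame ε lam (fun p => (w p).2.1) (fun p => (w p).2.2.1)
      (fun p => (w p).2.2.2) Ω := by
    refine ⟨fun p hp => ?_, fun p hp => ?_, fun p hp => ?_⟩
    · refine ((hw' p hp).snd.fst).congr_fderiv ?_
      ext <;> simp
    · refine ((hw' p hp).snd.snd.fst).congr_fderiv ?_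
      ext <;> simp
    · refine ((hw' p hp).snd.snd.snd).congr_fderiv ?_
      ext <;> simp
  refine ⟨fun p => (w p).1, hF.isLiouvilleImmersion hε hΩ hws.fst (fun p hp => ?_)
    (fun p hp => ?_) (fun p hp => ?_)⟩
  · refine ((hw' p hp).fst).congr_fderiv ?_
    ext <;> simp
  -- Adaptedness at p₀ spreads over Ω, since it is a condition on the constant frame tensor.
  · rw [isAdapted_iff hε (Real.exp_pos _).ne', hF.frameTensor_const hε hΩ hc hd hF hp hp₀,
      ← isAdapted_iff hε (Real.exp_pos _).ne']
    simpa [hw0] using had₀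
  · refine eq_inv_of_mul_eq_one_right ?_
    rw [hF.volume_const hΩ hc hd hp hp₀, hw0]
    exact hvol₀

/-! ### The adapted moving frame of a given Liouville immersion -/

namespace IsLiouvilleImmersion

variable {ε : ℝ} {lam : ℝ × ℝ → ℝ} {ψ : ℝ × ℝ → L3} {Ω : Set (ℝ × ℝ)}

theorem isAdapted (hε : ε = 1 ∨ ε = -1) (h : IsLiouvilleImmersion ε Ω lam ψ) {p : ℝ × ℝ}
    (hp : p ∈ Ω) :
    IsAdapted ε (Real.exp (-2 * lam p)) (dX ψ p) (dY ψ p) (normalN ε ψ p) := by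
  have hE := h.first_E p hp
  have hF := h.first_F p hp
  have hG := h.first_G p hp
  have he := (Real.exp_pos (2 * lam p)).ne'
  refine ⟨?_, hF, ?_, ?_, ?_, ?_⟩
  · rw [exp_neg_two_mul_inv]; exact hE
  · rw [exp_neg_two_mul_inv]; exact hG
  · rw [normalN, lor_smul_left, lor_lcross_left, mul_zero]
  · rw [normalN, lor_smul_left, lor_lcross_right, mul_zero]
  · rw [normalN, lor_smul_left, lor_smul_right, lor_lcross_lcross, hE]
    rw [coeffE] at hE
    rw [coeffF] at hF
    rw [coeffG] at hG
    rw [hE, hF, hG]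
    rcases hε with rfl | rfl <;> field_simp <;> norm_num

theorem lor_lcross_normalN (hε : ε = 1 ∨ ε = -1) (h : IsLiouvilleImmersion ε Ω lam ψ)
    {p : ℝ × ℝ} (hp : p ∈ Ω) :
    lor (lcross (dX ψ p) (dY ψ p)) (normalN ε ψ p) = (Real.exp (-2 * lam p))⁻¹ := by
  have hE := h.first_E p hp
  have hF := h.first_F p hp
  have hG := h.first_G p hp
  have he := (Real.exp_pos (2 * lam p)).ne'
  rw [normalN, lor_smul_right, lor_lcross_lcross, hE, exp_neg_two_mul_inv]
  rw [coeffE] at hE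
  rw [coeffF] at hF
  rw [coeffG] at hG
  rw [hE, hF, hG]
  rcases hε with rfl | rfl <;> field_simp <;> norm_num

theorem differentiableAt_normalN (hΩ : IsOpen Ω) (h : IsLiouvilleImmersion ε Ω lam ψ)
    {p : ℝ × ℝ} (hp : p ∈ Ω) : DifferentiableAt ℝ (normalN ε ψ) p := by
  have hn := hΩ.mem_nhds hp
  have hX := ((contDiffOn_dX hΩ h.smooth).contDiffAt hn).differentiableAt (by simp)
  have hY := ((contDiffOn_dY hΩ h.smooth).contDiffAt hn).differentiableAt (by simp)
  have hX' := fun i => (hasFDerivAt_apply (hasFDerivAt_ofPartials hX) i).differentiableAt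
  have hY' := fun i => (hasFDerivAt_apply (hasFDerivAt_ofPartials hY) i).differentiableAt
  have hE : DifferentiableAt ℝ (coeffE ψ) p :=
    (hasFDerivAt_lor (hasFDerivAt_ofPartials hX) (hasFDerivAt_ofPartials hX)).differentiableAt
  have hE0 : coeffE ψ p ≠ 0 := by rw [h.first_E p hp]; exact (Real.exp_pos _).ne'
  have hc : DifferentiableAt ℝ (fun q => -ε / coeffE ψ q) p := by
    simpa only [div_eq_mul_inv] using (hE.fun_inv hE0).const_mul (-ε)
  refine hc.smul ?_
  rw [differentiableAt_pi]
  intro i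
  fin_cases i
  · exact ((hX' 1).mul (hY' 2)).sub ((hX' 2).mul (hY' 1))
  · exact ((hX' 2).mul (hY' 0)).sub ((hX' 0).mul (hY' 2))
  · exact ((hX' 1).mul (hY' 0)).sub ((hX' 0).mul (hY' 1))

theorem hasFDerivAt_self (hΩ : IsOpen Ω) (h : IsLiouvilleImmersion ε Ω lam ψ) {p : ℝ × ℝ}
    (hp : p ∈ Ω) : HasFDerivAt ψ (ofPartials (dX ψ p) (dY ψ p)) p :=
  hasFDerivAt_ofPartials
    ((h.smooth.contDiffAt (hΩ.mem_nhds hp)).differentiableAt (by simp))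

/-- The derivatives and the normal of a Liouville immersion form a moving frame. -/
theorem isMovingFrame (hε : ε = 1 ∨ ε = -1) (hΩ : IsOpen Ω)
    (hlam : ∀ p ∈ Ω, DifferentiableAt ℝ lam p) (h : IsLiouvilleImmersion ε Ω lam ψ) :
    IsMovingFrame ε lam (dX ψ) (dY ψ) (normalN ε ψ) Ω := by
  have hε2 : ε * ε = 1 := by rcases hε with rfl | rfl <;> norm_num
  have key : ∀ p ∈ Ω,
      (dX (dX ψ) p = dX lam p • dX ψ p - (ε * dY lam p) • dY ψ p - ε • normalN ε ψ p ∧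
      dY (dX ψ) p = dY lam p • dX ψ p + dX lam p • dY ψ p) ∧
      dY (dY ψ) p = -(ε * dX lam p) • dX ψ p + dY lam p • dY ψ p + normalN ε ψ p ∧
      dX (normalN ε ψ) p = -Real.exp (-2 * lam p) • dX ψ p ∧
      dY (normalN ε ψ) p = Real.exp (-2 * lam p) • dY ψ p := by
    intro p hp
    have hn := hΩ.mem_nhds hp
    have hX := hasFDerivAt_ofPartials
      (((contDiffOn_dX hΩ h.smooth).contDiffAt hn).differentiableAt (by simp))
    have hY := hasFDerivAt_ofPartials
      (((contDiffOn_dY hΩ h.smooth).contDiffAt hn).differentiableAt (by simp))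
    have hN := hasFDerivAt_ofPartials (h.differentiableAt_normalN hΩ hp)
    have he := hasFDerivAt_exp_mul 2 (hasFDerivAt_ofPartials (hlam p hp))
    have hc := dX_dY_comm hΩ h.smooth hp
    have hc0 : HasFDerivAt (fun _ : ℝ × ℝ => (0 : ℝ)) (ofPartials 0 0) p :=
      (hasFDerivAt_const _ _).congr_fderiv (by ext <;> simp)
    have hcε : HasFDerivAt (fun _ : ℝ × ℝ => -ε) (ofPartials 0 0) p :=
      (hasFDerivAt_const _ _).congr_fderiv (by ext <;> simp)
    have hadp := h.isAdapted hε hp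
    -- Differentiating the six inner products of ψ_x, ψ_y, N and inserting l, m, n determines the
    -- inner products of all second derivatives, and of N_x and N_y, with the frame. The expansion
    -- in the adapted frame then recovers the vectors.
    have hEE := partials_eq_of_eqOn hΩ (fun q hq => h.first_E q hq) hp (hasFDerivAt_lor hX hX) he
    have hFF := partials_eq_of_eqOn hΩ (fun q hq => h.first_F q hq) hp (hasFDerivAt_lor hX hY) hc0
    have hGG := partials_eq_of_eqOn hΩ (fun q hq => h.first_G q hq) hp (hasFDerivAt_lor hY hY)
      (hasFDerivAt_const_mul ε he)
    have hNX := partials_eq_of_eqOn hΩ (fun q hq => (h.isAdapted hε hq).NX) hp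
      (hasFDerivAt_lor hN hX) hc0
    have hNY := partials_eq_of_eqOn hΩ (fun q hq => (h.isAdapted hε hq).NY) hp
      (hasFDerivAt_lor hN hY) hc0
    have hNN := partials_eq_of_eqOn hΩ (fun q hq => (h.isAdapted hε hq).NN) hp
      (hasFDerivAt_lor hN hN) hcε
    have hl : lor (dX (dX ψ) p) (normalN ε ψ p) = 1 := h.second_l p hp
    have hm : lor (dX (dY ψ) p) (normalN ε ψ p) = 0 := h.second_m p hp
    have hnn : lor (dY (dY ψ) p) (normalN ε ψ p) = -ε := h.second_n p hp
    have hexp := hadp.expansion hε (Real.exp_pos _).ne'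
    have hee : Real.exp (-2 * lam p) * Real.exp (2 * lam p) = 1 := by
      rw [← Real.exp_add]; simp
    rw [hc] at hFF hGG hm hNY
    have c1 := lor_comm (dX ψ p)
    have c2 := lor_comm (dY ψ p)
    have c3 := lor_comm (normalN ε ψ p)
    simp only [c1, c2, c3] at hEE hFF hGG hNX hNY hNN
    have sXX : lor (dX (dX ψ) p) (dX ψ p) = dX lam p * Real.exp (2 * lam p) := by
      linarith [hEE.1]
    have sXyX : lor (dY (dX ψ) p) (dX ψ p) = dY lam p * Real.exp (2 * lam p) := by
      linarith [hEE.2]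
    have sXyY : lor (dY (dX ψ) p) (dY ψ p) = ε * (dX lam p * Real.exp (2 * lam p)) := by
      linarith [hGG.1]
    have sYY : lor (dY (dY ψ) p) (dY ψ p) = ε * (dY lam p * Real.exp (2 * lam p)) := by
      linarith [hGG.2]
    have sXxY : lor (dX (dX ψ) p) (dY ψ p) = -(dY lam p * Real.exp (2 * lam p)) := by
      linarith [hFF.1]
    have sYyX : lor (dY (dY ψ) p) (dX ψ p) = -(ε * (dX lam p * Real.exp (2 * lam p))) := by
      linarith [hFF.2]
    have sNxX : lor (dX (normalN ε ψ) p) (dX ψ p) = -1 := by linarith [hNX.1]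
    have sNyX : lor (dY (normalN ε ψ) p) (dX ψ p) = 0 := by linarith [hNX.2]
    have sNxY : lor (dX (normalN ε ψ) p) (dY ψ p) = 0 := by linarith [hNY.1]
    have sNyY : lor (dY (normalN ε ψ) p) (dY ψ p) = ε := by linarith [hNY.2]
    have sNxN : lor (dX (normalN ε ψ) p) (normalN ε ψ p) = 0 := by linarith [hNN.1]
    have sNyN : lor (dY (normalN ε ψ) p) (normalN ε ψ p) = 0 := by linarith [hNN.2]
    refine ⟨⟨?_, ?_⟩, ?_, ?_, ?_⟩
    · rw [hexp (dX (dX ψ) p), sXX, sXxY, hl]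
      match_scalars
      · linear_combination (dX lam p) * hee
      · linear_combination (-ε * dY lam p) * hee
      · ring
    · rw [hexp (dY (dX ψ) p), sXyX, sXyY, hm]
      match_scalars
      · linear_combination (dY lam p) * hee
      · linear_combination (ε * ε * dX lam p) * hee + dX lam p * hε2
      · ring
    · rw [hexp (dY (dY ψ) p), sYyX, sYY, hnn]
      match_scalars
      · linear_combination (-ε * dX lam p) * hee
      · linear_combination (ε * ε * dY lam p) * hee + dY lam p * hε2
      · linear_combination hε2
    · rw [hexp (dX (normalN ε ψ) p), sNxX, sNxY, sNxN]
      module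
    · rw [hexp (dY (normalN ε ψ) p), sNyX, sNyY, sNyN]
      match_scalars
      · ring
      · linear_combination Real.exp (-2 * lam p) * hε2
      · ring
  refine ⟨fun p hp => ?_, fun p hp => ?_, fun p hp => ?_⟩
  · rw [← (key p hp).1.1, ← (key p hp).1.2]
    exact hasFDerivAt_ofPartials
      (((contDiffOn_dX hΩ h.smooth).contDiffAt (hΩ.mem_nhds hp)).differentiableAt (by simp))
  · rw [← (key p hp).1.2, ← (key p hp).2.1, ← dX_dY_comm hΩ h.smooth hp]
    exact hasFDerivAt_ofPartials
      (((contDiffOn_dY hΩ h.smooth).contDiffAt (hΩ.mem_nhds hp)).differentiableAt (by simp))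
  · rw [← (key p hp).2.2.1, ← (key p hp).2.2.2]
    exact hasFDerivAt_ofPartials (h.differentiableAt_normalN hΩ hp)

end IsLiouvilleImmersion

/-! ### Rigid motions -/

theorem lor_lcross_eq_det (u v w : L3) : lor (lcross u v) w = (Matrix.of ![u, v, w]).det := by
  simp [lor, lcross, Matrix.det_fin_three]; ring

theorem ext_lor {u v : L3} (h : ∀ w, lor u w = lor v w) : u = v := by
  ext i
  have h0 := h ![1, 0, 0]
  have h1 := h ![0, 1, 0]
  have h2 := h ![0, 0, 1]
  simp [lor] at h0 h1 h2
  fin_cases i <;> assumption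

theorem lor_lcross_map (A : L3 →ₗ[ℝ] L3) (u v w : L3) :
    lor (lcross (A u) (A v)) (A w) = LinearMap.det A * lor (lcross u v) w := by
  rw [lor_lcross_eq_det, lor_lcross_eq_det, ← LinearMap.det_toMatrix', ← Matrix.det_transpose,
    ← Matrix.det_transpose (Matrix.of ![u, v, w]), ← Matrix.det_mul]
  congr 1
  have hA : ∀ u i, A u i = ∑ j, LinearMap.toMatrix' A i j * u j := fun u i =>
    (congrFun (LinearMap.toMatrix'_mulVec A u) i).symm
  ext i j
  fin_cases j
  · exact hA u i
  · exact hA v i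
  · exact hA w i

/-- Both sides are tested against vectors A w, which exhaust the space because an isometry of a
nondegenerate form is injective. The claim becomes multiplicativity of the determinant together with
det A = 1. -/
theorem lcross_map {A : L3 →ₗ[ℝ] L3} (hA : ∀ u v, lor (A u) (A v) = lor u v)
    (hdet : LinearMap.det A = 1) (u v : L3) : lcross (A u) (A v) = A (lcross u v) := by
  have hsurj : Function.Surjective A := by
    refine LinearMap.injective_iff_surjective.1 ?_
    rw [injective_iff_map_eq_zero]
    intro u hu
    refine ext_lor fun w => ?_
    rw [← hA, hu]
    simp [lor]
  refine ext_lor fun w => ?_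
  obtain ⟨w, rfl⟩ := hsurj w
  rw [lor_lcross_map, hdet, one_mul, hA]

/-- Rigid motions map Liouville immersions to Liouville immersions. -/
theorem IsLiouvilleImmersion.rigidMotion {ε : ℝ} {lam : ℝ × ℝ → ℝ}
    {ψ ψ' : ℝ × ℝ → L3} {Ω : Set (ℝ × ℝ)} (hΩ : IsOpen Ω) (h : IsLiouvilleImmersion ε Ω lam ψ)
    {Φ : L3 → L3} (hΦ : IsRigidMotion Φ) (hψ' : ∀ p ∈ Ω, ψ' p = Φ (ψ p)) :
    IsLiouvilleImmersion ε Ω lam ψ' := by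
  obtain ⟨A, b, hA, hdet, hΦ⟩ := hΦ
  set T := A.toContinuousLinearMap with hT
  have hTA : ∀ u, T u = A u := fun u => rfl
  have hψT : ∀ p ∈ Ω, ψ' p = T (ψ p) + b := fun p hp => by rw [hψ' p hp, hΦ, hTA]
  have hmap : ∀ {f g : ℝ × ℝ → L3} (c : L3), ContDiffOn ℝ ∞ f Ω → (∀ p ∈ Ω, g p = T (f p) + c) →
      ∀ p ∈ Ω, fderiv ℝ g p = T ∘L fderiv ℝ f p := by
    intro f g c hf hg p hp
    rw [Filter.EventuallyEq.fderiv_eq (eventuallyEq_of_mem (hΩ.mem_nhds hp) hg)]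
    have hd := (hf.contDiffAt (hΩ.mem_nhds hp)).differentiableAt (by simp)
    exact ((T.hasFDerivAt.comp p hd.hasFDerivAt).add_const c).fderiv
  have hf := hmap b h.smooth hψT
  have hX : ∀ p ∈ Ω, dX ψ' p = T (dX ψ p) := fun p hp => by rw [dX, hf p hp]; rfl
  have hY : ∀ p ∈ Ω, dY ψ' p = T (dY ψ p) := fun p hp => by rw [dY, hf p hp]; rfl
  have hX' := hmap (f := dX ψ) (g := dX ψ') 0 (contDiffOn_dX hΩ h.smooth)
    (fun p hp => by rw [hX p hp, add_zero])
  have hY' := hmap (f := dY ψ) (g := dY ψ') 0 (contDiffOn_dY hΩ h.smooth)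
    (fun p hp => by rw [hY p hp, add_zero])
  have hE : ∀ p ∈ Ω, coeffE ψ' p = coeffE ψ p := fun p hp => by
    rw [coeffE, hX p hp, hTA, hA, coeffE]
  have hN : ∀ p ∈ Ω, normalN ε ψ' p = T (normalN ε ψ p) := fun p hp => by
    rw [normalN, hE p hp, hX p hp, hY p hp, hTA, hTA, lcross_map hA hdet, normalN, map_smul, hTA]
  have hinj : Function.Injective T := by
    rw [injective_iff_map_eq_zero]
    intro u hu
    refine ext_lor fun w => ?_
    rw [← hA, ← hTA, hu]
    simp [lor]
  refine ⟨?_, fun p hp => ?_, fun p hp => ?_, fun p hp => ?_, fun p hp => ?_, fun p hp => ?_,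
    fun p hp => ?_, fun p hp => ?_⟩
  · exact ((T.contDiff.comp_contDiffOn h.smooth).add contDiffOn_const).congr hψT
  · rw [IsImmersionAt, hf p hp]
    exact hinj.comp (h.immersion p hp)
  · rw [hE p hp, h.first_E p hp]
  · rw [coeffF, hX p hp, hY p hp, hTA, hTA, hA]
    exact h.first_F p hp
  · rw [coeffG, hY p hp, hTA, hA]
    exact h.first_G p hp
  · rw [coeffl, hN p hp, dX, hX' p hp, ContinuousLinearMap.comp_apply, hTA, hTA, hA]
    exact h.second_l p hp
  · rw [coeffm, hN p hp, dX, hY' p hp, ContinuousLinearMap.comp_apply, hTA, hTA, hA]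
    exact h.second_m p hp
  · rw [coeffn, hN p hp, dY, hY' p hp, ContinuousLinearMap.comp_apply, hTA, hTA, hA]
    exact h.second_n p hp

theorem det_colMatrix (X Y N : L3) : (colMatrix X Y N).det = lor (lcross X Y) N := by
  simp [colMatrix, lor, lcross, Matrix.det_fin_three]; ring

/-- Together with the metric, the tensor acts as the operator which, for an adapted frame X', Y',
N', sends it to X, Y, N. -/
theorem frameTensor_mulVec (ε e : ℝ) (X Y N X' Y' N' u : L3) :
    (frameTensor ε e X Y N X' Y' N' * lorMatrix).mulVec u =
      (e * lor u X') • X + (ε * e * lor u Y') • Y - (ε * lor u N') • N := by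
  ext i
  simp [frameTensor, lorMatrix, Matrix.mulVec, dotProduct, Fin.sum_univ_three, Matrix.mul_apply,
    Matrix.diagonal, lor]
  ring

/-- The linear map that takes one adapted frame to another is pseudo-orthogonal. -/
theorem lor_frameTensor_mulVec {ε e : ℝ} (hε : ε = 1 ∨ ε = -1) (he : e ≠ 0)
    {X Y N X' Y' N' : L3} (h : IsAdapted ε e X Y N) (h' : IsAdapted ε e X' Y' N') (u v : L3) :
    lor ((frameTensor ε e X' Y' N' X Y N * lorMatrix).mulVec u)
      ((frameTensor ε e X' Y' N' X Y N * lorMatrix).mulVec v) = lor u v := by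
  have hu := h.expansion hε he u
  have key : lor u v = e * lor u X * lor v X + ε * e * lor u Y * lor v Y
      - ε * lor u N * lor v N := by
    conv_lhs => rw [hu]
    rw [lor_sub_left, lor_add_left, lor_smul_left, lor_smul_left, lor_smul_left, lor_comm X,
      lor_comm Y, lor_comm N]
  rw [frameTensor_mulVec, frameTensor_mulVec, key]
  have bil : ∀ a b c a' b' c' : ℝ, lor (a • X' + b • Y' - c • N') (a' • X' + b' • Y' - c' • N') =
      a * a' * lor X' X' + b * b' * lor Y' Y' + c * c' * lor N' N' + (a * b' + b * a') * lor X' Y'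
        - (a * c' + c * a') * lor N' X' - (b * c' + c * b') * lor N' Y' := by
    intros
    simp only [lor, Pi.add_apply, Pi.sub_apply, Pi.smul_apply, smul_eq_mul]
    ring
  rw [bil, h'.XX, h'.XY, h'.YY, h'.NX, h'.NY, h'.NN]
  rcases hε with rfl | rfl <;> field_simp <;> ring

/-- Two Liouville immersions with the same conformal factor differ by a rigid motion. -/
theorem IsLiouvilleImmersion.exists_rigidMotion {ε : ℝ} (hε : ε = 1 ∨ ε = -1)
    {lam : ℝ × ℝ → ℝ} {ψ ψ' : ℝ × ℝ → L3} {Ω : Set (ℝ × ℝ)} (hΩ : IsOpen Ω)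
    (hc : IsPreconnected Ω) (hne : Ω.Nonempty) (hlam : ∀ p ∈ Ω, DifferentiableAt ℝ lam p)
    (h : IsLiouvilleImmersion ε Ω lam ψ) (h' : IsLiouvilleImmersion ε Ω lam ψ') :
    ∃ Φ : L3 → L3, IsRigidMotion Φ ∧ ∀ p ∈ Ω, ψ' p = Φ (ψ p) := by
  obtain ⟨p₀, hp₀⟩ := hne
  -- A carries the frame of ψ at p₀ to that of ψ'. As the tensor is constant, it does so at every
  -- point of Ω, and hence ψ' - Aψ has zero derivative.
  set A : Matrix (Fin 3) (Fin 3) ℝ := frameTensor ε (Real.exp (-2 * lam p₀)) (dX ψ' p₀)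
    (dY ψ' p₀) (normalN ε ψ' p₀) (dX ψ p₀) (dY ψ p₀) (normalN ε ψ p₀) * lorMatrix with hA
  have hF := h.isMovingFrame hε hΩ hlam
  have hF' := h'.isMovingFrame hε hΩ hlam
  have hA' : ∀ p ∈ Ω, A = frameTensor ε (Real.exp (-2 * lam p)) (dX ψ' p)
      (dY ψ' p) (normalN ε ψ' p) (dX ψ p) (dY ψ p) (normalN ε ψ p) * lorMatrix := fun p hp => by
    rw [hA, hF'.frameTensor_const hε hΩ hc hlam hF hp₀ hp]
  have hAX : ∀ p ∈ Ω, A.mulVec (dX ψ p) = dX ψ' p := fun p hp => by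
    have had := h.isAdapted hε hp
    rw [hA' p hp, frameTensor_mulVec, had.XX, had.XY, lor_comm _ (normalN ε ψ p), had.NX]
    simp
  have hAY : ∀ p ∈ Ω, A.mulVec (dY ψ p) = dY ψ' p := fun p hp => by
    have had := h.isAdapted hε hp
    rw [hA' p hp, frameTensor_mulVec, had.YY, lor_comm _ (dX ψ p), had.XY,
      lor_comm _ (normalN ε ψ p), had.NY]
    rcases hε with rfl | rfl <;> simp
  -- Both frame volumes equal e^{2λ}, with the same sign because both normals follow the same
  -- orientation rule; the two diagonal factors cancel them.
  have hdet : A.det = 1 := by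
    have e0 := (Real.exp_pos (-2 * lam p₀)).ne'
    rw [hA, frameTensor_eq, Matrix.det_mul, Matrix.det_mul, Matrix.det_mul, Matrix.det_transpose,
      det_colMatrix, det_colMatrix, h.lor_lcross_normalN hε hp₀, h'.lor_lcross_normalN hε hp₀,
      lorMatrix, Matrix.det_diagonal, Matrix.det_diagonal]
    simp only [Fin.prod_univ_three]
    rcases hε with rfl | rfl <;> simp
  have hconst : ∀ p ∈ Ω, ψ' p - A.mulVec (ψ p) = ψ' p₀ - A.mulVec (ψ p₀) := by
    intro p hp
    refine eq_of_hasFDerivAt_zero (f := fun p => ψ' p - A.mulVec (ψ p)) hΩ hc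
      (fun p hp => ?_) hp hp₀
    have h1 : HasFDerivAt (fun p => A.mulVec (ψ p)) _ p :=
      (A.mulVecLin.toContinuousLinearMap.hasFDerivAt).comp p (h.hasFDerivAt_self hΩ hp)
    refine ((h'.hasFDerivAt_self hΩ hp).sub h1).congr_fderiv ?_
    ext1
    · ext1
      simp [hAX p hp]
    · ext1
      simp [hAY p hp]
  refine ⟨fun u => A.mulVecLin u + (ψ' p₀ - A.mulVec (ψ p₀)), ⟨A.mulVecLin, _, fun u v => ?_, ?_,
    fun u => rfl⟩, fun p hp => ?_⟩
  · exact lor_frameTensor_mulVec hε (Real.exp_pos _).ne' (h.isAdapted hε hp₀)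
      (h'.isAdapted hε hp₀) u v
  · rw [← Matrix.toLin'_apply', LinearMap.det_toLin', hdet]
  · rw [← hconst p hp]
    simp

/-! ### Curvatures -/

theorem IsAdapted.smul_add_smul_eq_zero {ε e : ℝ} (hε : ε = 1 ∨ ε = -1) (he : e ≠ 0) {X Y N : L3}
    (h : IsAdapted ε e X Y N) {a b : ℝ} (hab : a • X + b • Y = 0) : a = 0 ∧ b = 0 := by
  have hε0 : ε ≠ 0 := by rcases hε with rfl | rfl <;> norm_num
  have h1 : lor (a • X + b • Y) X = 0 := by rw [hab]; simp [lor]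
  have h2 : lor (a • X + b • Y) Y = 0 := by rw [hab]; simp [lor]
  rw [lor_add_left, lor_smul_left, lor_smul_left, h.XX, lor_comm Y, h.XY] at h1
  rw [lor_add_left, lor_smul_left, lor_smul_left, h.XY, h.YY] at h2
  exact ⟨by simpa [he] using h1, by simpa [he, hε0] using h2⟩

namespace IsLiouvilleImmersion

variable {ε : ℝ} {lam : ℝ × ℝ → ℝ} {ψ : ℝ × ℝ → L3} {Ω : Set (ℝ × ℝ)} {p : ℝ × ℝ}

theorem lor_fderiv (h : IsLiouvilleImmersion ε Ω lam ψ) (hp : p ∈ Ω) (v : ℝ × ℝ) :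
    lor (fderiv ℝ ψ p v) (fderiv ℝ ψ p v) = Real.exp (2 * lam p) * (v.1 ^ 2 + ε * v.2 ^ 2) := by
  have hE := h.first_E p hp
  have hF := h.first_F p hp
  have hG := h.first_G p hp
  rw [coeffE] at hE
  rw [coeffF] at hF
  rw [coeffG] at hG
  have bil : lor (v.1 • dX ψ p + v.2 • dY ψ p) (v.1 • dX ψ p + v.2 • dY ψ p) =
      v.1 ^ 2 * lor (dX ψ p) (dX ψ p) + 2 * v.1 * v.2 * lor (dX ψ p) (dY ψ p) +
        v.2 ^ 2 * lor (dY ψ p) (dY ψ p) := by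
    simp only [lor, Pi.add_apply, Pi.smul_apply, smul_eq_mul]
    ring
  rw [fderiv_eq_ofPartials, ofPartials_apply, bil, hE, hF, hG]
  ring

theorem isSpacelikeAt {lam : ℝ × ℝ → ℝ} (h : IsLiouvilleImmersion 1 Ω lam ψ) (hp : p ∈ Ω) :
    IsSpacelikeAt ψ p := by
  intro v hv
  rw [h.lor_fderiv hp]
  have : 0 < v.1 ^ 2 + 1 * v.2 ^ 2 := by
    by_contra hcon
    have h1 := sq_nonneg v.1
    have h2 := sq_nonneg v.2
    exact hv (Prod.ext (pow_eq_zero_iff two_ne_zero |>.1 (by linarith))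
      (pow_eq_zero_iff two_ne_zero |>.1 (by linarith)))
  exact mul_pos (Real.exp_pos _) this

theorem isTimelikeAt {lam : ℝ × ℝ → ℝ} (h : IsLiouvilleImmersion (-1) Ω lam ψ) (hp : p ∈ Ω) :
    IsTimelikeAt ψ p :=
  ⟨⟨(1, 0), by rw [h.lor_fderiv hp]; simpa using Real.exp_pos _⟩,
    ⟨(0, 1), by rw [h.lor_fderiv hp]; simpa using Real.exp_pos _⟩⟩

theorem meanCurvature_eq_zero (h : IsLiouvilleImmersion ε Ω lam ψ) (hp : p ∈ Ω) :
    meanCurvature ε ψ p = 0 := by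
  rw [meanCurvature, h.first_E p hp, h.first_F p hp, h.first_G p hp, h.second_l p hp,
    h.second_m p hp, h.second_n p hp]
  ring

theorem gaussCurvature_eq (hε : ε = 1 ∨ ε = -1) (h : IsLiouvilleImmersion ε Ω lam ψ)
    (hp : p ∈ Ω) :
    gaussCurvature ε ψ p = ε * (Real.exp (-2 * lam p) * Real.exp (-2 * lam p)) := by
  have hinv := exp_neg_two_mul_inv (lam p)
  have h0 := (Real.exp_pos (-2 * lam p)).ne'
  rw [gaussCurvature, h.first_E p hp, h.first_F p hp, h.first_G p hp, h.second_l p hp,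
    h.second_m p hp, h.second_n p hp, ← hinv]
  rcases hε with rfl | rfl <;> field_simp <;> norm_num

theorem fderiv_normalN (hε : ε = 1 ∨ ε = -1) (hΩ : IsOpen Ω)
    (hlam : ∀ p ∈ Ω, DifferentiableAt ℝ lam p) (h : IsLiouvilleImmersion ε Ω lam ψ)
    (hp : p ∈ Ω) (v : ℝ × ℝ) :
    -fderiv ℝ (normalN ε ψ) p v =
      (v.1 * Real.exp (-2 * lam p)) • dX ψ p + (-(v.2 * Real.exp (-2 * lam p))) • dY ψ p := by
  rw [((h.isMovingFrame hε hΩ hlam).hasFDerivAt_N p hp).fderiv, ofPartials_apply]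
  module

/-- In the basis ψ_x, ψ_y the Weingarten map is diagonal with entries ±e^{-2λ}. By independence of
this basis, the statements on principal curvatures and umbilics reduce to these two scalar
equations. -/
theorem principal_iff (hε : ε = 1 ∨ ε = -1) (hΩ : IsOpen Ω)
    (hlam : ∀ p ∈ Ω, DifferentiableAt ℝ lam p) (h : IsLiouvilleImmersion ε Ω lam ψ)
    (hp : p ∈ Ω) (k : ℝ) (v : ℝ × ℝ) :
    -fderiv ℝ (normalN ε ψ) p v = k • fderiv ℝ ψ p v ↔
      v.1 * (Real.exp (-2 * lam p) - k) = 0 ∧ v.2 * (-Real.exp (-2 * lam p) - k) = 0 := by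
  rw [h.fderiv_normalN hε hΩ hlam hp, fderiv_eq_ofPartials ψ, ofPartials_apply, ← sub_eq_zero]
  have e1 : (v.1 * Real.exp (-2 * lam p)) • dX ψ p + (-(v.2 * Real.exp (-2 * lam p))) • dY ψ p -
      k • (v.1 • dX ψ p + v.2 • dY ψ p) = (v.1 * (Real.exp (-2 * lam p) - k)) • dX ψ p +
      (v.2 * (-Real.exp (-2 * lam p) - k)) • dY ψ p := by module
  rw [e1]
  constructor
  · exact (h.isAdapted hε hp).smul_add_smul_eq_zero hε (Real.exp_pos _).ne'
  · rintro ⟨h1, h2⟩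
    rw [h1, h2]; simp

theorem isPrincipal_x (hε : ε = 1 ∨ ε = -1) (hΩ : IsOpen Ω)
    (hlam : ∀ p ∈ Ω, DifferentiableAt ℝ lam p) (h : IsLiouvilleImmersion ε Ω lam ψ)
    (hp : p ∈ Ω) : IsPrincipal ε ψ p (Real.exp (-2 * lam p)) (1, 0) :=
  ⟨by simp, (h.principal_iff hε hΩ hlam hp _ _).2 (by simp)⟩

theorem isPrincipal_y (hε : ε = 1 ∨ ε = -1) (hΩ : IsOpen Ω)
    (hlam : ∀ p ∈ Ω, DifferentiableAt ℝ lam p) (h : IsLiouvilleImmersion ε Ω lam ψ)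
    (hp : p ∈ Ω) : IsPrincipal ε ψ p (-Real.exp (-2 * lam p)) (0, 1) :=
  ⟨by simp, (h.principal_iff hε hΩ hlam hp _ _).2 (by simp)⟩

theorem isPrincipalCurvature_iff (hε : ε = 1 ∨ ε = -1) (hΩ : IsOpen Ω)
    (hlam : ∀ p ∈ Ω, DifferentiableAt ℝ lam p) (h : IsLiouvilleImmersion ε Ω lam ψ)
    (hp : p ∈ Ω) (k : ℝ) : IsPrincipalCurvature ε ψ p k ↔
      k = Real.exp (-2 * lam p) ∨ k = -Real.exp (-2 * lam p) := by
  constructor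
  · rintro ⟨v, hv, hk⟩
    obtain ⟨h1, h2⟩ := (h.principal_iff hε hΩ hlam hp _ _).1 hk
    rcases mul_eq_zero.1 h1 with h1 | h1
    · rcases mul_eq_zero.1 h2 with h2 | h2
      · exact absurd (Prod.ext h1 h2) hv
      · right; linarith
    · left; linarith
  · rintro (rfl | rfl)
    · exact ⟨_, h.isPrincipal_x hε hΩ hlam hp⟩
    · exact ⟨_, h.isPrincipal_y hε hΩ hlam hp⟩

theorem not_isUmbilic (hε : ε = 1 ∨ ε = -1) (hΩ : IsOpen Ω)
    (hlam : ∀ p ∈ Ω, DifferentiableAt ℝ lam p) (h : IsLiouvilleImmersion ε Ω lam ψ)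
    (hp : p ∈ Ω) : ¬ IsUmbilic ε ψ p := by
  rintro ⟨k, hk⟩
  have h1 := ((h.principal_iff hε hΩ hlam hp _ _).1 (hk (1, 0))).1
  have h2 := ((h.principal_iff hε hΩ hlam hp _ _).1 (hk (0, 1))).2
  have h3 := Real.exp_pos (-2 * lam p)
  simp only [one_mul] at h1 h2
  linarith

theorem isWeingartenDiagonalizable (hε : ε = 1 ∨ ε = -1) (hΩ : IsOpen Ω)
    (hlam : ∀ p ∈ Ω, DifferentiableAt ℝ lam p) (h : IsLiouvilleImmersion ε Ω lam ψ)
    (hp : p ∈ Ω) : IsWeingartenDiagonalizable ε ψ p := by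
  refine ⟨(1, 0), (0, 1), ?_, ⟨_, h.isPrincipal_x hε hΩ hlam hp⟩,
    ⟨_, h.isPrincipal_y hε hΩ hlam hp⟩⟩
  rw [LinearIndependent.pair_iff]
  intro s t hst
  simpa using hst

end IsLiouvilleImmersion

/-! ### Calculus of `𝕂`-holomorphic functions -/

section KCalculus

variable {ε : ℝ}

@[simp] theorem unitI_re : (unitI ε).re = 0 := rfl

@[simp] theorem unitI_im : (unitI ε).im = 1 := rfl

/-- `f` has the derivative `f'` with respect to `z` at `p`, that is, `f_x = f'` and
`f_y = ω f'`. -/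
structure HasKDeriv (f : ℝ × ℝ → KNum ε) (f' : KNum ε) (p : ℝ × ℝ) : Prop where
  re : HasFDerivAt (fun q => (f q).re) (ofPartials f'.re (-ε * f'.im)) p
  im : HasFDerivAt (fun q => (f q).im) (ofPartials f'.im f'.re) p

theorem dzbar_eq_zero (hε : ε = 1 ∨ ε = -1) {f : ℝ × ℝ → KNum ε} {f' : KNum ε} {p : ℝ × ℝ}
    (h : HasKDeriv f f' p) : dzbar f p = 0 := by
  rw [dzbar, kdX, kdY, dX_eq_of_hasFDerivAt h.re, dX_eq_of_hasFDerivAt h.im,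
    dY_eq_of_hasFDerivAt h.re, dY_eq_of_hasFDerivAt h.im]
  rcases hε with rfl | rfl <;> ext <;> simp

theorem dz_eq (hε : ε = 1 ∨ ε = -1) {f : ℝ × ℝ → KNum ε} {f' : KNum ε} {p : ℝ × ℝ}
    (h : HasKDeriv f f' p) : dz f p = f' := by
  rw [dz, kdX, kdY, dX_eq_of_hasFDerivAt h.re, dX_eq_of_hasFDerivAt h.im,
    dY_eq_of_hasFDerivAt h.re, dY_eq_of_hasFDerivAt h.im]
  rcases hε with rfl | rfl <;> ext <;> simp <;> ring

namespace HasKDeriv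

variable {f g : ℝ × ℝ → KNum ε} {f' g' : KNum ε} {p : ℝ × ℝ}

theorem congr_deriv {d : KNum ε} (hf : HasKDeriv f f' p) (h : f' = d) : HasKDeriv f d p := h ▸ hf

theorem add (hf : HasKDeriv f f' p) (hg : HasKDeriv g g' p) :
    HasKDeriv (fun q => f q + g q) (f' + g') p := by
  refine ⟨(hasFDerivAt_add hf.re hg.re).congr_fderiv ?_,
    (hasFDerivAt_add hf.im hg.im).congr_fderiv ?_⟩ <;> congr 1 <;> simp <;> ring

theorem const_mul (k : KNum ε) (hf : HasKDeriv f f' p) :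
    HasKDeriv (fun q => k * f q) (k * f') p := by
  constructor
  · simp only [QuadraticAlgebra.re_mul]
    refine (hasFDerivAt_add (hasFDerivAt_const_mul k.re hf.re)
      (hasFDerivAt_const_mul (-ε * k.im) hf.im)).congr_fderiv ?_
    congr 1
    simp; ring
  · simp only [QuadraticAlgebra.im_mul, zero_mul, add_zero]
    refine (hasFDerivAt_add (hasFDerivAt_const_mul k.re hf.im)
      (hasFDerivAt_const_mul k.im hf.re)).congr_fderiv ?_
    congr 1 <;> simp <;> ring

theorem mul (hf : HasKDeriv f f' p) (hg : HasKDeriv g g' p) :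
    HasKDeriv (fun q => f q * g q) (f' * g p + f p * g') p := by
  constructor
  · simp only [QuadraticAlgebra.re_mul, mul_assoc]
    refine (hasFDerivAt_add (hasFDerivAt_mul hf.re hg.re)
      (hasFDerivAt_const_mul (-ε) (hasFDerivAt_mul hf.im hg.im))).congr_fderiv ?_
    congr 1 <;> simp <;> ring
  · simp only [QuadraticAlgebra.im_mul, zero_mul, add_zero]
    refine (hasFDerivAt_add (hasFDerivAt_mul hf.re hg.im)
      (hasFDerivAt_mul hf.im hg.re)).congr_fderiv ?_
    congr 1 <;> simp <;> ring

theorem inv (hf : HasKDeriv f f' p) (h0 : (f p).norm ≠ 0) :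
    HasKDeriv (fun q => (f q)⁻¹) (-(f' * ((f p)⁻¹ * (f p)⁻¹))) p := by
  have hn : HasFDerivAt (fun q => (f q).norm) (ofPartials
      (2 * ((f p).re * f'.re + ε * (f p).im * f'.im))
      (2 * ε * ((f p).im * f'.re - (f p).re * f'.im))) p := by
    simp only [QuadraticAlgebra.norm_def, zero_mul, add_zero, mul_assoc]
    refine (hasFDerivAt_sub (hasFDerivAt_mul hf.re hf.re)
      (hasFDerivAt_const_mul (-ε) (hasFDerivAt_mul hf.im hf.im))).congr_fderiv ?_
    congr 1 <;> ring
  have hi : HasFDerivAt (fun q => (f q).norm⁻¹) (ofPartials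
      (-((f p).norm⁻¹ * (f p).norm⁻¹) * (2 * ((f p).re * f'.re + ε * (f p).im * f'.im)))
      (-((f p).norm⁻¹ * (f p).norm⁻¹) * (2 * ε * ((f p).im * f'.re - (f p).re * f'.im)))) p := by
    refine ((hasDerivAt_inv h0).comp_hasFDerivAt p hn).congr_fderiv ?_
    ext <;> simp <;> left <;> rw [← mul_inv, ← sq]
  have hnd : (f p).norm = (f p).re * (f p).re + ε * ((f p).im * (f p).im) := by
    rw [QuadraticAlgebra.norm_def]; ring
  -- Writing n⁻¹ as n⁻² n with n = re² + ε im² puts both sides over the common denominator n².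
  have hm : (f p).norm⁻¹ = (f p).norm⁻¹ * (f p).norm⁻¹ *
      ((f p).re * (f p).re + ε * ((f p).im * (f p).im)) := by
    rw [← hnd, mul_assoc, inv_mul_cancel₀ h0, mul_one]
  constructor
  · have h1 : (fun q => ((f q)⁻¹).re) = fun q => (f q).norm⁻¹ * (f q).re := by
      ext q; simp [QuadraticAlgebra.re_inv]
    rw [h1]
    refine (hasFDerivAt_mul hi hf.re).congr_fderiv ?_
    congr 1 <;> simp only [QuadraticAlgebra.re_neg, QuadraticAlgebra.im_neg,
      QuadraticAlgebra.re_mul, QuadraticAlgebra.im_mul,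
      QuadraticAlgebra.re_inv, QuadraticAlgebra.im_inv, zero_mul, add_zero]
    · linear_combination f'.re * hm
    · linear_combination -ε * f'.im * hm
  · have h1 : (fun q => ((f q)⁻¹).im) = fun q => -1 * ((f q).norm⁻¹ * (f q).im) := by
      ext q; simp [QuadraticAlgebra.im_inv]
    rw [h1]
    refine (hasFDerivAt_const_mul (-1) (hasFDerivAt_mul hi hf.im)).congr_fderiv ?_
    congr 1 <;> simp only [QuadraticAlgebra.re_neg, QuadraticAlgebra.im_neg,
      QuadraticAlgebra.re_mul, QuadraticAlgebra.im_mul,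
      QuadraticAlgebra.re_inv, QuadraticAlgebra.im_inv, zero_mul, add_zero]
    · linear_combination -f'.im * hm
    · linear_combination -f'.re * hm

end HasKDeriv

end KCalculus

/-! ### Arithmetic of `𝕂` -/

section KArithmetic

variable {ε : ℝ}

theorem isUnit_iff_norm_ne_zero {z : KNum ε} : IsUnit z ↔ z.norm ≠ 0 := by
  rw [QuadraticAlgebra.isUnit_iff_norm_isUnit, isUnit_iff_ne_zero]

theorem mul_inv_of_norm_ne_zero {z : KNum ε} (h : z.norm ≠ 0) : z * z⁻¹ = 1 := by
  rw [QuadraticAlgebra.inv_def, mul_smul_comm, ← QuadraticAlgebra.algebraMap_norm_eq_mul_star,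
    Algebra.smul_def, ← map_mul, inv_mul_cancel₀ h, map_one]

theorem inv_eq_of_mul_eq_one_of_comm {z w : KNum ε} (h : z * w = 1) : z⁻¹ = w := by
  have hn : z.norm ≠ 0 := isUnit_iff_norm_ne_zero.1 (IsUnit.of_mul_eq_one w h)
  have h1 := mul_inv_of_norm_ne_zero hn
  linear_combination z⁻¹ * (-h) + w * h1

theorem eq_div_of_mul_eq_of_norm_ne_zero {z w v : KNum ε} (h : w.norm ≠ 0) (hz : v * w = z) :
    v = z / w := by
  change v = z * w⁻¹
  linear_combination (-v) * mul_inv_of_norm_ne_zero h + w⁻¹ * hz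

theorem norm_eq (z : KNum ε) : z.norm = z.re * z.re + ε * (z.im * z.im) := by
  rw [QuadraticAlgebra.norm_def]; ring

/-- Although 𝕂 has zero divisors for ε = -1, it is reduced: z² = 0 means re² = ε im² and re · im =
0. -/
theorem eq_zero_of_mul_self_eq_zero (hε : ε = 1 ∨ ε = -1) {z : KNum ε} (h : z * z = 0) :
    z = 0 := by
  have h1 : z.re * z.re - ε * (z.im * z.im) = 0 := by
    have := congrArg QuadraticAlgebra.re h
    simp only [QuadraticAlgebra.re_mul, QuadraticAlgebra.re_zero] at this
    linarith
  have h2 : z.re * z.im = 0 := by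
    have := congrArg QuadraticAlgebra.im h
    simp only [QuadraticAlgebra.im_mul, QuadraticAlgebra.im_zero] at this
    linarith
  have hε0 : ε ≠ 0 := by rcases hε with rfl | rfl <;> norm_num
  rcases mul_eq_zero.1 h2 with h3 | h3 <;> ext <;> simp_all

theorem eq_zero_of_norm_eq_zero {z : KNum 1} (h : z.norm = 0) : z = 0 := by
  rw [norm_eq] at h
  ext
  · change z.re = 0; nlinarith
  · change z.im = 0; nlinarith

theorem norm_eq_mul (z : KNum (-1)) : z.norm = (z.re + z.im) * (z.re - z.im) := by
  rw [norm_eq]; ring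

/-- For s = ±1 the numbers (1 + sτ)/2 are the idempotents of 𝕂 ≅ ℝ ⊕ ℝ, and z.re + s z.im are the
components of z. -/
theorem add_mul_eq_zero_iff {z : KNum (-1)} {s : ℝ} (hs : s * s = 1) :
    (⟨1, s⟩ : KNum (-1)) * z = 0 ↔ z.re + s * z.im = 0 := by
  constructor
  · intro h
    have := congrArg QuadraticAlgebra.re h
    simp at this
    linarith
  · intro h
    ext
    · simp; linarith
    · simp; linear_combination s * h - z.im * hs

/-- The polynomial α + 2tγ + t²β has discriminant zero, so two distinct roots force it to vanish.
The three cases are the pairs among the nodes t = 0, 1, -1. -/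
theorem eq_zero_of_two_eq_zero {α β γ : ℝ} (h : γ * γ = α * β) :
    (α = 0 → α + 2 * γ + β = 0 → α = 0 ∧ β = 0 ∧ γ = 0) ∧
    (α = 0 → α - 2 * γ + β = 0 → α = 0 ∧ β = 0 ∧ γ = 0) ∧
    (α + 2 * γ + β = 0 → α - 2 * γ + β = 0 → α = 0 ∧ β = 0 ∧ γ = 0) := by
  refine ⟨fun h1 h2 => ?_, fun h1 h2 => ?_, fun h1 h2 => ?_⟩
  · have : γ = 0 := by simpa [h1] using h
    exact ⟨h1, by linarith, this⟩
  · have : γ = 0 := by simpa [h1] using h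
    exact ⟨h1, by linarith, this⟩
  · have h3 : γ = 0 := by linarith
    have h4 : β = -α := by linarith
    have h5 : α = 0 := by
      rw [h3, h4] at h; nlinarith
    exact ⟨h5, by linarith, h3⟩

/-- A pair `(a, c)` with `c² = a b` can be rotated so that its first entry becomes invertible. -/
theorem exists_isUnit_rotation (hε : ε = 1 ∨ ε = -1) {a b c : KNum ε} (h : c * c = a * b)
    (hk : ∀ k : KNum ε, k * a = 0 → k * b = 0 → k * c = 0 → k = 0) :
    ∃ β : ℝ, (β = 0 ∨ β * β = 1) ∧
      (a + (2 * β) • c + (β * β) • b).norm ≠ 0 := by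
  by_contra! hcon
  -- Each component vanishes for at most one of β = 0, 1, -1, unless a, b, c all vanish in it. There
  -- are at most two components, so three values suffice.
  have h0 := hcon 0 (by norm_num)
  have h1 := hcon 1 (by norm_num)
  have h2 := hcon (-1) (by norm_num)
  rcases hε with rfl | rfl
  · have h0 := eq_zero_of_norm_eq_zero h0
    have h1 := eq_zero_of_norm_eq_zero h1
    simp at h0 h1
    have hc : c = 0 := eq_zero_of_mul_self_eq_zero (Or.inl rfl) (by rw [h, h0, zero_mul])
    have hb : b = 0 := by simpa [h0, hc] using h1
    simpa using hk 1 (by simp [h0]) (by simp [hb]) (by simp [hc])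
  · have key : ∀ s : ℝ, s * s = 1 → (c.re + s * c.im) * (c.re + s * c.im) =
        (a.re + s * a.im) * (b.re + s * b.im) := by
      intro s hs
      have hr := congrArg QuadraticAlgebra.re h
      have hi := congrArg QuadraticAlgebra.im h
      simp at hr hi
      linear_combination hr + s * hi + (c.im * c.im - a.im * b.im) * hs
    have bad : ∀ s : ℝ, s * s = 1 → ¬ (a.re + s * a.im = 0 ∧ b.re + s * b.im = 0 ∧
        c.re + s * c.im = 0) := by
      rintro s hs ⟨ha, hb, hc⟩
      have := hk ⟨1, s⟩ ((add_mul_eq_zero_iff hs).2 ha) ((add_mul_eq_zero_iff hs).2 hb)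
        ((add_mul_eq_zero_iff hs).2 hc)
      simpa using congrArg QuadraticAlgebra.re this
    obtain ⟨p1, p2, p3⟩ := eq_zero_of_two_eq_zero (key 1 (by norm_num))
    obtain ⟨m1, m2, m3⟩ := eq_zero_of_two_eq_zero (key (-1) (by norm_num))
    have bp := bad 1 (by norm_num)
    have bm := bad (-1) (by norm_num)
    rw [norm_eq_mul, mul_eq_zero] at h0 h1 h2
    simp at h0 h1 h2
    rcases h0 with h0 | h0 <;> rcases h1 with h1 | h1 <;> rcases h2 with h2 | h2
    · exact bp (p1 (by linarith) (by linarith))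
    · exact bp (p1 (by linarith) (by linarith))
    · exact bp (p2 (by linarith) (by linarith))
    · exact bm (m3 (by linarith) (by linarith))
    · exact bp (p3 (by linarith) (by linarith))
    · exact bm (m2 (by linarith) (by linarith))
    · exact bm (m1 (by linarith) (by linarith))
    · exact bm (m1 (by linarith) (by linarith))

/-- The zero divisors among the values of a function with simple zeros are isolated along
horizontal lines. -/
theorem HasKDeriv.eventually_norm_ne_zero (hε : ε = 1 ∨ ε = -1) {Q : ℝ × ℝ → KNum ε}
    {Q' : KNum ε} {q : ℝ × ℝ} (hQ : HasKDeriv Q Q' q)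
    (h : ∀ k : KNum ε, k ≠ 0 → k * Q q = 0 → k * Q' ≠ 0) :
    ∀ᶠ t in 𝓝[≠] (0 : ℝ), (Q (q + (t, 0))).norm ≠ 0 := by
  have hl : HasDerivAt (fun t : ℝ => q + (t, (0 : ℝ))) (1, 0) 0 := by
    simpa using ((hasDerivAt_id (0 : ℝ)).prodMk (hasDerivAt_const (0 : ℝ) (0 : ℝ))).const_add q
  have hq : q + ((0 : ℝ), (0 : ℝ)) = q := by ext <;> simp
  have hre : HasDerivAt (fun t : ℝ => (Q (q + (t, 0))).re) Q'.re 0 := by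
    refine (HasFDerivAt.comp_hasDerivAt (x := (0 : ℝ)) (l := fun q => (Q q).re)
      (hl := hq.symm ▸ hQ.re) (hf := hl)).congr_deriv ?_
    simp
  have him : HasDerivAt (fun t : ℝ => (Q (q + (t, 0))).im) Q'.im 0 := by
    refine (HasFDerivAt.comp_hasDerivAt (x := (0 : ℝ)) (l := fun q => (Q q).im)
      (hl := hq.symm ▸ hQ.im) (hf := hl)).congr_deriv ?_
    simp
  have ev : ∀ {u : ℝ → ℝ} {u' : ℝ}, HasDerivAt u u' 0 → (u 0 = 0 → u' ≠ 0) →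
      ∀ᶠ t in 𝓝[≠] (0 : ℝ), u t ≠ 0 := by
    intro u u' hu h0
    by_cases hz : u 0 = 0
    · exact hu.eventually_ne (h0 hz)
    · exact (hu.continuousAt.eventually_ne hz).filter_mono nhdsWithin_le_nhds
  rcases hε with rfl | rfl
  · by_cases hn : (Q q).norm = 0
    · have hQ' : Q' ≠ 0 := by
        simpa using h 1 one_ne_zero (by rw [eq_zero_of_norm_eq_zero hn, mul_zero])
      have hor : Q'.re ≠ 0 ∨ Q'.im ≠ 0 := by
        by_contra! hc
        exact hQ' (by ext <;> simp [hc.1, hc.2])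
      rcases hor with h1 | h1
      · filter_upwards [ev hre fun _ => h1] with t ht h2
        exact ht (by rw [eq_zero_of_norm_eq_zero h2]; rfl)
      · filter_upwards [ev him fun _ => h1] with t ht h2
        exact ht (by rw [eq_zero_of_norm_eq_zero h2]; rfl)
    · have hc : ContinuousAt (fun t : ℝ => (Q (q + (t, 0))).norm) 0 := by
        simp only [norm_eq]
        exact (hre.continuousAt.mul hre.continuousAt).add
          (continuousAt_const.mul (him.continuousAt.mul him.continuousAt))
      refine (hc.eventually_ne ?_).filter_mono nhdsWithin_le_nhds
      rwa [hq]
  -- Each of the two real components of Q either does not vanish at q or has nonzero derivative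
  -- along the line; a value is invertible when both components are nonzero.
  · have comp : ∀ s : ℝ, s * s = 1 →
        ∀ᶠ t in 𝓝[≠] (0 : ℝ), (Q (q + (t, 0))).re + s * (Q (q + (t, 0))).im ≠ 0 := by
      intro s hs
      refine ev (hre.add (him.const_mul s)) fun h0 h1 => ?_
      rw [hq] at h0
      refine h ⟨1, s⟩ (fun hk => ?_) ((add_mul_eq_zero_iff hs).2 h0)
        ((add_mul_eq_zero_iff hs).2 h1)
      simpa using congrArg QuadraticAlgebra.re hk
    filter_upwards [comp 1 (by norm_num), comp (-1) (by norm_num)] with t h1 h2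
    rw [norm_eq_mul]
    refine mul_ne_zero (by simpa using h1) ?_
    simpa [sub_eq_add_neg] using h2

end KArithmetic

/-! ### Null curves in 𝕂³ and the quotient c / a -/

section NullCurves

variable {ε : ℝ}

theorem HasKDeriv.continuousAt_norm {f : ℝ × ℝ → KNum ε} {f' : KNum ε} {p : ℝ × ℝ}
    (h : HasKDeriv f f' p) : ContinuousAt (fun q => (f q).norm) p := by
  simp only [norm_eq]
  exact (h.re.continuousAt.mul h.re.continuousAt).add
    (continuousAt_const.mul (h.im.continuousAt.mul h.im.continuousAt))

/-- `f` is smooth with derivative `f'` on `U`. -/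
structure IsKSmooth (f f' : ℝ × ℝ → KNum ε) (U : Set (ℝ × ℝ)) : Prop where
  re : ContDiffOn ℝ ∞ (fun q => (f q).re) U
  im : ContDiffOn ℝ ∞ (fun q => (f q).im) U
  deriv : ∀ p ∈ U, HasKDeriv f (f' p) p

namespace IsKSmooth

variable {f g f' g' : ℝ × ℝ → KNum ε} {U V : Set (ℝ × ℝ)}

theorem mono (h : IsKSmooth f f' U) (hVU : V ⊆ U) : IsKSmooth f f' V :=
  ⟨h.re.mono hVU, h.im.mono hVU, fun p hp => h.deriv p (hVU hp)⟩

theorem add (hf : IsKSmooth f f' U) (hg : IsKSmooth g g' U) :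
    IsKSmooth (fun q => f q + g q) (fun q => f' q + g' q) U :=
  ⟨hf.re.add hg.re, hf.im.add hg.im, fun p hp => (hf.deriv p hp).add (hg.deriv p hp)⟩

theorem const_mul (k : KNum ε) (hf : IsKSmooth f f' U) :
    IsKSmooth (fun q => k * f q) (fun q => k * f' q) U := by
  refine ⟨?_, ?_, fun p hp => (hf.deriv p hp).const_mul k⟩
  · simp only [QuadraticAlgebra.re_mul]
    exact (contDiffOn_const.mul hf.re).add (contDiffOn_const.mul hf.im)
  · simp only [QuadraticAlgebra.im_mul, zero_mul, add_zero]
    exact (contDiffOn_const.mul hf.im).add (contDiffOn_const.mul hf.re)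

theorem congr_deriv (hf : IsKSmooth f f' U) (h : ∀ p ∈ U, f' p = g' p) : IsKSmooth f g' U :=
  ⟨hf.re, hf.im, fun p hp => (hf.deriv p hp).congr_deriv (h p hp)⟩

theorem kHolomorphicOn (hε : ε = 1 ∨ ε = -1) (hf : IsKSmooth f f' U) : KHolomorphicOn f U :=
  ⟨hf.re, hf.im, fun p hp => dzbar_eq_zero hε (hf.deriv p hp)⟩

end IsKSmooth

/-- The algebraic relations between the components `a`, `b`, `c` of the null vector `ψ_z` and
those of the normal vector, with respect to a basis of `𝕂³` in which the quadratic form is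
`c² - a b`. -/
structure IsNullTriple (E : ℝ) (a b c na nb nc : KNum ε) : Prop where
  sq : c * c = a * b
  ac : a * nc - c * na = -(algebraMap ℝ (KNum ε) ε * a)
  ab : a * nb - b * na = -(2 * algebraMap ℝ (KNum ε) ε * c)
  cb : c * nb - b * nc = -(algebraMap ℝ (KNum ε) ε * b)
  norm : a.norm + b.norm - 2 * ε * c.norm = E
  pos : 0 < E

namespace IsNullTriple

variable {E : ℝ} {a b c na nb nc : KNum ε}

theorem mul_star (h : IsNullTriple E a b c na nb nc) :
    a * star a + b * star b - 2 * algebraMap ℝ (KNum ε) ε * (c * star c) =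
      algebraMap ℝ (KNum ε) E := by
  rw [← h.norm]
  simp only [← QuadraticAlgebra.algebraMap_norm_eq_mul_star, map_add, map_sub, map_mul,
    map_ofNat]

/-- From k a = k b = 0 one gets (k c)² = 0, so k c = 0, and multiplying the formula for E by k gives
k E = 0. This is where E > 0 yields coprimality. -/
theorem eq_zero_of_mul_eq_zero (hε : ε = 1 ∨ ε = -1) (h : IsNullTriple E a b c na nb nc)
    {k : KNum ε} (ha : k * a = 0) (hb : k * b = 0) : k = 0 := by
  have hc : k * c = 0 := eq_zero_of_mul_self_eq_zero hε (by
    linear_combination k * k * h.sq + k * b * ha)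
  have h1 : k * algebraMap ℝ (KNum ε) E = 0 := by
    linear_combination (-k) * h.mul_star + star a * ha + star b * hb -
      2 * algebraMap ℝ (KNum ε) ε * star c * hc
  have h2 : IsUnit (algebraMap ℝ (KNum ε) E) := (IsUnit.mk0 E h.pos.ne').map _
  exact h2.mul_left_eq_zero.1 h1

/-- Multiply the formula for E by |a|² and use |c|⁴ = |a|²|b|²: the result is a perfect square. It
makes |a|² nonnegative and is the Liouville formula before division. -/
theorem norm_sq (hε : ε = 1 ∨ ε = -1) (h : IsNullTriple E a b c na nb nc) :
    (a.norm - ε * c.norm) ^ 2 = a.norm * E := by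
  have h1 : c.norm * c.norm = a.norm * b.norm := by rw [← map_mul, h.sq, map_mul]
  have h2 : ε * ε = 1 := by rcases hε with rfl | rfl <;> norm_num
  linear_combination a.norm * h.norm + h1 + c.norm * c.norm * h2

theorem norm_pos (hε : ε = 1 ∨ ε = -1) (h : IsNullTriple E a b c na nb nc)
    (ha : a.norm ≠ 0) : 0 < a.norm := by
  refine lt_of_le_of_ne (not_lt.1 fun hlt => ?_) ha.symm
  have := mul_neg_of_neg_of_pos hlt h.pos
  rw [← h.norm_sq hε] at this
  exact absurd this (not_lt.2 (sq_nonneg _))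

theorem norm_div (ha : a.norm ≠ 0) : (c / a).norm * a.norm = c.norm := by
  rw [← map_mul]
  congr 1
  change c * a⁻¹ * a = c
  linear_combination c * mul_inv_of_norm_ne_zero ha

/-- If |c/a|² = ε, then |a|² - ε|c|² = 0, so the perfect square |a|² E would vanish. -/
theorem norm_div_ne (hε : ε = 1 ∨ ε = -1) (h : IsNullTriple E a b c na nb nc)
    (ha : a.norm ≠ 0) : (c / a).norm ≠ ε := by
  intro h0
  have h1 := norm_div (c := c) ha
  have h2 : ε * ε = 1 := by rcases hε with rfl | rfl <;> norm_num
  have h3 := h.norm_sq hε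
  rw [h0] at h1
  have h4 : a.norm * E = 0 := by
    rw [← h3, ← h1]
    linear_combination ((a.norm) ^ 2 * (ε * ε - 1)) * h2
  exact mul_ne_zero ha h.pos.ne' h4

/-- Taking norms in 2ad = 1 gives 4|a|²|d|² = 1, and the perfect-square identity is divided by |a|⁴.
-/
theorem eq_liouville (hε : ε = 1 ∨ ε = -1) (h : IsNullTriple E a b c na nb nc)
    (ha : a.norm ≠ 0) {d : KNum ε} (hd : 2 * a * d = 1) :
    E = (1 - ε * (c / a).norm) ^ 2 / (4 * d.norm) := by
  have h1 := norm_div (c := c) ha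
  have h3 := h.norm_sq hε
  have h4 : 4 * d.norm * a.norm = 1 := by
    have h5 : (2 : KNum ε) = algebraMap ℝ (KNum ε) 2 := (map_ofNat _ 2).symm
    have := congrArg QuadraticAlgebra.norm hd
    rw [h5, map_mul, map_mul, QuadraticAlgebra.norm_algebraMap, map_one] at this
    linear_combination this
  have h6 : 4 * d.norm ≠ 0 := left_ne_zero_of_mul_eq_one h4
  rw [eq_div_iff h6]
  rw [← h1] at h3
  refine mul_left_cancel₀ (mul_ne_zero ha ha) ?_
  linear_combination a.norm * E * h4 - h3

end IsNullTriple

/-- The components of a null curve `ψ_z` on `Ω` and of its normal, in the situation of a Liouville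
parameter. -/
structure IsNullCurve (Ω : Set (ℝ × ℝ)) (E : ℝ × ℝ → ℝ)
    (a b c na nb nc μ : ℝ × ℝ → KNum ε) : Prop where
  triple : ∀ p ∈ Ω, IsNullTriple (E p) (a p) (b p) (c p) (na p) (nb p) (nc p)
  smooth_a : IsKSmooth a (fun p => μ p * a p - algebraMap ℝ (KNum ε) (ε / 2) * na p) Ω
  smooth_b : IsKSmooth b (fun p => μ p * b p - algebraMap ℝ (KNum ε) (ε / 2) * nb p) Ω
  smooth_c : IsKSmooth c (fun p => μ p * c p - algebraMap ℝ (KNum ε) (ε / 2) * nc p) Ω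

namespace IsNullCurve

variable {Ω S : Set (ℝ × ℝ)} {E : ℝ × ℝ → ℝ} {a b c na nb nc μ g : ℝ × ℝ → KNum ε} {p : ℝ × ℝ}

theorem two_mul_half (ε : ℝ) : 2 * algebraMap ℝ (KNum ε) (ε / 2) = algebraMap ℝ (KNum ε) ε := by
  rw [show (2 : KNum ε) = algebraMap ℝ (KNum ε) 2 from (map_ofNat _ 2).symm, ← map_mul]
  congr 1; ring

theorem algebraMap_mul_self (hε : ε = 1 ∨ ε = -1) :
    algebraMap ℝ (KNum ε) ε * algebraMap ℝ (KNum ε) ε = 1 := by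
  rw [← map_mul, show ε * ε = 1 by rcases hε with rfl | rfl <;> norm_num, map_one]

/-- In c'a - ca' the terms with μ cancel. What remains is -(ε/2)(a nc - c na) = a/2, so the
derivative of c/a is 1/(2a). -/
theorem two_mul_dz_div (hε : ε = 1 ∨ ε = -1) (h : IsNullCurve Ω E a b c na nb nc μ) (hp : p ∈ Ω)
    (ha : (a p).norm ≠ 0) : 2 * a p * dz (fun q => c q / a q) p = 1 := by
  have hd := ((h.smooth_c.deriv p hp).mul ((h.smooth_a.deriv p hp).inv ha))
  have hd' : HasKDeriv (fun q => c q / a q) _ p := hd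
  rw [dz_eq hε hd']
  have h1 := mul_inv_of_norm_ne_zero ha
  have h2 := (h.triple p hp).ac
  have h3 := two_mul_half ε
  have h4 := algebraMap_mul_self hε
  generalize (a p)⁻¹ = v at *
  generalize algebraMap ℝ (KNum ε) (ε / 2) = η at *
  generalize algebraMap ℝ (KNum ε) ε = e at *
  linear_combination (2 * (μ p * c p - η * nc p) - 2 * c p * (μ p * a p - η * na p) * v -
    2 * c p * μ p + 2 * η * nc p + 1) * h1 - 2 * η * v * h2 + e * v * a p * h3 + v * a p * h4

/-- Near every point `c / a` is a quotient in lowest terms with a denominator with simple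
zeros. -/
theorem exists_isQuotientOn (hε : ε = 1 ∨ ε = -1) (hΩ : IsOpen Ω)
    (h : IsNullCurve Ω E a b c na nb nc μ) (hg : ∀ q ∈ Ω, g q = c q / a q)
    (hS : ∀ q ∈ Ω, q ∈ S ↔ ¬ IsUnit (a q)) (hp : p ∈ Ω) :
    ∃ U P Q, IsOpen U ∧ p ∈ U ∧ U ⊆ Ω ∧ IsQuotientOn g P Q S U ∧
      ∀ k : KNum ε, k ≠ 0 → k * Q p = 0 → k * dz Q p ≠ 0 := by
  have hT := h.triple p hp
  -- Numerator c + Bb and denominator a + Bc satisfy (a + Bc)² = aD, (c + Bb)² = bD and (c + Bb)a =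
  -- c(a + Bc). Where D is invertible, the denominator is thus invertible exactly where a is, and
  -- the quotient is unchanged.
  obtain ⟨β, hβ, hD⟩ := exists_isUnit_rotation hε hT.sq
    fun k ha hb _ => hT.eq_zero_of_mul_eq_zero hε ha hb
  set B : KNum ε := algebraMap ℝ (KNum ε) β with hB
  have hβ' : β = 0 ∨ IsUnit B := hβ.imp id fun h1 => by
    refine IsUnit.of_mul_eq_one B ?_
    rw [hB, ← map_mul, h1, map_one]
  set D : ℝ × ℝ → KNum ε := fun q => a q + (2 * B) * c q + B * B * b q with hDdef
  have hDp : (D p).norm ≠ 0 := by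
    convert hD using 2
    simp only [hDdef, hB, Algebra.smul_def, map_mul, map_ofNat]
  have hDs := (h.smooth_a.add (h.smooth_c.const_mul (2 * B))).add (h.smooth_b.const_mul (B * B))
  set U : Set (ℝ × ℝ) := Ω ∩ (fun q => (D q).norm) ⁻¹' {0}ᶜ with hU
  have hUo : IsOpen U := ContinuousOn.isOpen_inter_preimage
    (fun q hq => (hDs.deriv q hq).continuousAt_norm.continuousWithinAt) hΩ
    isOpen_compl_singleton
  have hUΩ : U ⊆ Ω := inter_subset_left
  have hQs := (h.smooth_a.add (h.smooth_c.const_mul B)).mono hUΩ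
  have hPs := (h.smooth_c.add (h.smooth_b.const_mul B)).mono hUΩ
  have hDU : ∀ q ∈ U, IsUnit (D q) := fun q hq => isUnit_iff_norm_ne_zero.2 hq.2
  have hQQ : ∀ q ∈ U, (a q + B * c q) * (a q + B * c q) = a q * D q := fun q hq => by
    linear_combination (B * B) * (h.triple q hq.1).sq
  have hPP : ∀ q ∈ U, (c q + B * b q) * (c q + B * b q) = b q * D q := fun q hq => by
    linear_combination (h.triple q hq.1).sq
  have hpole : ∀ q ∈ U, q ∈ S ↔ ¬ IsUnit (a q + B * c q) := fun q hq => by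
    rw [hS q hq.1, not_iff_not, ← isUnit_mul_self_iff (a := a q + B * c q), hQQ q hq,
      IsUnit.mul_iff]
    exact ⟨fun h => ⟨h, hDU q hq⟩, fun h => h.1⟩
  have hka : ∀ q ∈ U, ∀ k, k * (a q + B * c q) = 0 → k * a q = 0 := fun q hq k hk => by
    refine (hDU q hq).mul_left_eq_zero.1 ?_
    linear_combination (-k) * hQQ q hq + (a q + B * c q) * hk
  have hsimple : ∀ q ∈ U, ∀ k : KNum ε, k ≠ 0 → k * (a q + B * c q) = 0 →
      k * dz (fun q => a q + B * c q) q ≠ 0 := by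
    intro q hq k hk0 hk hk'
    have hTq := h.triple q hq.1
    have ha := hka q hq k hk
    have hc : k * c q = 0 := eq_zero_of_mul_self_eq_zero hε (by
      linear_combination k * k * hTq.sq + k * b q * ha)
    rw [dz_eq hε (hQs.deriv q hq)] at hk'
    have h3 := two_mul_half ε
    have h4 := algebraMap_mul_self hε
    have h1 : k * (na q + B * nc q) = 0 := by
      generalize algebraMap ℝ (KNum ε) (ε / 2) = η at *
      linear_combination (-2 * algebraMap ℝ (KNum ε) ε) * hk' +
        2 * algebraMap ℝ (KNum ε) ε * μ q * hk - k * (na q + B * nc q) * h4 -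
        k * (na q + B * nc q) * algebraMap ℝ (KNum ε) ε * h3
    -- As k annihilates a and c, the relation `ab` gives k b na = 0 and `cb` gives k b nc = ε k b.
    -- Multiplying k(na + B nc) = 0 by b leaves B k b = 0.
    have h2 : B * (k * b q) = 0 := by
      have hab := hTq.ab
      have hcb := hTq.cb
      generalize algebraMap ℝ (KNum ε) ε = e at *
      linear_combination -B * k * b q * h4 + e * (k * B * hcb - B * nb q * hc + b q * h1 -
        (-(k * hab) + nb q * ha + 2 * e * hc))
    refine hk0 ?_
    rcases hβ' with rfl | hu
    · have : IsUnit (a q) := by simpa [hDdef, hB] using hDU q hq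
      exact this.mul_left_eq_zero.1 ha
    · exact hTq.eq_zero_of_mul_eq_zero hε ha (hu.mul_right_eq_zero.1 h2)
  refine ⟨U, fun q => c q + B * b q, fun q => a q + B * c q, hUo, ⟨hp, hDp⟩, hUΩ,
    ⟨hPs.kHolomorphicOn hε, hQs.kHolomorphicOn hε, hpole, ?_, ?_, ?_⟩, hsimple p ⟨hp, hDp⟩⟩
  -- Density: the zeros of the denominator are simple at every point of U, so on the horizontal line
  -- through q it is invertible for all small nonzero t.
  · intro q hq
    have hev := (hQs.deriv q hq).eventually_norm_ne_zero hε
      (dz_eq hε (hQs.deriv q hq) ▸ hsimple q hq)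
    have hl : Tendsto (fun t : ℝ => q + (t, (0 : ℝ))) (𝓝[≠] 0) (𝓝 q) := by
      have : ContinuousAt (fun t : ℝ => q + (t, (0 : ℝ))) 0 := by fun_prop
      have h0 : q + ((0 : ℝ), (0 : ℝ)) = q := by ext <;> simp
      have h1 := this.tendsto
      rw [h0] at h1
      exact h1.mono_left nhdsWithin_le_nhds
    refine mem_closure_of_tendsto hl ?_
    filter_upwards [hev, hl (hUo.mem_nhds hq)] with t h1 h2
    exact ⟨h2, fun hs => (hpole _ h2).1 hs (isUnit_iff_norm_ne_zero.2 h1)⟩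
  · intro q hq k hkP hkQ
    refine (h.triple q hq.1).eq_zero_of_mul_eq_zero hε (hka q hq k hkQ) ?_
    refine (hDU q hq).mul_left_eq_zero.1 ?_
    linear_combination (-k) * hPP q hq + (c q + B * b q) * hkP
  · intro q hq
    have hQu : IsUnit (a q + B * c q) := not_not.1 fun hn => hq.2 ((hpole q hq.1).2 hn)
    have hau : IsUnit (a q) := not_not.1 fun hn => hq.2 ((hS q (hUΩ hq.1)).2 hn)
    rw [hg q (hUΩ hq.1)]
    have hi := mul_inv_of_norm_ne_zero (isUnit_iff_norm_ne_zero.1 hau)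
    refine eq_div_of_mul_eq_of_norm_ne_zero (isUnit_iff_norm_ne_zero.1 hQu) ?_
    change c q * (a q)⁻¹ * (a q + B * c q) = _
    linear_combination (c q + B * b q) * hi + (a q)⁻¹ * B * (h.triple q (hUΩ hq.1)).sq

end IsNullCurve

end NullCurves

/-! ### Null coordinates of ψ_z for the two signatures -/

section WeierstrassData

variable {ε : ℝ}

theorem IsKSmooth.congr {f g f' g' : ℝ × ℝ → KNum ε} {U : Set (ℝ × ℝ)} (hU : IsOpen U)
    (hf : IsKSmooth f f' U) (h : ∀ p ∈ U, g p = f p) (h' : ∀ p ∈ U, f' p = g' p) :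
    IsKSmooth g g' U := by
  refine ⟨hf.re.congr fun p hp => by rw [h p hp], hf.im.congr fun p hp => by rw [h p hp],
    fun p hp => ?_⟩
  have he : ∀ᶠ q in 𝓝 p, g q = f q := (hU.eventually_mem hp).mono h
  rw [← h' p hp]
  exact ⟨(hf.deriv p hp).re.congr_of_eventuallyEq (he.mono fun q hq => by simp only [hq]),
    (hf.deriv p hp).im.congr_of_eventuallyEq (he.mono fun q hq => by simp only [hq])⟩

/-- Only the inner product with Y survives, and it is minus the frame volume. With Y × N = X this
gives φ × N = -εωφ for the null vector φ, the source of the three linear relations of a null triple.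
-/
theorem IsAdapted.lcross_X_N {e : ℝ} (hε : ε = 1 ∨ ε = -1) (he : e ≠ 0) {X Y N : L3}
    (h : IsAdapted ε e X Y N) (hv : lor (lcross X Y) N = e⁻¹) : lcross X N = (-ε) • Y := by
  rw [h.expansion hε he (lcross X N)]
  have h1 : lor (lcross X N) X = 0 := by simp [lor, lcross]; ring
  have h2 : lor (lcross X N) N = 0 := by simp [lor, lcross]; ring
  have h3 : lor (lcross X N) Y = -e⁻¹ := by rw [← hv]; simp [lor, lcross]; ring
  rw [h1, h2, h3]
  ext i
  simp [he]

theorem IsAdapted.lcross_Y_N {e : ℝ} (hε : ε = 1 ∨ ε = -1) (he : e ≠ 0) {X Y N : L3}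
    (h : IsAdapted ε e X Y N) (hv : lor (lcross X Y) N = e⁻¹) : lcross Y N = X := by
  conv_lhs => rw [h.expansion hε he (lcross Y N)]
  have h1 : lor (lcross Y N) X = e⁻¹ := by rw [← hv]; simp [lor, lcross]; ring
  have h2 : lor (lcross Y N) N = 0 := by simp [lor, lcross]; ring
  have h3 : lor (lcross Y N) Y = 0 := by simp [lor, lcross]; ring
  rw [h1, h2, h3]
  ext i
  simp [he]

theorem re_two : (2 : KNum ε).re = 2 := rfl

theorem im_two : (2 : KNum ε).im = 0 := rfl

/-- The null vector `ψ_z` of an adapted frame with `ψ_x = X` and `ψ_y = Y`. -/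
noncomputable def nullVector (ε : ℝ) (X Y : L3) (j : Fin 3) : KNum ε :=
  ⟨1 / 2 * X j, -(ε / 2) * Y j⟩

theorem phi_eq {ψ : ℝ × ℝ → L3} {p : ℝ × ℝ}
    (h : HasFDerivAt ψ (ofPartials (dX ψ p) (dY ψ p)) p) (j : Fin 3) :
    phi ε ψ p j = nullVector ε (dX ψ p) (dY ψ p) j := by
  have hz : HasFDerivAt (fun _ : ℝ × ℝ => (0 : ℝ)) (ofPartials (0 : ℝ) 0) p :=
    (hasFDerivAt_const (0 : ℝ) p).congr_fderiv (by ext <;> simp)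
  rw [phi, dz, kdX, kdY]
  simp only [QuadraticAlgebra.algebraMap_re, QuadraticAlgebra.algebraMap_im]
  rw [dX_eq_of_hasFDerivAt hz, dY_eq_of_hasFDerivAt hz,
    dX_eq_of_hasFDerivAt (hasFDerivAt_apply h j), dY_eq_of_hasFDerivAt (hasFDerivAt_apply h j)]
  ext <;> simp [nullVector]; ring

/-- In the coordinates a = -φ₀ + iφ₁, b = -φ₀ - iφ₁, c = φ₂ one has c² - ab = -⟨φ, φ⟩, which
vanishes by conformality. The linear relations are the components of φ × N = -iφ. -/
theorem isNullTriple_riemannian {e : ℝ} (he : 0 < e) {X Y N : L3}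
    (h : IsAdapted 1 e X Y N) (hv : lor (lcross X Y) N = e⁻¹) :
    let φ := nullVector 1 X Y
    let n : Fin 3 → KNum 1 := fun j => algebraMap ℝ (KNum 1) (N j)
    IsNullTriple e⁻¹ (-1 * φ 0 + unitI 1 * φ 1) (-1 * φ 0 + -unitI 1 * φ 1) (φ 2)
      (-1 * n 0 + unitI 1 * n 1) (-1 * n 0 + -unitI 1 * n 1) (n 2) := by
  intro φ n
  have hX := h.lcross_X_N (Or.inl rfl) he.ne' hv
  have hY := h.lcross_Y_N (Or.inl rfl) he.ne' hv
  have hX0 := congrFun hX 0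
  have hX1 := congrFun hX 1
  have hX2 := congrFun hX 2
  have hY0 := congrFun hY 0
  have hY1 := congrFun hY 1
  have hY2 := congrFun hY 2
  obtain ⟨hXX, hXY, hYY, -, -, -⟩ := h
  simp only [lor, lcross, Matrix.cons_val, Pi.smul_apply, smul_eq_mul] at *
  refine ⟨?_, ?_, ?_, ?_, ?_, inv_pos.2 he⟩
  · ext <;> simp [φ, nullVector]
    · linear_combination (-1/4) * hXX + (1/4) * hYY
    · linear_combination (1/2) * hXY
  · ext <;> simp [φ, n, nullVector]
    all_goals linarith
  · ext <;> simp [φ, n, nullVector, re_two, im_two]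
    all_goals linarith
  · ext <;> simp [φ, n, nullVector]
    all_goals linarith
  · simp [norm_eq, φ, nullVector]
    linear_combination (1/2) * hXX + (1/2) * hYY

/-- Here a = φ₁ + τφ₂, b = -φ₁ + τφ₂, c = φ₀, so that c² - ab = ⟨φ, φ⟩ = 0, and the linear relations
are the components of φ × N = τφ. -/
theorem isNullTriple_lorentzian {e : ℝ} (he : 0 < e) {X Y N : L3}
    (h : IsAdapted (-1) e X Y N) (hv : lor (lcross X Y) N = e⁻¹) :
    let φ := nullVector (-1) X Y
    let n : Fin 3 → KNum (-1) := fun j => algebraMap ℝ (KNum (-1)) (N j)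
    IsNullTriple e⁻¹ (1 * φ 1 + unitI (-1) * φ 2) (-1 * φ 1 + unitI (-1) * φ 2) (φ 0)
      (1 * n 1 + unitI (-1) * n 2) (-1 * n 1 + unitI (-1) * n 2) (n 0) := by
  intro φ n
  have hX := h.lcross_X_N (Or.inr rfl) he.ne' hv
  have hY := h.lcross_Y_N (Or.inr rfl) he.ne' hv
  have hX0 := congrFun hX 0
  have hX1 := congrFun hX 1
  have hX2 := congrFun hX 2
  have hY0 := congrFun hY 0
  have hY1 := congrFun hY 1
  have hY2 := congrFun hY 2
  obtain ⟨hXX, hXY, hYY, -, -, -⟩ := h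
  simp only [lor, lcross, Matrix.cons_val, Pi.smul_apply, smul_eq_mul] at *
  refine ⟨?_, ?_, ?_, ?_, ?_, inv_pos.2 he⟩
  · ext <;> simp [φ, nullVector]
    · linear_combination (1/4) * hXX + (1/4) * hYY
    · linear_combination (1/2) * hXY
  · ext <;> simp [φ, n, nullVector]
    all_goals linarith
  · ext <;> simp [φ, n, nullVector, re_two, im_two]
    all_goals linarith
  · ext <;> simp [φ, n, nullVector]
    all_goals linarith
  · simp [norm_eq, φ, nullVector]
    linear_combination (1/2) * hXX - (1/2) * hYY

/-- The Gauss equations give ψ_xx + εψ_yy = 0, so φ is holomorphic, and φ' = μφ - (ε/2)N with μ =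
2λ_z. The form survives constant linear combinations of components, hence passes to a, b, c. -/
theorem IsLiouvilleImmersion.isKSmooth_phi {Ω : Set (ℝ × ℝ)} {lam : ℝ × ℝ → ℝ}
    {ψ : ℝ × ℝ → L3} (hε : ε = 1 ∨ ε = -1) (hΩ : IsOpen Ω)
    (hlam : ∀ p ∈ Ω, DifferentiableAt ℝ lam p) (h : IsLiouvilleImmersion ε Ω lam ψ) (j : Fin 3) :
    IsKSmooth (fun q => phi ε ψ q j)
      (fun q => ⟨dX lam q, -ε * dY lam q⟩ * phi ε ψ q j -
        algebraMap ℝ (KNum ε) (ε / 2) * algebraMap ℝ (KNum ε) (normalN ε ψ q j)) Ω := by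
  have hphi : ∀ q ∈ Ω, phi ε ψ q j = nullVector ε (dX ψ q) (dY ψ q) j := fun q hq =>
    phi_eq (h.hasFDerivAt_self hΩ hq) j
  have hM := h.isMovingFrame hε hΩ hlam
  have hs : IsKSmooth (fun q => nullVector ε (dX ψ q) (dY ψ q) j)
      (fun q => ⟨dX lam q, -ε * dY lam q⟩ * nullVector ε (dX ψ q) (dY ψ q) j -
        algebraMap ℝ (KNum ε) (ε / 2) * algebraMap ℝ (KNum ε) (normalN ε ψ q j)) Ω := by
    refine ⟨?_, ?_, fun p hp => ⟨?_, ?_⟩⟩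
    · exact contDiffOn_const.mul (contDiffOn_pi.1 (contDiffOn_dX hΩ h.smooth) j)
    · exact contDiffOn_const.mul (contDiffOn_pi.1 (contDiffOn_dY hΩ h.smooth) j)
    · refine (hasFDerivAt_const_mul (1 / 2)
        (hasFDerivAt_apply (hM.hasFDerivAt_X p hp) j)).congr_fderiv ?_
      rcases hε with rfl | rfl <;> congr 1 <;> simp [nullVector] <;> ring
    · refine (hasFDerivAt_const_mul (-(ε / 2))
        (hasFDerivAt_apply (hM.hasFDerivAt_Y p hp) j)).congr_fderiv ?_
      rcases hε with rfl | rfl <;> congr 1 <;> simp [nullVector] <;> ring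
  exact hs.congr hΩ hphi fun q hq => by rw [hphi q hq]

theorem IsKSmooth.linearCombination {Ω : Set (ℝ × ℝ)} {f g u v μ : ℝ × ℝ → KNum ε} {η : KNum ε}
    (k l : KNum ε) (hf : IsKSmooth f (fun q => μ q * f q - η * u q) Ω)
    (hg : IsKSmooth g (fun q => μ q * g q - η * v q) Ω) :
    IsKSmooth (fun q => k * f q + l * g q)
      (fun q => μ q * (k * f q + l * g q) - η * (k * u q + l * v q)) Ω :=
  ((hf.const_mul k).add (hg.const_mul l)).congr_deriv fun q _ => by ring

end WeierstrassData

/-! ### The Weierstrass pair of a Liouville immersion -/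

section WeierstrassPair

variable {ε : ℝ}

namespace IsNullCurve

variable {Ω S : Set (ℝ × ℝ)} {E : ℝ × ℝ → ℝ} {a b c na nb nc μ f g : ℝ × ℝ → KNum ε} {p : ℝ × ℝ}

theorem isUnit_weierstrass_iff (hε : ε = 1 ∨ ε = -1) {z w : KNum ε}
    (h : z = -(2 * algebraMap ℝ (KNum ε) ε) * w) : IsUnit z ↔ IsUnit w := by
  have hu : IsUnit (-(2 * algebraMap ℝ (KNum ε) ε)) := by
    refine IsUnit.of_mul_eq_one (-(algebraMap ℝ (KNum ε) (1 / 2) * algebraMap ℝ (KNum ε) ε)) ?_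
    have h1 := algebraMap_mul_self hε
    have h2 : 2 * algebraMap ℝ (KNum ε) (1 / 2) = 1 := by
      rw [show (2 : KNum ε) = algebraMap ℝ (KNum ε) 2 from (map_ofNat _ 2).symm, ← map_mul]
      norm_num
    linear_combination 2 * algebraMap ℝ (KNum ε) (1 / 2) * h1 + h2
  rw [h, IsUnit.mul_iff, and_iff_right hu]

/-- With f = -2εa and g = c/a everything is a statement on the null curve: 2a g' = 1 gives f = -ε/g'
and |g'|² = 1/(4|a|²) > 0. The relations ga = c and gc = b serve to recover ψ_z from f and g. -/
theorem weierstrass (hε : ε = 1 ∨ ε = -1) (hΩ : IsOpen Ω)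
    (h : IsNullCurve Ω E a b c na nb nc μ)
    (hf : f = fun q => -(2 * algebraMap ℝ (KNum ε) ε) * a q) (hg : g = fun q => c q / a q)
    (hS : S = {p | p ∈ Ω ∧ ¬ IsUnit (f p)}) :
    KHolomorphicOn f Ω ∧ IsMeromorphicWithPoles g S Ω ∧ HasOnlySimplePoles g S ∧
      ∀ p ∈ Ω \ S, 0 < (dz g p).norm ∧ (g p).norm ≠ ε ∧ f p = -ε • (dz g p)⁻¹ ∧
        E p = (1 - ε * (g p).norm) ^ 2 / (4 * (dz g p).norm) ∧
        g p * a p = c p ∧ g p * c p = b p := by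
  have hSa : ∀ q ∈ Ω, q ∈ S ↔ ¬ IsUnit (a q) := fun q hq => by
    rw [hS, mem_ofPred_eq, and_iff_right hq, isUnit_weierstrass_iff hε (congrFun hf q)]
  have hq : ∀ p ∈ Ω, _ := fun p hp =>
    h.exists_isQuotientOn hε hΩ (g := g) (S := S) (fun q _ => congrFun hg q) hSa hp
  refine ⟨?_, ⟨?_, ?_⟩, ?_, ?_⟩
  · rw [hf]
    exact (h.smooth_a.const_mul _).kHolomorphicOn hε
  · rw [hS]
    exact fun q hq => hq.1
  · intro p hp
    obtain ⟨U, P, Q, hU, hpU, hUΩ, hPQ, -⟩ := hq p hp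
    exact ⟨U, P, Q, hU, hpU, hUΩ, hPQ⟩
  · intro p hp
    obtain ⟨U, P, Q, hU, hpU, -, hPQ, hs⟩ := hq p (by rw [hS] at hp; exact hp.1)
    exact ⟨U, P, Q, hU, hpU, hPQ, hs⟩
  · rintro p ⟨hp, hpS⟩
    have hT := h.triple p hp
    have hau : IsUnit (a p) := not_not.1 fun hn => hpS ((hSa p hp).2 hn)
    have ha := isUnit_iff_norm_ne_zero.1 hau
    have hd : 2 * a p * dz g p = 1 := hg ▸ h.two_mul_dz_div hε hp ha
    have hpos := hT.norm_pos hε ha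
    have hdn : 4 * (a p).norm * (dz g p).norm = 1 := by
      have := congrArg QuadraticAlgebra.norm hd
      rw [show (2 : KNum ε) = algebraMap ℝ (KNum ε) 2 from (map_ofNat _ 2).symm, map_mul,
        map_mul, QuadraticAlgebra.norm_algebraMap, map_one] at this
      linear_combination this
    refine ⟨?_, ?_, ?_, ?_, ?_, ?_⟩
    · exact pos_of_mul_pos_right (hdn ▸ one_pos) (by positivity)
    · rw [hg]
      exact hT.norm_div_ne hε ha
    · rw [hf, inv_eq_of_mul_eq_one_of_comm (z := dz g p) (w := 2 * a p) (by rw [mul_comm, hd]),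
        Algebra.smul_def, map_neg]
      ring
    · rw [congrFun hg p]
      exact hT.eq_liouville hε ha hd
    · rw [congrFun hg p]
      change c p * (a p)⁻¹ * a p = c p
      linear_combination c p * mul_inv_of_norm_ne_zero ha
    · rw [congrFun hg p]
      change c p * (a p)⁻¹ * c p = b p
      linear_combination (a p)⁻¹ * hT.sq + b p * mul_inv_of_norm_ne_zero ha

end IsNullCurve

namespace IsLiouvilleImmersion

variable {Ω : Set (ℝ × ℝ)} {lam : ℝ × ℝ → ℝ} {ψ : ℝ × ℝ → L3}

theorem weierstrass (hε : ε = 1 ∨ ε = -1) (hΩ : IsOpen Ω)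
    (hlam : ∀ p ∈ Ω, DifferentiableAt ℝ lam p) (h : IsLiouvilleImmersion ε Ω lam ψ) :
    KHolomorphicOn (weierstrassF ε ψ) Ω ∧
    IsMeromorphicWithPoles (weierstrassG ε ψ) (weierstrassPoles ε ψ Ω) Ω ∧
    HasOnlySimplePoles (weierstrassG ε ψ) (weierstrassPoles ε ψ Ω) ∧
    ∀ p ∈ Ω \ weierstrassPoles ε ψ Ω,
      (∀ j, 2 * phi ε ψ p j =
        weierstrassVector ε (weierstrassF ε ψ p) (weierstrassG ε ψ p) j) ∧
      0 < (dz (weierstrassG ε ψ) p).norm ∧ (weierstrassG ε ψ p).norm ≠ ε ∧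
      weierstrassF ε ψ p = -ε • (dz (weierstrassG ε ψ) p)⁻¹ ∧
      Real.exp (2 * lam p) = (1 - ε * (weierstrassG ε ψ p).norm) ^ 2 /
        (4 * (dz (weierstrassG ε ψ) p).norm) := by
  have hphi := h.isKSmooth_phi hε hΩ hlam
  have hphi' : ∀ q ∈ Ω, ∀ j, phi ε ψ q j = nullVector ε (dX ψ q) (dY ψ q) j :=
    fun q hq => phi_eq (h.hasFDerivAt_self hΩ hq)
  have hω : unitI ε * unitI ε = -algebraMap ℝ (KNum ε) ε := by ext <;> simp
  have h2 : ∀ z : KNum ε, (1 / 2 : ℝ) • (2 * z) = z := fun z => by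
    rw [Algebra.smul_def, ← mul_assoc,
      show (2 : KNum ε) = algebraMap ℝ (KNum ε) 2 from (map_ofNat _ 2).symm, ← map_mul]
    norm_num
  rcases hε with rfl | rfl
  · have hN : IsNullCurve (ε := 1) Ω (fun q => Real.exp (2 * lam q)) _ _ _ _ _ _ _ :=
      ⟨fun q hq => by
        have := isNullTriple_riemannian (Real.exp_pos _) (h.isAdapted (Or.inl rfl) hq)
          (h.lor_lcross_normalN (Or.inl rfl) hq)
        simp only [← hphi' q hq, exp_neg_two_mul_inv] at this
        exact this,
      (hphi 0).linearCombination (-1) (unitI 1) (hphi 1),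
      (hphi 0).linearCombination (-1) (-unitI 1) (hphi 1), hphi 2⟩
    have hF : weierstrassF 1 ψ = fun q => -(2 * algebraMap ℝ (KNum 1) 1) *
        (-1 * phi 1 ψ q 0 + unitI 1 * phi 1 ψ q 1) := by
      ext1 q
      rw [weierstrassF, if_pos rfl, map_one]; ring
    have hG : weierstrassG 1 ψ = fun q => phi 1 ψ q 2 /
        (-1 * phi 1 ψ q 0 + unitI 1 * phi 1 ψ q 1) := by
      ext1 q
      rw [weierstrassG, if_pos rfl, neg_one_mul]
    obtain ⟨h1, h3, h4, h5⟩ := hN.weierstrass (Or.inl rfl) hΩ hF hG rfl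
    refine ⟨h1, h3, h4, fun p hp => ?_⟩
    obtain ⟨k1, k2, k3, k4, k5, k6⟩ := h5 p hp
    refine ⟨?_, k1, k2, k3, k4⟩
    have hFp := congrFun hF p
    rw [map_one] at hω hFp
    generalize weierstrassG 1 ψ p = g at *
    rw [hFp, weierstrassVector, if_pos rfl]
    intro j
    fin_cases j
    -- Since a g² = b, the vector has components -(a + b), -i(a - b) and 2c in terms of the null
    -- coordinates; inverting the coordinate change gives 2φ.
    · change 2 * phi 1 ψ p 0 = (1 / 2 : ℝ) • _
      rw [← h2 (2 * phi 1 ψ p 0)]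
      congr 1
      linear_combination 2 * g * k5 + 2 * k6
    · change 2 * phi 1 ψ p 1 = (1 / 2 : ℝ) • _
      rw [← h2 (2 * phi 1 ψ p 1)]
      congr 1
      linear_combination -2 * unitI 1 * g * k5 - 2 * unitI 1 * k6 + 4 * phi 1 ψ p 1 * hω
    · change 2 * phi 1 ψ p 2 = -_
      linear_combination -2 * k5
  · have hN : IsNullCurve (ε := -1) Ω (fun q => Real.exp (2 * lam q)) _ _ _ _ _ _ _ :=
      ⟨fun q hq => by
        have := isNullTriple_lorentzian (Real.exp_pos _) (h.isAdapted (Or.inr rfl) hq)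
          (h.lor_lcross_normalN (Or.inr rfl) hq)
        simp only [← hphi' q hq, exp_neg_two_mul_inv] at this
        exact this,
      (hphi 1).linearCombination 1 (unitI (-1)) (hphi 2),
      (hphi 1).linearCombination (-1) (unitI (-1)) (hphi 2), hphi 0⟩
    have hne : ¬ (-1 : ℝ) = 1 := by norm_num
    have hF : weierstrassF (-1) ψ = fun q => -(2 * algebraMap ℝ (KNum (-1)) (-1)) *
        (1 * phi (-1) ψ q 1 + unitI (-1) * phi (-1) ψ q 2) := by
      ext1 q
      rw [weierstrassF, if_neg hne, map_neg, map_one]; ring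
    have hG : weierstrassG (-1) ψ = fun q => phi (-1) ψ q 0 /
        (1 * phi (-1) ψ q 1 + unitI (-1) * phi (-1) ψ q 2) := by
      ext1 q
      rw [weierstrassG, if_neg hne, one_mul]
    obtain ⟨h1, h3, h4, h5⟩ := hN.weierstrass (Or.inr rfl) hΩ hF hG rfl
    refine ⟨h1, h3, h4, fun p hp => ?_⟩
    obtain ⟨k1, k2, k3, k4, k5, k6⟩ := h5 p hp
    refine ⟨?_, k1, k2, k3, k4⟩
    have hFp := congrFun hF p
    rw [map_neg, map_one] at hω hFp
    generalize weierstrassG (-1) ψ p = g at *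
    rw [hFp, weierstrassVector, if_neg hne]
    intro j
    fin_cases j
    · change 2 * phi (-1) ψ p 0 = _ * g
      linear_combination -2 * k5
    · change 2 * phi (-1) ψ p 1 = (1 / 2 : ℝ) • _
      rw [← h2 (2 * phi (-1) ψ p 1)]
      congr 1
      linear_combination 2 * g * k5 + 2 * k6
    · change 2 * phi (-1) ψ p 2 = (1 / 2 : ℝ) • _
      rw [← h2 (2 * phi (-1) ψ p 2)]
      congr 1
      linear_combination -2 * unitI (-1) * g * k5 - 2 * unitI (-1) * k6 -
        4 * phi (-1) ψ p 2 * hω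

end IsLiouvilleImmersion

end WeierstrassPair

end LiouvilleMinimal

/-! ### The proposition assembled -/

theorem mainTheorem3 (ε : ℝ) (hε : ε = 1 ∨ ε = -1)
    (Ω : Set (ℝ × ℝ)) (hΩ : IsOpen Ω) (hsc : IsSimplyConnected Ω)
    (lam : ℝ × ℝ → ℝ) (hlam : ContDiffOn ℝ ∞ lam Ω)
    (hL : ∀ p ∈ Ω, laplaceBeltrami ε lam lam p = -ε * Real.exp (-4 * lam p)) :
    -- existence of the immersion
    (∃ ψ, IsLiouvilleImmersion ε Ω lam ψ) ∧
    -- uniqueness up to a rigid motion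
    (∀ ψ, IsLiouvilleImmersion ε Ω lam ψ → ∀ ψ' : ℝ × ℝ → L3,
      IsLiouvilleImmersion ε Ω lam ψ' ↔
        ∃ Φ : L3 → L3, IsRigidMotion Φ ∧ ∀ p ∈ Ω, ψ' p = Φ (ψ p)) ∧
    -- properties of the immersion
    (∀ ψ, IsLiouvilleImmersion ε Ω lam ψ →
      -- spacelike or timelike, minimal, without umbilic points
      (∀ p ∈ Ω, (ε = 1 → IsSpacelikeAt ψ p) ∧ (ε = -1 → IsTimelikeAt ψ p) ∧
        lor (normalN ε ψ p) (normalN ε ψ p) = -ε ∧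
        meanCurvature ε ψ p = 0 ∧ ¬ IsUmbilic ε ψ p) ∧
      -- the coordinate lines are lines of curvature; principal and Gaussian curvatures
      (∀ p ∈ Ω, IsPrincipal ε ψ p (Real.exp (-2 * lam p)) (1, 0) ∧
        IsPrincipal ε ψ p (-Real.exp (-2 * lam p)) (0, 1) ∧
        (∀ k, IsPrincipalCurvature ε ψ p k ↔
          k = Real.exp (-2 * lam p) ∨ k = -Real.exp (-2 * lam p)) ∧
        gaussCurvature ε ψ p = -ε * (Real.exp (-2 * lam p) * -Real.exp (-2 * lam p)) ∧
        gaussCurvature ε ψ p = ε * Real.exp (-4 * lam p) ∧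
        0 < ε * gaussCurvature ε ψ p ∧
        IsWeingartenDiagonalizable ε ψ p) ∧
      -- the Weierstrass pair `(f dz, g)` of `ψ`
      KHolomorphicOn (weierstrassF ε ψ) Ω ∧
      IsMeromorphicWithPoles (weierstrassG ε ψ) (weierstrassPoles ε ψ Ω) Ω ∧
      HasOnlySimplePoles (weierstrassG ε ψ) (weierstrassPoles ε ψ Ω) ∧
      (∀ p ∈ Ω \ weierstrassPoles ε ψ Ω,
        (∀ j, 2 * phi ε ψ p j =
          weierstrassVector ε (weierstrassF ε ψ p) (weierstrassG ε ψ p) j) ∧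
        0 < (dz (weierstrassG ε ψ) p).norm ∧
        (weierstrassG ε ψ p).norm ≠ ε ∧
        weierstrassF ε ψ p = -ε • (dz (weierstrassG ε ψ) p)⁻¹ ∧
        -- the Liouville formula
        Real.exp (2 * lam p) =
          (1 - ε * (weierstrassG ε ψ p).norm) ^ 2 /
            (4 * (dz (weierstrassG ε ψ) p).norm))) := by
  have hd : ∀ p ∈ Ω, DifferentiableAt ℝ lam p := fun p hp =>
    (hlam.contDiffAt (hΩ.mem_nhds hp)).differentiableAt (by simp)
  have hexp : ∀ p, Real.exp (-4 * lam p) = Real.exp (-2 * lam p) * Real.exp (-2 * lam p) :=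
    fun p => by rw [← Real.exp_add]; ring_nf
  have hε2 : ε * ε = 1 := by rcases hε with rfl | rfl <;> norm_num
  refine ⟨exists_isLiouvilleImmersion hε hΩ hsc hlam hL, fun ψ h ψ' => ⟨fun h' =>
    h.exists_rigidMotion hε hΩ hsc.isPathConnected.isConnected.isPreconnected hsc.nonempty hd h',
    fun ⟨Φ, hΦ, hψ'⟩ => h.rigidMotion hΩ hΦ hψ'⟩, fun ψ h => ⟨fun p hp => ⟨?_, ?_,
    (h.isAdapted hε hp).NN, h.meanCurvature_eq_zero hp, h.not_isUmbilic hε hΩ hd hp⟩,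
    fun p hp => ⟨h.isPrincipal_x hε hΩ hd hp, h.isPrincipal_y hε hΩ hd hp,
      h.isPrincipalCurvature_iff hε hΩ hd hp, ?_, ?_, ?_,
      h.isWeingartenDiagonalizable hε hΩ hd hp⟩, h.weierstrass hε hΩ hd⟩⟩
  · rintro rfl
    exact h.isSpacelikeAt hp
  · rintro rfl
    exact h.isTimelikeAt hp
  · rw [h.gaussCurvature_eq hε hp]
    ring
  · rw [h.gaussCurvature_eq hε hp, hexp]
  · rw [h.gaussCurvature_eq hε hp, ← mul_assoc, hε2, one_mul]
    positivity
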